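/- Let $k$ be a positive even integer. A digraph $G=(V,E)$ is finite and loopless, $E$ is a set of ordered pairs of vertices (antiparallel pairs are allowed), and $|G|=|V|+|E|$. Connectivity notions refer to the underlying undirected graph; a digraph is \emph{biconnected} if it is connected, has at least two vertices and has no cut-vertex, and the \emph{blocks} of $G$ are its maximal biconnected subgraphs. In a planar embedding $\mathcal E$ of $G$ (given by the circular orders of the edges around the vertices), the \emph{modality} of a vertex $v$ is the number of pairs of consecutive edges around $v$ one of which is incoming at $v$ and the other outgoing from $v$. A \emph{maximum-modality function} is a function $m\colon V\to\{0,2,4,\dots,k\}$. The problem \textsc{$k$-MaxModality} asks, for a given pair $\langle G,m\rangle$, whether $G$ has a planar embedding in which every vertex $v$ has modality at most $m(v)$. Theorem. \textsc{$k$-MaxModality} for simply-connected (i.e. connected) digraphs is Turing-reducible to \textsc{$k$-MaxModality} for biconnected digraphs: given a subroutine \textsc{TestBiconnected} that tests \textsc{$k$-MaxModality} for biconnected instances, there is a procedure \textsc{TestSimplyConnected}, running on a random access machine with uniform cost (with addition, subtraction and halving as arithmetic operations) and calling the subroutine, that tests \textsc{$k$-MaxModality} for simply-connected digraphs. On an instance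 $\langle G,m\rangle$ with $G$ connected, its running time, including the time spent in the calls of the subroutine, is $$O\Big(|G|+\log k\sum_{\beta} r(\beta)\Big),$$ where the sum ranges over the blocks $\beta$ of $G$ (the blocks of its BC-tree), and $r(\beta)$ is the cost of testing the block $\beta$, i.e. the maximum running time of \textsc{TestBiconnected}$(\langle\beta,m'\rangle)$ (at least one step) over all encodings of the pair $\langle\beta,m'\rangle$, where $m'$ ranges over the maximum-modality functions that satisfy $m'\le m$ and agree with $m$ except possibly at cut-vertices of $G$. Neither the procedure nor the constant hidden in the $O$-notation depends on $k$, $G$, $m$ or the subroutine. -/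

import Mathlib

namespace KModal

/-! ## Digraphs, connectivity, blocks

A digraph is Mathlib's `Digraph V`: its edges are the ordered pairs `(u, v)` with `G.Adj u v`.
Antiparallel pairs of edges are allowed. Connectivity refers to the underlying undirected graph
`G.toSimpleGraphInclusive`. -/

section Graphs

variable {V : Type}

/-- The edge `uv`, directed from `u` to `v`, is the pair `(u, v)`. -/
abbrev Edge (G : Digraph V) : Type := {p : V × V // G.Adj p.1 p.2}

/-- The size `|G| = |V(G)| + |E(G)|`. -/
noncomputable def size (G : Digraph V) : ℕ := Nat.card V + Nat.card (Edge G)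

def Loopless (G : Digraph V) : Prop := ∀ v, ¬ G.Adj v v

/-- `G` is (simply) connected; in particular it has a vertex. -/
def SimplyConnected (G : Digraph V) : Prop := G.toSimpleGraphInclusive.Connected

/-- `v` is a cut-vertex of the connected digraph `G`: deleting `v` disconnects `G`. -/
def IsCutVertex (G : Digraph V) (v : V) : Prop :=
  ¬ (G.toSimpleGraphInclusive.induce ({v}ᶜ : Set V)).Preconnected

/-- `G` is connected, has no cut-vertex, and has at least two vertices. (A pair of vertices
joined by one edge, or by two antiparallel edges, is biconnected: it can be a block.) -/
def Biconnected (G : Digraph V) : Prop :=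
  Nontrivial V ∧ SimplyConnected G ∧ ∀ v, ¬ IsCutVertex G v

/-- The subgraph of `G` induced by the vertex set `B`. -/
def induce (G : Digraph V) (B : Finset V) : Digraph B where
  Adj u v := G.Adj u v

open Classical in
/-- The blocks of `G`, i.e. its maximal biconnected subgraphs. A block is an induced subgraph and
is given by its vertex set. -/
noncomputable def blocks [Fintype V] (G : Digraph V) : Finset (Finset V) :=
  Finset.univ.filter fun B => Maximal (fun A : Finset V => Biconnected (induce G A)) B

/-! ## Planar embeddings and modality

A planar embedding is given by its rotation system: the circular orders of the edges around the
vertices. The rotation system is planar when it satisfies Euler's formula. -/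

/-- Edge ends: `(e, true)` is the end of `e` at its tail (where `e` is outgoing), `(e, false)` is
the end of `e` at its head (where `e` is incoming). -/
abbrev Dart (G : Digraph V) : Type := Edge G × Bool

/-- The vertex at which an edge end lies. -/
def Dart.vertex {G : Digraph V} (d : Dart G) : V := if d.2 then d.1.1.1 else d.1.1.2

/-- The orientation of the edge at this end: `true` for outgoing, `false` for incoming. -/
def Dart.outgoing {G : Digraph V} (d : Dart G) : Bool := d.2

/-- The involution that exchanges the two ends of every edge. -/
def flip (G : Digraph V) : Equiv.Perm (Dart G) := Equiv.prodCongr (Equiv.refl _) Equiv.boolNot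

/-- The number of boundary walks of faces, over all connected components: the orbits of the face
permutation, and one trivial walk for each isolated vertex. -/
noncomputable def numFaces (G : Digraph V) (rot : Equiv.Perm (Dart G)) : ℕ :=
  Nat.card (Quotient (Equiv.Perm.SameCycle.setoid (rot * flip G))) +
    Nat.card {v : V // ∀ d : Dart G, d.vertex ≠ v}

/-- A (combinatorial) planar embedding of a finite digraph. The permutation `rot` maps each edge
end to the next one in the circular order around its vertex. -/
structure Embedding (G : Digraph V) where
  rot : Equiv.Perm (Dart G)
  /-- The cycles of `rot` are exactly the sets of edge ends at the non-isolated vertices. -/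
  isRotation : ∀ d d' : Dart G, rot.SameCycle d d' ↔ d.vertex = d'.vertex
  /-- Euler's formula `|V| - |E| + |F| = 2c`, where `c` is the number of components: each
  component is embedded in the sphere. -/
  planar : Nat.card V + numFaces G rot =
    Nat.card (Edge G) + 2 * Nat.card G.toSimpleGraphInclusive.ConnectedComponent

/-- The modality of `v`: the number of alternating pairs of consecutive edges around `v`. -/
noncomputable def Embedding.modality {G : Digraph V} (E : Embedding G) (v : V) : ℕ :=
  Nat.card {d : Dart G // d.vertex = v ∧ Dart.outgoing (E.rot d) ≠ Dart.outgoing d}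

/-- `m` is a maximum-modality function: its values are even and at most `k`. -/
def IsMaxModalityFunction (k : ℕ) (m : V → ℕ) : Prop := ∀ v, Even (m v) ∧ m v ≤ k

/-- `⟨G, m⟩` is a positive instance of MaxModality. -/
def MaxModality (G : Digraph V) (m : V → ℕ) : Prop :=
  ∃ E : Embedding G, ∀ v, E.modality v ≤ m v

/-- The list of numbers `L` is an encoding of `⟨G, m⟩`: for some numbering `0, …, n - 1` of the
vertices and some ordering of the edges, `L` consists of the number `n` of vertices, the number of
edges, the values of `m`, and the tails and heads of the edges. -/
def Encodes (G : Digraph V) (m : V → ℕ) (L : List ℕ) : Prop :=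
  ∃ (n : ℕ) (f : Fin n ≃ V) (E : List (V × V)),
    E.Nodup ∧ (∀ p, p ∈ E ↔ G.Adj p.1 p.2) ∧
    L = [n, E.length] ++ List.ofFn (fun i => m (f i)) ++
      E.flatMap (fun p => [(f.symm p.1 : ℕ), (f.symm p.2 : ℕ)])

end Graphs

/-! ## The machine model

A random access machine with uniform cost, programmed in a small imperative language. The memory
consists of registers and of arrays, all holding natural numbers. A program mentions only finitely
many registers and arrays. Arithmetic consists of addition, truncated subtraction and halving. A
program may call an external subroutine. -/

/-- A subroutine that gets a list of numbers and returns a yes/no answer, with its running time on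
each input. -/
structure Subroutine where
  answer : List ℕ → Bool
  time : List ℕ → ℕ
  time_pos : ∀ L, 0 < time L

structure State where
  reg : ℕ → ℕ
  arr : ℕ → ℕ → ℕ

inductive Expr : Type
  | const (c : ℕ)
  | reg (x : ℕ)
  | read (a : ℕ) (i : Expr)
  | add (e₁ e₂ : Expr)
  | sub (e₁ e₂ : Expr)
  | half (e : Expr)

def Expr.eval (s : State) : Expr → ℕ
  | .const c => c
  | .reg x => s.reg x
  | .read a i => s.arr a (i.eval s)
  | .add e₁ e₂ => e₁.eval s + e₂.eval s
  | .sub e₁ e₂ => e₁.eval s - e₂.eval s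
  | .half e => e.eval s / 2

/-- The number of steps taken by the evaluation of an expression. -/
def Expr.cost : Expr → ℕ
  | .const _ => 1
  | .reg _ => 1
  | .read _ i => i.cost + 1
  | .add e₁ e₂ => e₁.cost + e₂.cost + 1
  | .sub e₁ e₂ => e₁.cost + e₂.cost + 1
  | .half e => e.cost + 1

/-- Programs. `call x a o` passes to the subroutine, by reference, the instance that is stored in
array `a` from position `o` on, and stores the answer in register `x`. -/
inductive Prog : Type
  | skip
  | assign (x : ℕ) (e : Expr)
  | write (a : ℕ) (i e : Expr)
  | seq (p q : Prog)
  | cond (c : Expr) (p q : Prog)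
  | loop (c : Expr) (p : Prog)
  | call (x a : ℕ) (o : Expr)

def State.setReg (s : State) (x v : ℕ) : State :=
  { s with reg := Function.update s.reg x v }

def State.setArr (s : State) (a i v : ℕ) : State :=
  { s with arr := Function.update s.arr a (Function.update (s.arr a) i v) }

/-- The encoded instance stored in array `a` from position `o` on. Its first two entries, the
numbers of vertices and edges, determine its length. -/
def State.stored (s : State) (a o : ℕ) : List ℕ :=
  List.ofFn fun i : Fin (2 + s.arr a o + 2 * s.arr a (o + 1)) => s.arr a (o + i)

/-- `Exec T p s s' t`: with the subroutine `T`, the program `p` started in state `s` halts in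
state `s'` after `t` steps. The time spent in calls of the subroutine is included. -/
inductive Exec (T : Subroutine) : Prog → State → State → ℕ → Prop
  | skip (s : State) : Exec T .skip s s 1
  | assign (x : ℕ) (e : Expr) (s : State) :
      Exec T (.assign x e) s (s.setReg x (e.eval s)) (e.cost + 1)
  | write (a : ℕ) (i e : Expr) (s : State) :
      Exec T (.write a i e) s (s.setArr a (i.eval s) (e.eval s)) (i.cost + e.cost + 1)
  | seq {p q : Prog} {s s' s'' : State} {t t' : ℕ} :
      Exec T p s s' t → Exec T q s' s'' t' → Exec T (.seq p q) s s'' (t + t')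
  | cond_true {c : Expr} {p q : Prog} {s s' : State} {t : ℕ} :
      c.eval s ≠ 0 → Exec T p s s' t → Exec T (.cond c p q) s s' (c.cost + 1 + t)
  | cond_false {c : Expr} {p q : Prog} {s s' : State} {t : ℕ} :
      c.eval s = 0 → Exec T q s s' t → Exec T (.cond c p q) s s' (c.cost + 1 + t)
  | loop_true {c : Expr} {p : Prog} {s s' s'' : State} {t t' : ℕ} :
      c.eval s ≠ 0 → Exec T p s s' t → Exec T (.loop c p) s' s'' t' →
      Exec T (.loop c p) s s'' (c.cost + 1 + t + t')
  | loop_false {c : Expr} {p : Prog} {s : State} :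
      c.eval s = 0 → Exec T (.loop c p) s s (c.cost + 1)
  | call (x a : ℕ) (o : Expr) (s : State) :
      Exec T (.call x a o) s
        (s.setReg x (if T.answer (s.stored a (o.eval s)) then 1 else 0))
        (o.cost + 1 + T.time (s.stored a (o.eval s)))

/-- The initial state: the input is stored in array `0`, everything else is `0`. -/
def initState (L : List ℕ) : State where
  reg _ := 0
  arr a i := if a = 0 then L.getD i 0 else 0

/-! ## The two testing procedures -/

/-- `T` tests `k`-MaxModality for biconnected instances. Nothing is required of its answers on
other inputs. -/
def TestsBiconnected (k : ℕ) (T : Subroutine) : Prop :=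
  ∀ (V : Type) [Fintype V] (G : Digraph V) (m : V → ℕ), Loopless G → Biconnected G →
    IsMaxModalityFunction k m → ∀ L, Encodes G m L → (T.answer L = true ↔ MaxModality G m)

/-- `r` bounds, for each block `β` of `G`, the running time of `T` for testing `β`: the running
time on every encoding of `⟨β, m'⟩`, where the maximum-modality function `m'` is `m`, possibly
with smaller values at the cut-vertices of `G`. -/
def BoundsBlockTimes {V : Type} [Fintype V] (T : Subroutine) (G : Digraph V) (m : V → ℕ)
    (r : Finset V → ℕ) : Prop :=
  ∀ β ∈ blocks G, ∀ m' : V → ℕ, (∀ v, Even (m' v) ∧ m' v ≤ m v) →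
    (∀ v, ¬ IsCutVertex G v → m' v = m v) →
    ∀ L, Encodes (induce G β) (fun v => m' v) L → T.time L ≤ r β

end KModal

/-! The crux is how modality adds up at a cut-vertex. If planar embeddings of two subgraphs that
meet only in `c` have the even modalities `a` and `b` at `c`, they can be merged so that the
modality at `c` is at most `2` when `a = b = 0`, at most the larger one when exactly one of them is
`0`, and at most `a + b - 2` otherwise (`SubEmbedding.merge`). Conversely, a planar embedding can be
split at a cut-vertex without losing more than that (`SubEmbedding.split`). In terms of the
truncated difference "modality minus 2", merging is subadditive and splitting superadditive.
Iterating over the blocks gives `BlockSequence.maxModality_iff_exists`: the instance is positive iff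
the blocks have planar embeddings whose reduced modalities at each `v` sum to at most `m v - 2`, and
every `v` with `m v = 0` has edges of one orientation only. The last condition is separate because
truncation cannot tell `0` from `2`.

Planarity is treated algebraically. A rotation system is a permutation of the edge ends, and for a
connected graph Euler's formula says that the genus of the pair (rotation, edge flip) vanishes.
Splitting or merging at a vertex multiplies the rotation by a transposition, so the counts of
vertices and faces each change by exactly one. Hence the genus does not grow under splitting
(`genus_split_le`), it is never negative (`genus_nonneg`), and a planar embedding split at two
corners of the same face falls apart (`split_of_same_face`).

The algorithm is greedy. A depth-first search arranges the blocks in a rooted tree, where each block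
has a head, its vertex nearest to the root. Blocks are handled from the leaves upwards, with a
remaining budget for each vertex. All vertices of a block except its head are given their remaining
budgets, the least admissible value `h` at the head is found by bisection, and `h - 2` is deducted
from the budget of the head. No solution spends less there (the field `optimal` of `Greedy`), so a
block that fails even with the whole remaining budget refutes the instance; if all blocks pass,
their embeddings combine (`Greedy.maxModality`). The last block, with top `1`, is tested only once,
with the whole remaining budget, because its head, the root, need not be a cut-vertex.

Bisection over at most `k / 2` values costs at most `log k` further calls per block. Everything else
is linear: low points determine the blocks, each block is stored once as an encoded instance, and a
trial overwrites only the single cell with the value of the head. Correctness and step counts of the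
program are derived together in the calculus `WP`. -/

namespace KModal

open Equiv Equiv.Perm

/-! ### Genus of a pair of permutations under multiplication by transpositions. -/

section Genus

variable {D : Type}

/-- The equivalence relation whose classes are the cycles of `σ`. -/
abbrev cycles (σ : Perm D) : Setoid D := SameCycle.setoid σ

/-- Universal property of the orbit relation. It reduces every later claim that something is
constant along cycles to a single application of the permutation. -/
theorem cycles_le_iff {σ : Perm D} {t : Setoid D} : cycles σ ≤ t ↔ ∀ a, t a (σ a) := by
  constructor
  · intro h a
    exact h (show σ.SameCycle a (σ a) from ⟨1, by simp⟩)
  · rintro h a b ⟨i, rfl⟩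
    have hinv : ∀ a, t a (σ⁻¹ a) := fun a => by
      have := h (σ⁻¹ a)
      simp only [← Perm.mul_apply, mul_inv_cancel, Perm.one_apply] at this
      exact t.symm this
    induction i using Int.induction_on with
    | zero => exact t.refl a
    | succ i ih =>
      rw [add_comm, zpow_add, zpow_one, Perm.mul_apply]
      exact t.trans ih (h _)
    | pred i ih =>
      rw [sub_eq_add_neg, add_comm, zpow_add, zpow_neg_one, Perm.mul_apply]
      exact t.trans ih (hinv _)

/-- The equivalence relation `s` with the classes of `x` and `y` merged. -/
def glue (s : Setoid D) (x y : D) : Setoid D where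
  r a b := s a b ∨ (s a x ∧ s y b) ∨ (s a y ∧ s x b)
  iseqv := by
    refine ⟨fun a => Or.inl (s.refl a), ?_, ?_⟩
    · rintro a b (h | ⟨h, h'⟩ | ⟨h, h'⟩)
      · exact Or.inl (s.symm h)
      · exact Or.inr (Or.inr ⟨s.symm h', s.symm h⟩)
      · exact Or.inr (Or.inl ⟨s.symm h', s.symm h⟩)
    · rintro a b c (h | ⟨h, h'⟩ | ⟨h, h'⟩) (g | ⟨g, g'⟩ | ⟨g, g'⟩)
      · exact Or.inl (s.trans h g)
      · exact Or.inr (Or.inl ⟨s.trans h g, g'⟩)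
      · exact Or.inr (Or.inr ⟨s.trans h g, g'⟩)
      · exact Or.inr (Or.inl ⟨h, s.trans h' g⟩)
      · exact Or.inr (Or.inl ⟨h, g'⟩)
      · exact Or.inl (s.trans h g')
      · exact Or.inr (Or.inr ⟨h, s.trans h' g⟩)
      · exact Or.inl (s.trans h g')
      · exact Or.inr (Or.inr ⟨h, g'⟩)

theorem glue_apply {s : Setoid D} {x y a b : D} :
    glue s x y a b ↔ s a b ∨ (s a x ∧ s y b) ∨ (s a y ∧ s x b) := Iff.rfl

theorem glue_le_iff {s t : Setoid D} {x y : D} : glue s x y ≤ t ↔ s ≤ t ∧ t x y := by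
  constructor
  · intro h
    exact ⟨fun a b hab => h (Or.inl hab), h (Or.inr (Or.inl ⟨s.refl x, s.refl y⟩))⟩
  · rintro ⟨h, hxy⟩ a b (g | ⟨g, g'⟩ | ⟨g, g'⟩)
    · exact h g
    · exact t.trans (h g) (t.trans hxy (h g'))
    · exact t.trans (h g) (t.trans (t.symm hxy) (h g'))

theorem le_glue {s : Setoid D} {x y : D} : s ≤ glue s x y := (glue_le_iff.1 le_rfl).1

theorem glue_self {s : Setoid D} {x y : D} : glue s x y x y := (glue_le_iff.1 le_rfl).2

theorem glue_eq_self {s : Setoid D} {x y : D} (h : s x y) : glue s x y = s :=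
  le_antisymm (glue_le_iff.2 ⟨le_rfl, h⟩) le_glue

/-- The number of classes of an equivalence relation. -/
noncomputable def numClasses (s : Setoid D) : ℕ := Nat.card (Quotient s)

/-- The classes after gluing are represented by the old classes other than that of `y`. -/
theorem numClasses_glue [Finite D] {s : Setoid D} {x y : D} (h : ¬ s x y) :
    numClasses (glue s x y) + 1 = numClasses s := by
  classical
  have := Fintype.ofFinite (Quotient s)
  have e : Nat.card {q : Quotient s // q ≠ Quotient.mk s y} = numClasses (glue s x y) := by
    refine Nat.card_congr (Equiv.ofBijective
      (fun q => Quotient.map' (s₁ := s) (s₂ := glue s x y) id (fun a b hab => le_glue hab) q.1)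
      ⟨?_, ?_⟩)
    · rintro ⟨⟨a⟩, ha⟩ ⟨⟨b⟩, hb⟩ hab
      have hay : ¬ s a y := fun h => ha (Quotient.sound h)
      have hby : ¬ s b y := fun h => hb (Quotient.sound h)
      have hab' : glue s x y a b := Quotient.exact hab
      rcases glue_apply.1 hab' with g | ⟨g, g'⟩ | ⟨g, g'⟩
      · exact Subtype.ext (Quotient.sound g)
      · exact absurd (s.symm g') hby
      · exact absurd g hay
    · rintro ⟨a⟩
      by_cases hay : s a y
      · refine ⟨⟨Quotient.mk s x, fun h' => h (Quotient.exact h')⟩, Quotient.sound ?_⟩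
        exact Or.inr (Or.inl ⟨s.refl x, s.symm hay⟩)
      · exact ⟨⟨Quotient.mk s a, fun h' => hay (Quotient.exact h')⟩, rfl⟩
  rw [← e, numClasses, Nat.card_eq_fintype_card, Nat.card_eq_fintype_card]
  have := Fintype.card_subtype_compl (fun q : Quotient s => q = Quotient.mk s y)
  have hpos : 0 < Fintype.card (Quotient s) := Fintype.card_pos_iff.2 ⟨Quotient.mk s y⟩
  simp only [Fintype.card_subtype_eq] at this
  simp only [ne_eq]
  omega

/-- The number of cycles of a permutation, fixed points included. -/
noncomputable def cyc (σ : Perm D) : ℕ := numClasses (cycles σ)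

/-- The number of orbits of the group generated by `σ` and `α`. -/
noncomputable def orb (σ α : Perm D) : ℕ := numClasses (cycles σ ⊔ cycles α)

theorem cycles_mul_le (σ α : Perm D) : cycles (σ * α) ≤ cycles σ ⊔ cycles α := by
  rw [cycles_le_iff]
  intro a
  have h1 : ∀ a, (cycles σ ⊔ cycles α) a (σ a) := cycles_le_iff.1 le_sup_left
  have h2 : ∀ a, (cycles σ ⊔ cycles α) a (α a) := cycles_le_iff.1 le_sup_right
  exact (cycles σ ⊔ cycles α).trans (h2 a) (h1 (α a))

/-- Twice the genus of the hypermap `(σ, α)`. -/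
noncomputable def genus (σ α : Perm D) : ℤ :=
  Nat.card D + 2 * orb σ α - cyc σ - cyc (σ * α) - cyc α

variable [DecidableEq D]

theorem cycles_mul_swap_le (σ : Perm D) (x y : D) :
    cycles (σ * swap x y) ≤ glue (cycles σ) x y := by
  rw [cycles_le_iff]
  intro a
  have h1 : ∀ a, glue (cycles σ) x y a (σ a) := cycles_le_iff.1 le_glue
  rw [Perm.mul_apply]
  rcases eq_or_ne a x with rfl | hx
  · rw [swap_apply_left]
    exact (glue _ _ _).trans glue_self (h1 y)
  · rcases eq_or_ne a y with rfl | hy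
    · rw [swap_apply_right]
      exact (glue _ _ _).trans ((glue _ _ _).symm glue_self) (h1 x)
    · rw [swap_apply_of_ne_of_ne hx hy]
      exact h1 a

/-- Multiplying twice by the same transposition gives back `σ`, so the inclusion
`cycles_mul_swap_le` can be used in both directions. The cycles of `σ` and of `σ * swap x y` thus
differ only in whether `x` and `y` are already related. -/
theorem glue_cycles_mul_swap (σ : Perm D) (x y : D) :
    glue (cycles (σ * swap x y)) x y = glue (cycles σ) x y := by
  apply le_antisymm
  · exact glue_le_iff.2 ⟨cycles_mul_swap_le σ x y, glue_self⟩
  · refine glue_le_iff.2 ⟨?_, glue_self⟩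
    have := cycles_mul_swap_le (σ * swap x y) x y
    rwa [mul_assoc, swap_mul_self, mul_one] at this

theorem glue_sup_cycles_mul_swap {σ α : Perm D} {x y : D} (h : σ.SameCycle x y) :
    glue (cycles (σ * swap x y) ⊔ cycles α) x y = cycles σ ⊔ cycles α := by
  have e := glue_cycles_mul_swap σ x y
  rw [glue_eq_self (s := cycles σ) h] at e
  apply le_antisymm
  · refine glue_le_iff.2 ⟨sup_le_sup_right ?_ _, (le_sup_left : cycles σ ≤ _) h⟩
    exact le_glue.trans_eq e
  · refine sup_le ?_ (le_sup_right.trans le_glue)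
    rw [← e]
    exact glue_le_iff.2 ⟨le_sup_left.trans le_glue, glue_self⟩

/-- With `σ` the rotation and `α` the flip, `σ * α` is the face permutation; a change of the
rotation by a transposition is also a transposition for the faces. -/
theorem mul_swap_mul (σ α : Perm D) (x y : D) :
    σ * swap x y * α = σ * α * swap (α⁻¹ x) (α⁻¹ y) := by
  rw [mul_assoc, swap_mul_eq_mul_swap, mul_assoc]

variable [Finite D]

/-- The new permutation sends `x` to `σ y` and then follows the old cycle of `y`, which avoids `x`,
until it arrives at `y`. -/
theorem sameCycle_mul_swap_of_not {σ : Perm D} {x y : D} (h : ¬ σ.SameCycle x y) :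
    (σ * swap x y).SameCycle x y := by
  have key : ∀ j : ℕ, (σ * swap x y).SameCycle x ((σ ^ (j + 1)) y) ∨
      (σ * swap x y).SameCycle x y := by
    intro j
    induction j with
    | zero => exact Or.inl ⟨1, by simp⟩
    | succ j ih =>
      rcases ih with ih | ih
      · by_cases hy : (σ ^ (j + 1)) y = y
        · rw [hy] at ih; exact Or.inr ih
        · left
          have hx : (σ ^ (j + 1)) y ≠ x := fun hx => h
            (SameCycle.symm ⟨(j + 1 : ℕ), by rw [zpow_natCast]; exact hx⟩)
          refine ih.trans ⟨1, ?_⟩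
          rw [zpow_one, Perm.mul_apply, swap_apply_of_ne_of_ne hx hy, pow_succ' σ (j + 1),
            Perm.mul_apply]
      · exact Or.inr ih
  have hpos := orderOf_pos σ
  rcases key (orderOf σ - 1) with h' | h'
  · rw [Nat.sub_add_cancel hpos, pow_orderOf_eq_one] at h'
    exact h'
  · exact h'

/-- If `p` is least with `(σ ^ p) y = x`, the new orbit of `x` consists of the points `(σ ^ j) y`
with `1 ≤ j ≤ p`: it closes up at `x` and never meets `y`. -/
theorem not_sameCycle_mul_swap {σ : Perm D} {x y : D} (hxy : x ≠ y) (h : σ.SameCycle x y) :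
    ¬ (σ * swap x y).SameCycle x y := by
  classical
  have hex : ∃ p : ℕ, (σ ^ p) y = x := h.symm.exists_nat_pow_eq
  set p := Nat.find hex with hp
  have hpx : (σ ^ p) y = x := Nat.find_spec hex
  have hmin : ∀ j < p, (σ ^ j) y ≠ x := fun j hj => Nat.find_min hex hj
  have hp0 : 0 < p := by
    rcases Nat.eq_zero_or_pos p with h0 | h0
    · rw [h0] at hpx; exact absurd hpx.symm hxy
    · exact h0
  have hy : ∀ j, 1 ≤ j → j ≤ p → (σ ^ j) y ≠ y := by
    intro j hj1 hjp hjy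
    apply hmin (p - j) (by omega)
    have : (σ ^ (p - j + j)) y = x := by rw [Nat.sub_add_cancel hjp]; exact hpx
    rwa [pow_add, Perm.mul_apply, hjy] at this
  have hinv : ∀ i : ℕ, ∃ j, 1 ≤ j ∧ j ≤ p ∧ ((σ * swap x y) ^ i) x = (σ ^ j) y := by
    intro i
    induction i with
    | zero => exact ⟨p, hp0, le_rfl, by simp [hpx]⟩
    | succ i ih =>
      obtain ⟨j, hj1, hjp, hj⟩ := ih
      rw [pow_succ' _ i, Perm.mul_apply, hj]
      rcases eq_or_lt_of_le hjp with rfl | hlt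
      · refine ⟨1, le_rfl, hp0, ?_⟩
        rw [Perm.mul_apply, hpx, swap_apply_left, pow_one]
      · refine ⟨j + 1, by omega, hlt, ?_⟩
        rw [Perm.mul_apply, swap_apply_of_ne_of_ne (hmin j hlt) (hy j hj1 hjp), pow_succ' σ j,
          Perm.mul_apply]
  intro hc
  obtain ⟨i, hi⟩ := hc.exists_nat_pow_eq
  obtain ⟨j, hj1, hjp, hj⟩ := hinv i
  exact hy j hj1 hjp (hj ▸ hi)

theorem cyc_mul_swap_of_sameCycle {σ : Perm D} {x y : D} (hxy : x ≠ y) (h : σ.SameCycle x y) :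
    cyc (σ * swap x y) = cyc σ + 1 := by
  have h1 := numClasses_glue (s := cycles (σ * swap x y)) (x := x) (y := y)
    (not_sameCycle_mul_swap hxy h)
  rw [glue_cycles_mul_swap, glue_eq_self (s := cycles σ) h] at h1
  exact h1.symm

theorem cyc_mul_swap_of_not {σ : Perm D} {x y : D} (h : ¬ σ.SameCycle x y) :
    cyc (σ * swap x y) + 1 = cyc σ := by
  have h1 := numClasses_glue (s := cycles σ) (x := x) (y := y) h
  rw [← glue_cycles_mul_swap, glue_eq_self (s := cycles (σ * swap x y))
    (sameCycle_mul_swap_of_not h)] at h1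
  exact h1

theorem genus_one (α : Perm D) : genus 1 α = 0 := by
  have h1 : cycles (1 : Perm D) = ⊥ := le_bot_iff.1 (cycles_le_iff.2 fun a => rfl)
  have h2 : cyc (1 : Perm D) = Nat.card D := by
    rw [cyc, h1, numClasses]
    refine (Nat.card_congr (Equiv.ofBijective (Quotient.mk ⊥) ⟨?_, Quotient.mk_surjective⟩)).symm
    intro a b h
    exact Quotient.exact h
  rw [genus, h2, one_mul, orb, h1, bot_sup_eq]
  simp only [cyc]
  ring

/-- The effect of splitting a cycle of `σ` on the numbers that make up the genus. -/
theorem split_cases {σ : Perm D} (α : Perm D) {x y : D} (h : σ.SameCycle x y) :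
    (¬ (cycles (σ * swap x y) ⊔ cycles α) x y ∧ ¬ (σ * swap x y * α).SameCycle (α⁻¹ x) (α⁻¹ y) ∧
      orb (σ * swap x y) α = orb σ α + 1) ∨
    ((cycles (σ * swap x y) ⊔ cycles α) x y ∧ orb (σ * swap x y) α = orb σ α) := by
  have e := glue_sup_cycles_mul_swap (α := α) h
  by_cases hc : (cycles (σ * swap x y) ⊔ cycles α) x y
  · exact Or.inr ⟨hc, by rw [orb, orb, ← e, glue_eq_self hc]⟩
  · refine Or.inl ⟨hc, fun hs => hc ?_, ?_⟩
    · have h1 : ∀ z, (cycles (σ * swap x y) ⊔ cycles α) (α⁻¹ z) z := fun z => by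
        have := (cycles_le_iff (t := cycles (σ * swap x y) ⊔ cycles α)).1 le_sup_right (α⁻¹ z)
        simpa using this
      exact Setoid.trans' _ (Setoid.trans' _ (Setoid.symm' _ (h1 x))
        (cycles_mul_le (σ * swap x y) α hs)) (h1 y)
    · rw [orb, orb, ← e]
      exact (numClasses_glue hc).symm

theorem cyc_split_mul (σ α : Perm D) {x y : D} (hxy : x ≠ y) :
    (¬ (σ * swap x y * α).SameCycle (α⁻¹ x) (α⁻¹ y) ∧ (σ * α).SameCycle (α⁻¹ x) (α⁻¹ y) ∧
      cyc (σ * swap x y * α) = cyc (σ * α) + 1) ∨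
    ((σ * swap x y * α).SameCycle (α⁻¹ x) (α⁻¹ y) ∧ ¬ (σ * α).SameCycle (α⁻¹ x) (α⁻¹ y) ∧
      cyc (σ * swap x y * α) + 1 = cyc (σ * α)) := by
  have hne : α⁻¹ x ≠ α⁻¹ y := fun h => hxy (α⁻¹.injective h)
  rw [mul_swap_mul]
  by_cases h : (σ * α).SameCycle (α⁻¹ x) (α⁻¹ y)
  · exact Or.inl ⟨not_sameCycle_mul_swap hne h, h, cyc_mul_swap_of_sameCycle hne h⟩
  · exact Or.inr ⟨sameCycle_mul_swap_of_not h, h, cyc_mul_swap_of_not h⟩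

/-- Splitting adds one cycle of `σ`. If it also separates an orbit of the group, the two corners end
up in different faces, so a face is gained too and the changes cancel. Otherwise the face count
changes by one either way, and the genus stays or drops by `2`. -/
theorem genus_split_le {σ : Perm D} (α : Perm D) {x y : D} (hxy : x ≠ y) (h : σ.SameCycle x y) :
    genus (σ * swap x y) α ≤ genus σ α := by
  have hc := cyc_mul_swap_of_sameCycle hxy h
  have h1 := split_cases α h
  have h2 := cyc_split_mul σ α hxy
  simp only [genus]
  rcases h1 with ⟨_, h1, h1'⟩ | ⟨_, h1'⟩ <;> rcases h2 with ⟨h2, _, h2'⟩ | ⟨h2, _, h2'⟩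
  · omega
  · exact absurd h2 h1
  · omega
  · omega

theorem cyc_le_card (σ : Perm D) : cyc σ ≤ Nat.card D :=
  Nat.card_le_card_of_surjective (Quotient.mk (cycles σ)) Quotient.mk_surjective

/-- Splitting off points one at a time leads to `σ = 1`, which has genus `0`, and no split increases
the genus. -/
theorem genus_nonneg (σ α : Perm D) : 0 ≤ genus σ α := by
  obtain ⟨k, hk⟩ : ∃ k, k = Nat.card D - cyc σ := ⟨_, rfl⟩
  induction k using Nat.strong_induction_on generalizing σ with
  | _ k ih =>
    by_cases h1 : σ = 1
    · rw [h1, genus_one]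
    · obtain ⟨x, hx⟩ : ∃ x, σ x ≠ x := by
        by_contra hcon
        push Not at hcon
        exact h1 (Perm.ext hcon)
      have hs : σ.SameCycle x (σ x) := ⟨1, by simp⟩
      have hc := cyc_mul_swap_of_sameCycle hx.symm hs
      have hle := cyc_le_card (σ * swap x (σ x))
      exact (ih _ (by omega) (σ * swap x (σ x)) rfl).trans (genus_split_le α hx.symm hs)

/-- Splitting a cycle of a planar hypermap at two corners of the same face disconnects it. -/
theorem split_of_same_face {σ α : Perm D} {x y : D} (hxy : x ≠ y) (h : σ.SameCycle x y)
    (hf : (σ * α).SameCycle (α⁻¹ x) (α⁻¹ y)) (hg : genus σ α = 0) :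
    genus (σ * swap x y) α = 0 ∧ ¬ (cycles (σ * swap x y) ⊔ cycles α) x y := by
  have hc := cyc_mul_swap_of_sameCycle hxy h
  have h1 := split_cases α h
  have h2 := cyc_split_mul σ α hxy
  have h3 := genus_nonneg (σ * swap x y) α
  simp only [genus] at hg h3 ⊢
  -- A split within one face gains a face. Were the orbit not separated, the genus would fall to
  -- `-2`.
  rcases h1 with ⟨h1, _, h1'⟩ | ⟨_, h1'⟩ <;> rcases h2 with ⟨_, _, h2'⟩ | ⟨_, h2, _⟩
  · exact ⟨by omega, h1⟩
  · exact absurd hf h2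
  · omega
  · exact absurd hf h2

/-- Merging cycles that lie in different components does not change the genus. -/
theorem genus_merge {σ α : Perm D} {x y : D} (h : ¬ (cycles σ ⊔ cycles α) x y) :
    genus (σ * swap x y) α = genus σ α := by
  have hxy : x ≠ y := fun e => h (e ▸ Setoid.refl' _ x)
  have hn : ¬ σ.SameCycle x y := fun hs => h ((le_sup_left : cycles σ ≤ _) hs)
  have hs := sameCycle_mul_swap_of_not hn
  have e : σ * swap x y * swap x y = σ := by rw [mul_assoc, swap_mul_self, mul_one]
  have h1 := split_cases α hs
  have h2 := cyc_split_mul (σ * swap x y) α hxy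
  have hc := cyc_mul_swap_of_not hn
  rw [e] at h1 h2
  simp only [genus]
  rcases h1 with ⟨_, h1, h1'⟩ | ⟨h1, _⟩
  · rcases h2 with ⟨_, _, h2'⟩ | ⟨h2, _⟩
    · omega
    · exact absurd h2 h1
  · exact absurd h1 h

end Genus
end KModal

namespace KModal

open Equiv Equiv.Perm

/-! ### Additivity of the genus over invariant parts. -/

section Sum

variable {D D' : Type}

theorem numClasses_congr {s : Setoid D} {s' : Setoid D'} (e : D' ≃ D)
    (h : ∀ x y, s' x y ↔ s (e x) (e y)) : numClasses s' = numClasses s :=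
  Nat.card_congr (Quotient.congr e h)

theorem cycles_le_comap {σ : Perm D} {σ' : Perm D'} {f : D' → D}
    (h : ∀ x, σ (f x) = f (σ' x)) {t : Setoid D} (ht : cycles σ ≤ t) :
    cycles σ' ≤ t.comap f := by
  rw [cycles_le_iff] at ht ⊢
  intro a
  show t (f a) (f (σ' a))
  rw [← h]
  exact ht _

theorem genus_congr {σ α : Perm D} {σ' α' : Perm D'} (e : D' ≃ D)
    (hσ : ∀ x, σ (e x) = e (σ' x)) (hα : ∀ x, α (e x) = e (α' x)) :
    genus σ' α' = genus σ α := by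
  have hsymm : ∀ {τ : Perm D} {τ' : Perm D'}, (∀ x, τ (e x) = e (τ' x)) →
      ∀ x, τ' (e.symm x) = e.symm (τ x) := fun h x => by
    rw [Equiv.eq_symm_apply, ← h, Equiv.apply_symm_apply]
  have key : ∀ {s : Setoid D} {s' : Setoid D'}, s' ≤ s.comap e → s ≤ s'.comap e.symm →
      numClasses s' = numClasses s := fun {s s'} h1 h2 =>
    numClasses_congr e fun x y => ⟨fun h => h1 h, fun h => by
      have h' : s' (e.symm (e x)) (e.symm (e y)) := h2 h
      simpa using h'⟩
  have kc : ∀ {τ : Perm D} {τ' : Perm D'}, (∀ x, τ (e x) = e (τ' x)) → cyc τ' = cyc τ :=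
    fun h => key (cycles_le_comap h le_rfl) (cycles_le_comap (hsymm h) le_rfl)
  have ko : orb σ' α' = orb σ α := key
    (sup_le (cycles_le_comap hσ le_sup_left) (cycles_le_comap hα le_sup_right))
    (sup_le (cycles_le_comap (hsymm hσ) le_sup_left) (cycles_le_comap (hsymm hα) le_sup_right))
  have km : cyc (σ' * α') = cyc (σ * α) :=
    kc fun x => by rw [Perm.mul_apply, Perm.mul_apply, hα, hσ]
  rw [genus, genus, kc hσ, kc hα, ko, km, Nat.card_congr e]

/-- The disjoint union of two equivalence relations. -/
def sumSetoid (s : Setoid D) (s' : Setoid D') : Setoid (D ⊕ D') where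
  r := Sum.LiftRel s s'
  iseqv := by
    refine ⟨?_, ?_, ?_⟩
    · rintro (a | a)
      · exact Sum.LiftRel.inl (s.refl a)
      · exact Sum.LiftRel.inr (s'.refl a)
    · rintro _ _ (h | h)
      · exact Sum.LiftRel.inl (s.symm h)
      · exact Sum.LiftRel.inr (s'.symm h)
    · rintro _ _ _ (h | h) (g | g)
      · exact Sum.LiftRel.inl (s.trans h g)
      · exact Sum.LiftRel.inr (s'.trans h g)

theorem sumSetoid_le_iff {s : Setoid D} {s' : Setoid D'} {t : Setoid (D ⊕ D')} :
    sumSetoid s s' ≤ t ↔ s ≤ t.comap Sum.inl ∧ s' ≤ t.comap Sum.inr := by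
  constructor
  · intro h
    exact ⟨fun a b hab => h (Sum.LiftRel.inl hab), fun a b hab => h (Sum.LiftRel.inr hab)⟩
  · rintro ⟨h, h'⟩ _ _ (g | g)
    · exact h g
    · exact h' g

theorem sumSetoid_sup (s t : Setoid D) (s' t' : Setoid D') :
    sumSetoid (s ⊔ t) (s' ⊔ t') = sumSetoid s s' ⊔ sumSetoid t t' := by
  apply le_antisymm
  · have h1 := sumSetoid_le_iff.1 (le_sup_left : sumSetoid s s' ≤ sumSetoid s s' ⊔ sumSetoid t t')
    have h2 := sumSetoid_le_iff.1 (le_sup_right : sumSetoid t t' ≤ sumSetoid s s' ⊔ sumSetoid t t')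
    exact sumSetoid_le_iff.2 ⟨sup_le h1.1 h2.1, sup_le h1.2 h2.2⟩
  · have h0 := sumSetoid_le_iff.1 (le_refl (sumSetoid (s ⊔ t) (s' ⊔ t')))
    exact sup_le (sumSetoid_le_iff.2 ⟨le_sup_left.trans h0.1, le_sup_left.trans h0.2⟩)
      (sumSetoid_le_iff.2 ⟨le_sup_right.trans h0.1, le_sup_right.trans h0.2⟩)

theorem cycles_sumCongr (σ : Perm D) (σ' : Perm D') :
    cycles (Perm.sumCongr σ σ') = sumSetoid (cycles σ) (cycles σ') := by
  apply le_antisymm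
  · rw [cycles_le_iff]
    rintro (a | a)
    · exact Sum.LiftRel.inl (cycles_le_iff.1 le_rfl a)
    · exact Sum.LiftRel.inr (cycles_le_iff.1 le_rfl a)
  · exact sumSetoid_le_iff.2 ⟨cycles_le_comap (fun x => by simp) le_rfl,
      cycles_le_comap (fun x => by simp) le_rfl⟩

theorem numClasses_sumSetoid [Finite D] [Finite D'] (s : Setoid D) (s' : Setoid D') :
    numClasses (sumSetoid s s') = numClasses s + numClasses s' := by
  rw [numClasses, numClasses, numClasses, ← Nat.card_sum]
  refine (Nat.card_congr (Equiv.ofBijective (Sum.elim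
    (Quotient.map' Sum.inl fun a b h => Sum.LiftRel.inl h)
    (Quotient.map' Sum.inr fun a b h => Sum.LiftRel.inr h)) ⟨?_, ?_⟩)).symm
  · rintro (a | a) (b | b) h <;> obtain ⟨a, rfl⟩ := Quotient.exists_rep a <;>
      obtain ⟨b, rfl⟩ := Quotient.exists_rep b
    · have h' : sumSetoid s s' (Sum.inl a) (Sum.inl b) := Quotient.exact h
      rcases h' with h' | h'
      exact congrArg Sum.inl (Quotient.sound h')
    · have h' : sumSetoid s s' (Sum.inl a) (Sum.inr b) := Quotient.exact h
      nomatch h'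
    · have h' : sumSetoid s s' (Sum.inr a) (Sum.inl b) := Quotient.exact h
      nomatch h'
    · have h' : sumSetoid s s' (Sum.inr a) (Sum.inr b) := Quotient.exact h
      rcases h' with h' | h'
      exact congrArg Sum.inr (Quotient.sound h')
  · rintro ⟨a | a⟩
    · exact ⟨Sum.inl (Quotient.mk s a), rfl⟩
    · exact ⟨Sum.inr (Quotient.mk s' a), rfl⟩

theorem genus_sumCongr [Finite D] [Finite D'] (σ α : Perm D) (σ' α' : Perm D') :
    genus (Perm.sumCongr σ σ') (Perm.sumCongr α α') = genus σ α + genus σ' α' := by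
  simp only [genus, orb, cyc, cycles_sumCongr, ← sumSetoid_sup, numClasses_sumSetoid, Nat.card_sum,
    Perm.sumCongr_mul]
  push_cast
  ring

/-- The genus of a hypermap that is trivial outside of the image of `f`. -/
theorem genus_extend [Finite D] [Finite D'] {σ α : Perm D} {σ' α' : Perm D'} {f : D' → D}
    (hf : Function.Injective f) (hσ : ∀ x, σ (f x) = f (σ' x)) (hα : ∀ x, α (f x) = f (α' x))
    (hσ' : ∀ d, d ∉ Set.range f → σ d = d) : genus σ α = genus σ' α' := by
  classical
  have hα' : ∀ d, d ∉ Set.range f ↔ α d ∉ Set.range f := fun d => not_congr <| by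
    constructor
    · rintro ⟨x, rfl⟩
      exact ⟨α' x, (hα x).symm⟩
    · rintro ⟨x, hx⟩
      refine ⟨α'⁻¹ x, α.injective ?_⟩
      rw [hα, ← hx, ← Perm.mul_apply, mul_inv_cancel, Perm.one_apply]
  let β : Perm {d // d ∉ Set.range f} := α.subtypePerm fun d => (hα' d).symm
  let e : D' ⊕ {d // d ∉ Set.range f} ≃ D :=
    ((Equiv.ofInjective f hf).sumCongr (Equiv.refl _)).trans (Equiv.sumCompl (· ∈ Set.range f))
  have h := genus_congr (σ := σ) (α := α) (σ' := Perm.sumCongr σ' 1) (α' := Perm.sumCongr α' β) e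
    (by
      rintro (x | ⟨x, hx⟩)
      · exact hσ x
      · exact hσ' x hx)
    (by
      rintro (x | ⟨x, hx⟩)
      · exact hα x
      · rfl)
  rw [← h, genus_sumCongr, genus_one, add_zero]

/-- The hypermap is the disjoint union of its restrictions to `A` and to the complement. Letting the
rotation of a part be trivial elsewhere does not change its genus, so both parts can be kept as
permutations of all of `D`. -/
theorem genus_eq_add [Finite D] {σ α τ υ : Perm D} {A : Set D}
    (hσ : ∀ d, σ d ∈ A ↔ d ∈ A) (hα : ∀ d, α d ∈ A ↔ d ∈ A)
    (hτ : ∀ d ∈ A, τ d = σ d) (hτ' : ∀ d ∉ A, τ d = d)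
    (hυ : ∀ d ∈ A, υ d = d) (hυ' : ∀ d ∉ A, υ d = σ d) :
    genus σ α = genus τ α + genus υ α := by
  classical
  have hσc : ∀ d, σ d ∉ A ↔ d ∉ A := fun d => not_congr (hσ d)
  have hαc : ∀ d, α d ∉ A ↔ d ∉ A := fun d => not_congr (hα d)
  have h1 : genus τ α = genus (σ.subtypePerm hσ) (α.subtypePerm hα) :=
    genus_extend (f := Subtype.val) Subtype.val_injective (fun x => hτ x x.2) (fun x => rfl)
      (fun d hd => hτ' d fun h => hd ⟨⟨d, h⟩, rfl⟩)
  have h2 : genus υ α = genus (σ.subtypePerm hσc) (α.subtypePerm hαc) :=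
    genus_extend (f := Subtype.val) Subtype.val_injective (fun x => hυ' x x.2) (fun x => rfl)
      (fun d hd => hυ d (by_contra fun h => hd ⟨⟨d, h⟩, rfl⟩))
  rw [h1, h2, ← genus_sumCongr]
  refine (genus_congr (Equiv.sumCompl (· ∈ A)) ?_ ?_).symm
  · rintro (x | x) <;> rfl
  · rintro (x | x) <;> rfl

/-- A function that changes along a cycle changes at least twice. -/
theorem exists_second_change [Finite D] {φ : Perm D} {K : D → Prop} {z : D}
    (hz : ¬ (K z ↔ K (φ z))) : ∃ w, w ≠ z ∧ φ.SameCycle z w ∧ ¬ (K w ↔ K (φ w)) := by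
  by_contra hcon
  push Not at hcon
  -- If `z` were the only place of change, `K` would keep its value from `φ z` on, all the way
  -- around the cycle to `z`.
  have key : ∀ j : ℕ, (K ((φ ^ (j + 1)) z) ↔ K (φ z)) := by
    intro j
    induction j with
    | zero => simp
    | succ j ih =>
      rw [pow_succ' φ (j + 1), Perm.mul_apply, ← ih]
      by_cases hw : (φ ^ (j + 1)) z = z
      · rw [hw] at ih ⊢
        exact absurd ih hz
      · exact (hcon _ hw ⟨(j + 1 : ℕ), by rw [zpow_natCast]⟩).symm
  apply hz
  have := key (orderOf φ - 1)
  rwa [Nat.sub_add_cancel (orderOf_pos φ), pow_orderOf_eq_one] at this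

end Sum
end KModal

namespace KModal

open Equiv Equiv.Perm

/-! ### Connectivity of vertex sets expressed by cuts. -/

section Connectivity

variable {V W : Type}

/-- `u` and `v` are joined by an edge in some direction. -/
def Joined (G : Digraph V) (u v : V) : Prop := G.Adj u v ∨ G.Adj v u

theorem Joined.symm {G : Digraph V} {u v : V} (h : Joined G u v) : Joined G v u := Or.symm h

/-- The subgraph induced by `S` has no cut without edges. -/
def ConnOn (G : Digraph V) (S : Set V) : Prop :=
  ∀ X : Set V, (∃ x ∈ S, x ∈ X) → (∃ y ∈ S, y ∉ X) →
    ∃ x ∈ S, x ∈ X ∧ ∃ y ∈ S, y ∉ X ∧ Joined G x y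

theorem preconnected_iff_cuts (H : SimpleGraph W) :
    H.Preconnected ↔ ∀ X : Set W, (∃ x, x ∈ X) → (∃ y, y ∉ X) → ∃ x ∈ X, ∃ y ∉ X, H.Adj x y := by
  constructor
  · rintro h X ⟨x, hx⟩ ⟨y, hy⟩
    obtain ⟨w⟩ := h x y
    obtain ⟨d, _, h1, h2⟩ := w.exists_boundary_dart X hx hy
    exact ⟨d.fst, h1, d.snd, h2, d.adj⟩
  · intro h x y
    by_contra hxy
    obtain ⟨a, ha, b, hb, hab⟩ := h {z | H.Reachable x z} ⟨x, .refl _⟩ ⟨y, hxy⟩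
    exact hb (SimpleGraph.Reachable.trans ha hab.reachable)

/-- Deleting a vertex, passing to a vertex set, and doing both after each other are all covered,
with `f` the inclusion. From here on connectivity is a property of subsets of `V`, and nested
subtypes disappear. -/
theorem preconnected_iff_connOn {G : Digraph V} {S : Set V} (H : SimpleGraph W) {f : W → V}
    (hf : Function.Injective f) (hS : ∀ v, v ∈ S ↔ ∃ w, f w = v)
    (hadj : ∀ x y, H.Adj x y ↔ x ≠ y ∧ Joined G (f x) (f y)) :
    H.Preconnected ↔ ConnOn G S := by
  rw [preconnected_iff_cuts]
  constructor
  · rintro h X ⟨x, hxS, hx⟩ ⟨y, hyS, hy⟩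
    obtain ⟨x, rfl⟩ := (hS _).1 hxS
    obtain ⟨y, rfl⟩ := (hS _).1 hyS
    obtain ⟨a, ha, b, hb, hab⟩ := h (f ⁻¹' X) ⟨x, hx⟩ ⟨y, hy⟩
    exact ⟨f a, (hS _).2 ⟨a, rfl⟩, ha, f b, (hS _).2 ⟨b, rfl⟩, hb, ((hadj a b).1 hab).2⟩
  · rintro h X ⟨x, hx⟩ ⟨y, hy⟩
    obtain ⟨a, haS, ⟨a, ha, rfl⟩, b, hbS, hb, hab⟩ := h (f '' X)
      ⟨f x, (hS _).2 ⟨x, rfl⟩, x, hx, rfl⟩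
      ⟨f y, (hS _).2 ⟨y, rfl⟩, fun ⟨z, hz, hzy⟩ => hy (hf hzy ▸ hz)⟩
    obtain ⟨b, rfl⟩ := (hS _).1 hbS
    have hb' : b ∉ X := fun h => hb ⟨b, h, rfl⟩
    exact ⟨a, ha, b, hb', (hadj a b).2 ⟨fun e => hb' (e ▸ ha), hab⟩⟩

theorem toSimpleGraphInclusive_adj (G : Digraph V) (x y : V) :
    G.toSimpleGraphInclusive.Adj x y ↔ x ≠ y ∧ Joined G x y :=
  SimpleGraph.fromRel_adj _ _ _

theorem simplyConnected_iff (G : Digraph V) :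
    SimplyConnected G ↔ ConnOn G Set.univ ∧ Nonempty V := by
  rw [SimplyConnected, SimpleGraph.connected_iff, preconnected_iff_connOn (G := G) (S := Set.univ)
    (f := id) _ Function.injective_id (by simp) (toSimpleGraphInclusive_adj G)]

theorem isCutVertex_iff (G : Digraph V) (v : V) : IsCutVertex G v ↔ ¬ ConnOn G {v}ᶜ := by
  rw [IsCutVertex, preconnected_iff_connOn (G := G) (S := {v}ᶜ)
    (f := Subtype.val) _ Subtype.val_injective (by simp)]
  intro x y
  rw [SimpleGraph.comap_adj, toSimpleGraphInclusive_adj, Subtype.coe_ne_coe.symm]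
  rfl

theorem simplyConnected_induce_iff (G : Digraph V) (B : Finset V) :
    SimplyConnected (induce G B) ↔ ConnOn G B ∧ B.Nonempty := by
  rw [SimplyConnected, SimpleGraph.connected_iff, preconnected_iff_connOn (G := G) (S := B)
    (f := Subtype.val) _ Subtype.val_injective (by simp), Finset.nonempty_coe_sort]
  intro x y
  rw [toSimpleGraphInclusive_adj]
  rfl

theorem isCutVertex_induce_iff (G : Digraph V) (B : Finset V) (v : B) :
    IsCutVertex (induce G B) v ↔ ¬ ConnOn G (B \ {v.1}) := by
  rw [IsCutVertex, preconnected_iff_connOn (G := G) (S := B \ {v.1})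
    (f := fun x => x.1.1) _ (fun x y h => Subtype.ext (Subtype.ext h))]
  · intro w
    constructor
    · rintro ⟨h1, h2⟩
      exact ⟨⟨⟨w, h1⟩, fun h => h2 (congrArg Subtype.val h)⟩, rfl⟩
    · rintro ⟨⟨⟨w, h1⟩, h2⟩, rfl⟩
      exact ⟨h1, fun h => h2 (Subtype.ext h)⟩
  · intro x y
    rw [SimpleGraph.comap_adj, toSimpleGraphInclusive_adj, ne_eq, ne_eq, Subtype.ext_iff (a1 := x)]
    rfl

theorem nontrivial_coe_finset_iff {B : Finset V} : Nontrivial B ↔ B.Nontrivial :=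
  Set.nontrivial_coe_sort (s := (B : Set V))

theorem biconnected_induce_iff (G : Digraph V) (B : Finset V) :
    Biconnected (induce G B) ↔ B.Nontrivial ∧ ConnOn G B ∧ ∀ v ∈ B, ConnOn G (B \ {v}) := by
  rw [Biconnected, simplyConnected_induce_iff, nontrivial_coe_finset_iff]
  constructor
  · rintro ⟨h1, h2, h3⟩
    refine ⟨h1, h2.1, fun v hv => ?_⟩
    have := h3 ⟨v, hv⟩
    rwa [isCutVertex_induce_iff, not_not] at this
  · rintro ⟨h1, h2, h3⟩
    refine ⟨h1, ⟨h2, h1.nonempty⟩, fun v => ?_⟩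
    rw [isCutVertex_induce_iff, not_not]
    exact h3 v v.2

end Connectivity

/-! ### Planar embeddings of subgraphs as permutations of all edge ends. -/

section Embeddings

variable {V W : Type}

theorem flip_apply {G : Digraph V} (d : Dart G) : flip G d = (d.1, !d.2) := rfl

theorem flip_flip {G : Digraph V} (d : Dart G) : flip G (flip G d) = d := by
  simp [flip_apply]

theorem flip_inv_apply {G : Digraph V} (d : Dart G) : (flip G)⁻¹ d = flip G d := by
  rw [Perm.inv_eq_iff_eq, flip_flip]

/-- The edge ends of the subgraph induced by `S`. -/
def dartsIn (G : Digraph V) (S : Set V) : Set (Dart G) :=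
  {d | d.vertex ∈ S ∧ (flip G d).vertex ∈ S}

theorem flip_mem_dartsIn {G : Digraph V} {S : Set V} (d : Dart G) :
    flip G d ∈ dartsIn G S ↔ d ∈ dartsIn G S := by
  simp only [dartsIn, Set.mem_ofPred_eq, flip_flip, and_comm]

theorem Joined.exists_dart {G : Digraph V} {u v : V} (h : Joined G u v) :
    ∃ d : Dart G, d.vertex = u ∧ (flip G d).vertex = v := by
  rcases h with h | h
  · exact ⟨(⟨(u, v), h⟩, true), rfl, rfl⟩
  · exact ⟨(⟨(v, u), h⟩, false), rfl, rfl⟩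

theorem Dart.joined {G : Digraph V} (d : Dart G) : Joined G d.vertex (flip G d).vertex := by
  obtain ⟨⟨⟨u, v⟩, h⟩, b⟩ := d
  cases b
  · exact Or.inr h
  · exact Or.inl h

theorem Dart.vertex_ne {G : Digraph V} (hG : Loopless G) (d : Dart G) :
    d.vertex ≠ (flip G d).vertex := by
  intro e
  have := d.joined
  rw [e] at this
  rcases this with h | h <;> exact hG _ h

/-- `σ`, which is trivial on the other edge ends, is the rotation system of a planar embedding of
the subgraph induced by `S`. -/
structure SubEmbedding (G : Digraph V) (S : Set V) (σ : Perm (Dart G)) : Prop where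
  fixes : ∀ d, d ∉ dartsIn G S → σ d = d
  rotation : ∀ d ∈ dartsIn G S, ∀ d' ∈ dartsIn G S, σ.SameCycle d d' ↔ d.vertex = d'.vertex
  planar : genus σ (flip G) = 0

/-- The number of alternating pairs of consecutive edges around `v`. -/
noncomputable def modality {G : Digraph V} (σ : Perm (Dart G)) (v : V) : ℕ :=
  Nat.card {d : Dart G // d.vertex = v ∧ Dart.outgoing (σ d) ≠ Dart.outgoing d}

theorem SubEmbedding.apply_mem_iff {G : Digraph V} {S : Set V} {σ : Perm (Dart G)}
    (h : SubEmbedding G S σ) (d : Dart G) : σ d ∈ dartsIn G S ↔ d ∈ dartsIn G S := by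
  constructor
  · intro hd
    by_contra hd'
    rw [h.fixes d hd'] at hd
    exact hd' hd
  · intro hd
    by_contra hd'
    have := σ.injective (h.fixes _ hd')
    rw [this] at hd'
    exact hd' hd

theorem SubEmbedding.vertex_apply {G : Digraph V} {S : Set V} {σ : Perm (Dart G)}
    (h : SubEmbedding G S σ) (d : Dart G) : (σ d).vertex = d.vertex := by
  by_cases hd : d ∈ dartsIn G S
  · exact ((h.rotation d hd _ ((h.apply_mem_iff d).2 hd)).1 ⟨1, by simp⟩).symm
  · rw [h.fixes d hd]

/-- A connected set with two vertices has an edge end at each vertex. -/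
theorem ConnOn.exists_dart {G : Digraph V} {S : Set V} (h : ConnOn G S) (hS : S.Nontrivial)
    {v : V} (hv : v ∈ S) : ∃ d ∈ dartsIn G S, d.vertex = v := by
  obtain ⟨w, hw, hwv⟩ := hS.exists_ne v
  obtain ⟨x, hxS, hx, y, hyS, -, hxy⟩ := h {v} ⟨v, hv, rfl⟩ ⟨w, hw, hwv⟩
  obtain ⟨d, rfl, rfl⟩ := hxy.exists_dart
  exact ⟨d, ⟨hxS, hyS⟩, hx⟩

/-- All edge ends in a connected set are related by a relation that relates the edge ends at a
vertex and the two ends of an edge. -/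
theorem ConnOn.darts_related {G : Digraph V} {S : Set V} (h : ConnOn G S) {s : Setoid (Dart G)}
    (hv : ∀ d ∈ dartsIn G S, ∀ d' ∈ dartsIn G S, d.vertex = d'.vertex → s d d')
    (hf : ∀ d, s d (flip G d)) {d d' : Dart G} (hd : d ∈ dartsIn G S) (hd' : d' ∈ dartsIn G S) :
    s d d' := by
  by_contra hcon
  obtain ⟨x, hxS, ⟨a, haS, rfl, ha⟩, y, hyS, hy, hxy⟩ :=
    h {v | ∃ a ∈ dartsIn G S, a.vertex = v ∧ s d a} ⟨d.vertex, hd.1, d, hd, rfl, s.refl d⟩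
      ⟨d'.vertex, hd'.1, fun ⟨a, haS, ha, hda⟩ => hcon (s.trans hda (hv a haS d' hd' ha))⟩
  obtain ⟨b, hb, rfl⟩ := hxy.exists_dart
  have hbS : b ∈ dartsIn G S := ⟨hb ▸ hxS, hyS⟩
  exact hy ⟨flip G b, (flip_mem_dartsIn b).2 hbS, rfl,
    s.trans (s.trans ha (hv a haS b hbS hb.symm)) (hf b)⟩

theorem dartsIn_univ (G : Digraph V) (d : Dart G) : d ∈ dartsIn G Set.univ :=
  ⟨trivial, trivial⟩

theorem cyc_flip (G : Digraph V) : cyc (flip G) = Nat.card (Edge G) := by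
  refine Nat.card_congr (Equiv.ofBijective (Quotient.lift Prod.fst fun a b h => ?_) ⟨?_, ?_⟩)
  · exact (cycles_le_iff (t := Setoid.ker Prod.fst)).2 (fun a => rfl) h
  · rintro ⟨a⟩ ⟨b⟩ h
    refine Quotient.sound ?_
    have h' : a.1 = b.1 := h
    by_cases hb : a.2 = b.2
    · rw [Prod.ext h' hb]
    · refine ⟨1, ?_⟩
      rw [zpow_one, flip_apply]
      exact Prod.ext h' (Bool.not_eq.2 hb)
  · intro e
    exact ⟨Quotient.mk _ (e, true), rfl⟩

theorem card_dart [Finite V] (G : Digraph V) : Nat.card (Dart G) = 2 * Nat.card (Edge G) := by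
  rw [Nat.card_prod]
  simp [mul_comm]

/-- A connected graph with two vertices has no isolated vertex, so the cycles of `rot` are the
vertices, those of `flip G` the edges, those of the product the faces, and there is one orbit on `2
|E|` edge ends. A single vertex must be excluded: it has no edge ends and hence no orbit. -/
theorem planar_iff_genus [Finite V] [Nontrivial V] (G : Digraph V) (hG : SimplyConnected G)
    (rot : Perm (Dart G)) (hrot : ∀ d d' : Dart G, rot.SameCycle d d' ↔ d.vertex = d'.vertex) :
    Nat.card V + numFaces G rot =
      Nat.card (Edge G) + 2 * Nat.card G.toSimpleGraphInclusive.ConnectedComponent ↔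
    genus rot (flip G) = 0 := by
  have hc := ((simplyConnected_iff G).1 hG).1
  have hd : ∀ v, ∃ d : Dart G, d.vertex = v := fun v => by
    obtain ⟨d, -, h⟩ := hc.exists_dart Set.nontrivial_univ (Set.mem_univ v)
    exact ⟨d, h⟩
  have h1 : cyc rot = Nat.card V := by
    refine Nat.card_congr (Equiv.ofBijective
      (Quotient.lift Dart.vertex fun a b h => (hrot a b).1 h) ⟨?_, ?_⟩)
    · rintro ⟨a⟩ ⟨b⟩ h
      exact Quotient.sound ((hrot a b).2 h)
    · intro v
      obtain ⟨d, h⟩ := hd v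
      exact ⟨Quotient.mk _ d, h⟩
  have h2 : numFaces G rot = cyc (rot * flip G) := by
    have : IsEmpty {v : V // ∀ d : Dart G, d.vertex ≠ v} :=
      ⟨fun ⟨v, hv⟩ => by obtain ⟨d, h⟩ := hd v; exact hv d h⟩
    rw [numFaces, Nat.card_of_isEmpty (α := {v : V // ∀ d : Dart G, d.vertex ≠ v})]
    rfl
  have h3 : Nat.card G.toSimpleGraphInclusive.ConnectedComponent = 1 := by
    have := SimpleGraph.Preconnected.subsingleton_connectedComponent hG.1
    have hne := hG.nonempty
    rw [Nat.card_eq_one_iff_unique]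
    exact ⟨this, ⟨G.toSimpleGraphInclusive.connectedComponentMk (Classical.arbitrary V)⟩⟩
  have h4 : orb rot (flip G) = 1 := by
    rw [orb, numClasses, Nat.card_eq_one_iff_unique]
    obtain ⟨d0, -⟩ := hd (Classical.arbitrary V)
    refine ⟨⟨?_⟩, ⟨Quotient.mk _ d0⟩⟩
    rintro ⟨a⟩ ⟨b⟩
    exact Quotient.sound (hc.darts_related (s := cycles rot ⊔ cycles (flip G))
      (fun d _ d' _ h => (le_sup_left : cycles rot ≤ _) ((hrot d d').2 h))
      (cycles_le_iff.1 le_sup_right) (dartsIn_univ G a) (dartsIn_univ G b))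
  rw [genus, h1, h2, h3, h4, cyc_flip, card_dart]
  omega

/-- Planar embeddings of a subgraph as permutations of the edge ends of the whole graph. -/
theorem maxModality_iff_subEmbedding [Finite V] [Finite W] [Nontrivial W] {G : Digraph V}
    {H : Digraph W} {S : Set V} {f : W → V} (hf : Function.Injective f)
    (hS : ∀ v, v ∈ S ↔ ∃ w, f w = v) (hadj : ∀ x y, H.Adj x y ↔ G.Adj (f x) (f y))
    (hH : SimplyConnected H) (m : V → ℕ) :
    MaxModality H (fun w => m (f w)) ↔ ∃ σ, SubEmbedding G S σ ∧ ∀ v ∈ S, modality σ v ≤ m v := by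
  classical
  -- `F` identifies the edge ends of `H` with `dartsIn G S`. Rotations are extended by the identity
  -- in one direction and restricted in the other; cycles, modality and genus agree under this
  -- correspondence.
  let F : Dart H → Dart G := fun d => (⟨(f d.1.1.1, f d.1.1.2), (hadj _ _).1 d.1.2⟩, d.2)
  have hFv : ∀ d, (F d).vertex = f d.vertex := by
    rintro ⟨e, b⟩
    cases b <;> rfl
  have hFf : ∀ d, flip G (F d) = F (flip H d) := fun d => rfl
  have hFo : ∀ d, Dart.outgoing (F d) = Dart.outgoing d := fun d => rfl
  have hFinj : Function.Injective F := by
    rintro ⟨⟨⟨a, b⟩, h⟩, c⟩ ⟨⟨⟨a', b'⟩, h'⟩, c'⟩ e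
    simp only [F, Prod.mk.injEq, Subtype.mk.injEq] at e
    obtain ⟨⟨e1, e2⟩, rfl⟩ := e
    obtain rfl := hf e1
    obtain rfl := hf e2
    rfl
  have hFr : ∀ d, d ∈ dartsIn G S ↔ d ∈ Set.range F := by
    intro d
    constructor
    · rintro ⟨h1, h2⟩
      obtain ⟨x, hx⟩ := (hS _).1 h1
      obtain ⟨y, hy⟩ := (hS _).1 h2
      obtain ⟨⟨⟨u, v⟩, h⟩, b⟩ := d
      cases b
      · obtain rfl : f x = v := hx
        obtain rfl : f y = u := hy
        exact ⟨(⟨(y, x), (hadj y x).2 h⟩, false), rfl⟩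
      · obtain rfl : f x = u := hx
        obtain rfl : f y = v := hy
        exact ⟨(⟨(x, y), (hadj x y).2 h⟩, true), rfl⟩
    · rintro ⟨d, rfl⟩
      refine ⟨(hS _).2 ⟨d.vertex, (hFv d).symm⟩, (hS _).2 ⟨(flip H d).vertex, ?_⟩⟩
      rw [hFf, hFv]
  have hmod : ∀ (σ : Perm (Dart G)) (τ : Perm (Dart H)), (∀ d, σ (F d) = F (τ d)) →
      (∀ d, d ∉ dartsIn G S → σ d = d) → ∀ w, modality σ (f w) = modality τ w := by
    intro σ τ h h' w
    have hp : ∀ d : {d : Dart H // d.vertex = w ∧ Dart.outgoing (τ d) ≠ Dart.outgoing d},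
        (F d).vertex = f w ∧ Dart.outgoing (σ (F d)) ≠ Dart.outgoing (F d) := fun d => by
      rw [hFv, h, hFo, hFo, d.2.1]
      exact ⟨rfl, d.2.2⟩
    refine (Nat.card_congr (Equiv.ofBijective (fun d => ⟨F d.1, hp d⟩) ⟨?_, ?_⟩)).symm
    · rintro ⟨a, _⟩ ⟨b, _⟩ e
      exact Subtype.ext (hFinj (congrArg Subtype.val e))
    · rintro ⟨d, hd1, hd2⟩
      have hd : d ∈ dartsIn G S := by
        by_contra hc
        rw [h' d hc] at hd2
        exact hd2 rfl
      obtain ⟨d, rfl⟩ := (hFr d).1 hd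
      rw [hFv] at hd1
      rw [h, hFo, hFo] at hd2
      exact ⟨⟨d, hf hd1, hd2⟩, rfl⟩
  have hgen : ∀ (σ : Perm (Dart G)) (τ : Perm (Dart H)), (∀ d, σ (F d) = F (τ d)) →
      (∀ d, d ∉ dartsIn G S → σ d = d) → genus σ (flip G) = genus τ (flip H) :=
    fun σ τ h h' => genus_extend hFinj h hFf fun d hd => h' d fun hd' => hd ((hFr d).1 hd')
  have hcyc : ∀ (σ : Perm (Dart G)) (τ : Perm (Dart H)), (∀ d, σ (F d) = F (τ d)) →
      ∀ d d', σ.SameCycle (F d) (F d') ↔ τ.SameCycle d d' := by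
    intro σ τ h d d'
    have hp : ∀ i : ℕ, (σ ^ i) (F d) = F ((τ ^ i) d) := by
      intro i
      induction i with
      | zero => rfl
      | succ i ih => rw [pow_succ', pow_succ', Perm.mul_apply, Perm.mul_apply, ih, h]
    constructor
    · intro hs
      obtain ⟨i, hi⟩ := hs.exists_nat_pow_eq
      rw [hp] at hi
      exact ⟨i, by rw [zpow_natCast]; exact hFinj hi⟩
    · intro hs
      obtain ⟨i, hi⟩ := hs.exists_nat_pow_eq
      exact ⟨i, by rw [zpow_natCast, hp, hi]⟩
  constructor
  · rintro ⟨E, hE⟩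
    let e : Dart H ≃ {d // d ∈ Set.range F} := Equiv.ofInjective F hFinj
    let σ : Perm (Dart G) := E.rot.extendDomain e
    have h : ∀ d, σ (F d) = F (E.rot d) := fun d => extendDomain_apply_image E.rot e d
    have h' : ∀ d, d ∉ dartsIn G S → σ d = d := fun d hd =>
      extendDomain_apply_not_subtype E.rot e fun hd' => hd ((hFr d).2 hd')
    refine ⟨σ, ⟨h', ?_, ?_⟩, ?_⟩
    · intro d hd d' hd'
      obtain ⟨d, rfl⟩ := (hFr d).1 hd
      obtain ⟨d', rfl⟩ := (hFr d').1 hd'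
      rw [hcyc σ E.rot h, hFv, hFv, E.isRotation, hf.eq_iff]
    · rw [hgen σ E.rot h h']
      exact (planar_iff_genus H hH E.rot E.isRotation).1 E.planar
    · intro v hv
      obtain ⟨w, rfl⟩ := (hS v).1 hv
      rw [hmod σ E.rot h h']
      exact hE w
  · rintro ⟨σ, hσ, hm⟩
    have hinv : ∀ d, σ d ∈ Set.range F ↔ d ∈ Set.range F := fun d => by
      rw [← hFr, ← hFr, hσ.apply_mem_iff]
    let e : Dart H ≃ {d // d ∈ Set.range F} := Equiv.ofInjective F hFinj
    let τ : Perm (Dart H) := e.symm.permCongr (σ.subtypePerm hinv)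
    have h : ∀ d, σ (F d) = F (τ d) := fun d => by
      have : e (τ d) = σ.subtypePerm hinv (e d) := by
        simp [τ, Equiv.permCongr_apply]
      exact (congrArg Subtype.val this).symm
    have hrot : ∀ d d', τ.SameCycle d d' ↔ d.vertex = d'.vertex := fun d d' => by
      rw [← hcyc σ τ h, hσ.rotation _ ((hFr _).2 ⟨d, rfl⟩) _ ((hFr _).2 ⟨d', rfl⟩), hFv, hFv,
        hf.eq_iff]
    have hgen' := hgen σ τ h hσ.fixes
    rw [hσ.planar] at hgen'
    refine ⟨⟨τ, hrot, (planar_iff_genus H hH τ hrot).2 hgen'.symm⟩, fun w => ?_⟩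
    have := hm (f w) ((hS _).2 ⟨w, rfl⟩)
    rw [hmod σ τ h hσ.fixes] at this
    exact this

theorem maxModality_iff [Finite V] [Nontrivial V] {G : Digraph V} (hG : SimplyConnected G)
    (m : V → ℕ) :
    MaxModality G m ↔ ∃ σ, SubEmbedding G Set.univ σ ∧ ∀ v, modality σ v ≤ m v := by
  have := maxModality_iff_subEmbedding (G := G) (H := G) (S := Set.univ) Function.injective_id
    (by simp) (fun _ _ => Iff.rfl) hG m
  simpa using this

theorem maxModality_induce_iff [Finite V] {G : Digraph V} {B : Finset V} (hB : B.Nontrivial)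
    (hc : ConnOn G B) (m : V → ℕ) :
    MaxModality (induce G B) (fun v => m v) ↔
      ∃ σ, SubEmbedding G B σ ∧ ∀ v ∈ B, modality σ v ≤ m v := by
  have : Nontrivial B := nontrivial_coe_finset_iff.2 hB
  have := maxModality_iff_subEmbedding (G := G) (H := induce G B) (S := B) Subtype.val_injective
    (by simp) (fun _ _ => Iff.rfl) ((simplyConnected_induce_iff G B).2 ⟨hc, hB.nonempty⟩) m
  simpa using this

end Embeddings
end KModal

namespace KModal

open Equiv Equiv.Perm

/-! ### Modality under local changes of the rotation. -/

section Modality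

variable {V : Type} {G : Digraph V}

open Classical in
/-- `1` if the edge ends `d` and `d'` have different orientations and `0` otherwise. -/
noncomputable def alternation (d d' : Dart G) : ℕ :=
  if Dart.outgoing d' ≠ Dart.outgoing d then 1 else 0

open Classical in
theorem modality_eq_sum [Fintype (Dart G)] (σ : Perm (Dart G)) (v : V) :
    modality σ v = ∑ d : Dart G with d.vertex = v, alternation d (σ d) := by
  rw [modality, Nat.card_eq_fintype_card, Fintype.card_subtype, Finset.card_filter,
    Finset.sum_filter]
  refine Finset.sum_congr rfl fun d _ => ?_
  by_cases h : d.vertex = v <;> simp [h, alternation]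

/-- Modulo `2` an alternation is the sum of the two orientations, and `σ` permutes the edge ends at
`v`, so every orientation is counted twice. -/
theorem even_modality [Finite V] {σ : Perm (Dart G)} (h : ∀ d, (σ d).vertex = d.vertex) (v : V) :
    Even (modality σ v) := by
  classical
  have := Fintype.ofFinite (Dart G)
  let o : Dart G → ZMod 2 := fun d => if Dart.outgoing d then 1 else 0
  have h1 : ∀ d d', (alternation d d' : ZMod 2) = o d' + o d := fun d d' => by
    simp only [alternation, o]
    cases Dart.outgoing d <;> cases Dart.outgoing d' <;> simp
    decide
  have h2 : ∑ d : Dart G with d.vertex = v, o (σ d) = ∑ d : Dart G with d.vertex = v, o d :=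
    Finset.sum_equiv σ (by simp [h]) (by simp)
  rw [← ZMod.natCast_eq_zero_iff_even, modality_eq_sum]
  push_cast
  simp only [h1, Finset.sum_add_distrib, h2]
  exact CharTwo.add_self_eq_zero _

/-- Only the successors of `x` and `y` are exchanged. The balance is written additively to avoid
truncated subtraction. -/
theorem modality_mul_swap [DecidableEq (Dart G)] [Finite V] (σ : Perm (Dart G)) {x y : Dart G} (hxy : x ≠ y)
    {v : V} (hx : x.vertex = v) (hy : y.vertex = v) :
    modality (σ * swap x y) v + alternation x (σ x) + alternation y (σ y) =
      modality σ v + alternation x (σ y) + alternation y (σ x) := by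
  classical
  have := Fintype.ofFinite (Dart G)
  set s : Finset (Dart G) := Finset.univ.filter fun d => d.vertex = v with hs
  have hxs : x ∈ s := by simp [hs, hx]
  have hys : y ∈ s.erase x := by simp [hs, hy, hxy.symm]
  have key : ∀ τ : Perm (Dart G), modality τ v = alternation x (τ x) + (alternation y (τ y) +
      ∑ d ∈ (s.erase x).erase y, alternation d (τ d)) := fun τ => by
    rw [modality_eq_sum, Finset.add_sum_erase _ (fun d => alternation d (τ d)) hys,
      Finset.add_sum_erase _ (fun d => alternation d (τ d)) hxs]
  have h1 : ∑ d ∈ (s.erase x).erase y, alternation d ((σ * swap x y) d) =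
      ∑ d ∈ (s.erase x).erase y, alternation d (σ d) := by
    refine Finset.sum_congr rfl fun d hd => ?_
    simp only [Finset.mem_erase] at hd
    rw [Perm.mul_apply, swap_apply_of_ne_of_ne hd.2.1 hd.1]
  rw [key, key, h1, Perm.mul_apply, Perm.mul_apply, swap_apply_left, swap_apply_right]
  omega

theorem alternation_self (d : Dart G) : alternation d d = 0 := by simp [alternation]

theorem modality_add [Finite V] {σ τ υ : Perm (Dart G)} (v : V)
    (h : ∀ d, (τ d = σ d ∧ υ d = d) ∨ (τ d = d ∧ υ d = σ d)) :
    modality τ v + modality υ v = modality σ v := by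
  classical
  have := Fintype.ofFinite (Dart G)
  rw [modality_eq_sum, modality_eq_sum, modality_eq_sum, ← Finset.sum_add_distrib]
  refine Finset.sum_congr rfl fun d _ => ?_
  rcases h d with ⟨h1, h2⟩ | ⟨h1, h2⟩ <;> rw [h1, h2, alternation_self] <;> simp

theorem alternation_eq_zero_of_modality [Finite V] {σ : Perm (Dart G)} {v : V} (h : modality σ v = 0)
    {d : Dart G} (hd : d.vertex = v) : alternation d (σ d) = 0 := by
  by_contra hc
  have hc' : Dart.outgoing (σ d) ≠ Dart.outgoing d := by
    by_contra h'
    exact hc (by simp [alternation, h'])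
  rw [modality, Nat.card_eq_zero] at h
  rcases h with h | h
  · exact h.false ⟨d, hd, hc'⟩
  · exact h.not_finite inferInstance

theorem modality_congr [Finite V] {σ τ : Perm (Dart G)} {v : V} (h : ∀ d, d.vertex = v → σ d = τ d) :
    modality σ v = modality τ v := by
  classical
  have := Fintype.ofFinite (Dart G)
  rw [modality_eq_sum, modality_eq_sum]
  refine Finset.sum_congr rfl fun d hd => ?_
  rw [h d (Finset.mem_filter.1 hd).2]

/-- Around a vertex of positive modality there are alternations of both kinds. -/
theorem exists_alternation [Finite V] {σ : Perm (Dart G)} (h : ∀ d, (σ d).vertex = d.vertex) {v : V}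
    (hv : modality σ v ≠ 0) (b : Bool) :
    ∃ d, d.vertex = v ∧ Dart.outgoing d = b ∧ Dart.outgoing (σ d) = !b := by
  by_contra hcon
  push Not at hcon
  have hne : Nonempty {d : Dart G // d.vertex = v ∧ Dart.outgoing (σ d) ≠ Dart.outgoing d} := by
    by_contra hc
    rw [not_nonempty_iff] at hc
    exact hv Nat.card_of_isEmpty
  obtain ⟨d, hd, hd'⟩ := hne
  have hb : Dart.outgoing d = !b := by
    by_contra hc
    have hc' : Dart.outgoing d = b := by simpa using hc
    exact hcon d hd hc' (by rw [← hc']; exact Bool.eq_not.2 hd')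
  -- At `d` the orientation turns from `!b` to `b`. If it never turned back it would still be `b`
  -- when the cycle returns to `d`.
  have key : ∀ j : ℕ, ((σ ^ (j + 1)) d).vertex = v ∧ Dart.outgoing ((σ ^ (j + 1)) d) = b := by
    intro j
    induction j with
    | zero =>
      rw [zero_add, pow_one, h]
      rw [hb] at hd'
      exact ⟨hd, by simpa using hd'⟩
    | succ j ih =>
      rw [pow_succ', Perm.mul_apply, h]
      exact ⟨ih.1, by simpa using hcon _ ih.1 ih.2⟩
  have := (key (orderOf σ - 1)).2
  rw [Nat.sub_add_cancel (orderOf_pos σ), pow_orderOf_eq_one, Perm.one_apply, hb] at this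
  simp at this

/-- All edges at `v` are incoming or all are outgoing. -/
def Monochromatic (G : Digraph V) (v : V) : Prop :=
  ∀ d d' : Dart G, d.vertex = v → d'.vertex = v → Dart.outgoing d = Dart.outgoing d'

theorem Monochromatic.modality_eq_zero {σ : Perm (Dart G)} (h : ∀ d, (σ d).vertex = d.vertex)
    {v : V} (hv : Monochromatic G v) : modality σ v = 0 := by
  have : IsEmpty {d : Dart G // d.vertex = v ∧ Dart.outgoing (σ d) ≠ Dart.outgoing d} :=
    ⟨fun ⟨d, hd, hd'⟩ => hd' (hv _ _ ((h d).trans hd) hd)⟩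
  exact Nat.card_of_isEmpty

/-- For a vertex with budget `0` this turns a condition on the embedding into one on `G` alone,
which the procedure checks before testing any block. -/
theorem monochromatic_of_modality_eq_zero [Finite V] {σ : Perm (Dart G)} (hσ : SubEmbedding G Set.univ σ)
    {v : V} (hv : modality σ v = 0) : Monochromatic G v := by
  intro d d' hd hd'
  have hs := (hσ.rotation d (dartsIn_univ G d) d' (dartsIn_univ G d')).2 (hd.trans hd'.symm)
  obtain ⟨i, rfl⟩ := hs.exists_nat_pow_eq
  have key : ∀ i : ℕ, ((σ ^ i) d).vertex = v ∧ Dart.outgoing ((σ ^ i) d) = Dart.outgoing d := by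
    intro i
    induction i with
    | zero => exact ⟨hd, rfl⟩
    | succ i ih =>
      rw [pow_succ', Perm.mul_apply, hσ.vertex_apply]
      refine ⟨ih.1, Eq.trans ?_ ih.2⟩
      have := alternation_eq_zero_of_modality hv ih.1
      simp only [alternation, ite_eq_right_iff] at this
      by_contra hc
      exact absurd (this hc) one_ne_zero
  exact (key i).2.symm

end Modality
end KModal

namespace KModal

open Equiv Equiv.Perm

/-! ### Splitting and merging planar embeddings at a vertex. -/

section OneSums

variable {V : Type} {G : Digraph V}

theorem sameCycle_of_agree {D : Type} [Finite D] {σ τ : Perm D} {A : Set D}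
    (hA : ∀ d ∈ A, σ d ∈ A) (h : ∀ d ∈ A, τ d = σ d) {d d' : D} (hd : d ∈ A)
    (hs : σ.SameCycle d d') : τ.SameCycle d d' := by
  obtain ⟨i, rfl⟩ := hs.exists_nat_pow_eq
  have key : ∀ i : ℕ, (σ ^ i) d ∈ A ∧ (τ ^ i) d = (σ ^ i) d := by
    intro i
    induction i with
    | zero => exact ⟨hd, rfl⟩
    | succ i ih =>
      rw [pow_succ', pow_succ', Perm.mul_apply, Perm.mul_apply, ih.2]
      exact ⟨hA _ ih.1, h _ ih.1⟩
  exact ⟨i, by rw [zpow_natCast, (key i).2]⟩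

/-- The permutation that agrees with `σ` on an invariant set and is trivial elsewhere. -/
theorem exists_restriction {D : Type} (σ : Perm D) {A : Set D} (hA : ∀ d, σ d ∈ A ↔ d ∈ A) :
    ∃ τ : Perm D, (∀ d ∈ A, τ d = σ d) ∧ ∀ d ∉ A, τ d = d := by
  classical
  exact ⟨ofSubtype (σ.subtypePerm hA), fun d hd => ofSubtype_apply_of_mem _ hd,
    fun d hd => ofSubtype_apply_of_not_mem _ hd⟩

variable [Finite V]

/-- The rotation of a one-sided part of a split rotation system. -/
theorem SubEmbedding.part (hG : Loopless G) {S : Set V} {σ : Perm (Dart G)}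
    (h : SubEmbedding G S σ) [DecidableEq (Dart G)] {x y : Dart G}
    (hx : x ∈ dartsIn G S) (hy : y ∈ dartsIn G S) (hxy : x.vertex = y.vertex)
    (hJ : ¬ (cycles (σ * swap x y) ⊔ cycles (flip G)) x y) :
    ∃ A : Set V, (∀ d, d ∈ dartsIn G A ↔ (cycles (σ * swap x y) ⊔ cycles (flip G)) d x) ∧
      (∀ v, v ∈ A ↔ ∃ d : Dart G, (cycles (σ * swap x y) ⊔ cycles (flip G)) d x ∧ d.vertex = v) ∧
      A ⊆ S ∧ x.vertex ∈ A ∧ A.Nontrivial ∧ ConnOn G A ∧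
      (∀ v ∈ A, v ≠ x.vertex → ∀ d : Dart G, d ∈ dartsIn G S → d.vertex = v →
        d ∈ dartsIn G A) ∧
      ∀ τ : Perm (Dart G), (∀ d ∈ dartsIn G A, τ d = (σ * swap x y) d) →
        (∀ d ∉ dartsIn G A, τ d = d) → genus τ (flip G) = 0 → SubEmbedding G A τ := by
  set J := cycles (σ * swap x y) ⊔ cycles (flip G) with hJdef
  have hσ' : ∀ d, J d ((σ * swap x y) d) := cycles_le_iff.1 le_sup_left
  have hfl : ∀ d, J d (flip G d) := cycles_le_iff.1 le_sup_right
  have hne : x ≠ y := fun e => hJ (e ▸ J.refl x)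
  have hv' : ∀ d, ((σ * swap x y) d).vertex = d.vertex := by
    intro d
    rw [Perm.mul_apply, h.vertex_apply]
    rcases eq_or_ne d x with rfl | h1
    · rw [swap_apply_left, hxy]
    · rcases eq_or_ne d y with rfl | h2
      · rw [swap_apply_right, hxy]
      · rw [swap_apply_of_ne_of_ne h1 h2]
  have hsw : ∀ d, swap x y d ∈ dartsIn G S ↔ d ∈ dartsIn G S := by
    intro d
    rcases eq_or_ne d x with rfl | h1
    · rw [swap_apply_left]; exact iff_of_true hy hx
    · rcases eq_or_ne d y with rfl | h2
      · rw [swap_apply_right]; exact iff_of_true hx hy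
      · rw [swap_apply_of_ne_of_ne h1 h2]
  have hin : ∀ d d', J d d' → (d ∈ dartsIn G S ↔ d' ∈ dartsIn G S) := by
    have : J ≤ Setoid.ker fun d => d ∈ dartsIn G S := by
      refine sup_le (cycles_le_iff.2 fun a => ?_) (cycles_le_iff.2 fun a => ?_)
      · exact propext (((h.apply_mem_iff _).trans (hsw a)).symm)
      · exact propext (flip_mem_dartsIn a).symm
    intro d d' hd
    have h' : (d ∈ dartsIn G S) = (d' ∈ dartsIn G S) := this hd
    rw [h']
  have hrot : ∀ d ∈ dartsIn G S, ∀ d' ∈ dartsIn G S, d.vertex = d'.vertex →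
      glue (cycles (σ * swap x y)) x y d d' := by
    intro d hd d' hd' hv
    rw [glue_cycles_mul_swap]
    exact le_glue ((h.rotation d hd d' hd').2 hv)
  -- Only the cycle at the vertex of `x` is split; at any other vertex all edge ends remain on one
  -- side.
  have hside : ∀ d, J d x → ∀ d' ∈ dartsIn G S, d.vertex = d'.vertex → d.vertex ≠ x.vertex →
      (σ * swap x y).SameCycle d d' := by
    intro d hd d' hd' hv hdv
    have hv1 : ∀ {a b : Dart G}, (σ * swap x y).SameCycle a b → a.vertex = b.vertex :=
      fun {a b} hs =>
        (cycles_le_iff (t := Setoid.ker Dart.vertex)).2 (fun a => (hv' a).symm) hs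
    rcases glue_apply.1 (hrot d ((hin d x hd).2 hx) d' hd' hv) with h1 | ⟨h1, _⟩ | ⟨h1, _⟩
    · exact h1
    · exact absurd (hv1 h1) hdv
    · exact absurd (hv1 h1) (hxy ▸ hdv)
  -- The side is an induced subgraph: an edge without loop has an end away from the vertex of `x`,
  -- and that end determines the side of the edge.
  have hA : ∀ d, d ∈ dartsIn G {v | ∃ d : Dart G, J d x ∧ d.vertex = v} ↔ J d x := by
    intro d
    constructor
    · rintro ⟨⟨a, ha, hav⟩, b, hb, hbv⟩
      have haS := (hin a x ha).2 hx
      have hbS := (hin b x hb).2 hx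
      have key : ∀ a d : Dart G, J a x → a.vertex = d.vertex → a.vertex ≠ x.vertex →
          d ∈ dartsIn G S → J d x := fun a d ha hav hax hd =>
        J.trans (J.symm ((le_sup_left : cycles _ ≤ J) (hside a ha d hd hav hax))) ha
      have hdS : d ∈ dartsIn G S := ⟨hav ▸ haS.1, hbv ▸ hbS.1⟩
      by_cases hax : a.vertex = x.vertex
      · have hbx : b.vertex ≠ x.vertex := by
          rw [hbv, ← hax, hav]
          exact (d.vertex_ne hG).symm
        exact J.trans (hfl d) (key b (flip G d) hb hbv hbx ((flip_mem_dartsIn d).2 hdS))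
      · exact key a d ha hav hax hdS
    · intro hd
      exact ⟨⟨d, hd, rfl⟩, flip G d, J.trans (J.symm (hfl d)) hd, rfl⟩
  refine ⟨{v | ∃ d : Dart G, J d x ∧ d.vertex = v}, hA, fun v => Iff.rfl, ?_, ⟨x, J.refl x, rfl⟩,
    ⟨x.vertex, ⟨x, J.refl x, rfl⟩, (flip G x).vertex, ⟨flip G x, J.symm (hfl x), rfl⟩,
      x.vertex_ne hG⟩, ?_, ?_, ?_⟩
  · rintro v ⟨d, hd, rfl⟩
    exact ((hin d x hd).2 hx).1
  · rintro X ⟨_, ⟨a, ha, rfl⟩, haX⟩ ⟨_, ⟨b, hb, rfl⟩, hbX⟩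
    by_contra hcon
    have : J ≤ Setoid.ker fun d => J d x ∧ d.vertex ∈ X := by
      refine sup_le (cycles_le_iff.2 fun d => propext ?_) (cycles_le_iff.2 fun d => propext ?_)
      · simp only [hv']
        exact and_congr_left fun _ => ⟨J.trans (J.symm (hσ' d)), J.trans (hσ' d)⟩
      · have hJ' : J d x ↔ J (flip G d) x := ⟨J.trans (J.symm (hfl d)), J.trans (hfl d)⟩
        simp only [← hJ']
        refine and_congr_right fun hd => ?_
        constructor
        · intro h1
          by_contra h2
          exact hcon ⟨_, ⟨d, hd, rfl⟩, h1, _, ⟨flip G d, hJ'.1 hd, rfl⟩, h2, d.joined⟩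
        · intro h1
          by_contra h2
          exact hcon ⟨_, ⟨flip G d, hJ'.1 hd, rfl⟩, h1, _, ⟨d, hd, rfl⟩, h2, d.joined.symm⟩
    have h' : (J a x ∧ a.vertex ∈ X) = (J b x ∧ b.vertex ∈ X) := this (J.trans ha (J.symm hb))
    have h'' := h' ▸ (⟨ha, haX⟩ : J a x ∧ a.vertex ∈ X)
    exact hbX h''.2
  · rintro _ ⟨a, ha, rfl⟩ hax d hd hda
    rw [hA]
    exact J.trans (J.symm ((le_sup_left : cycles _ ≤ J) (hside a ha d hd hda.symm hax))) ha
  · intro τ hτ hτ' hg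
    have hmaps : ∀ d ∈ dartsIn G {v | ∃ d : Dart G, J d x ∧ d.vertex = v},
        (σ * swap x y) d ∈ dartsIn G {v | ∃ d : Dart G, J d x ∧ d.vertex = v} := by
      intro d hd
      rw [hA] at hd ⊢
      exact J.trans (J.symm (hσ' d)) hd
    refine ⟨hτ', fun d hd d' hd' => ⟨fun hs => ?_, fun hv => ?_⟩, hg⟩
    · refine (cycles_le_iff (t := Setoid.ker Dart.vertex)).2 (fun a => ?_) hs
      show a.vertex = (τ a).vertex
      by_cases ha : a ∈ dartsIn G {v | ∃ d : Dart G, J d x ∧ d.vertex = v}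
      · rw [hτ a ha, hv']
      · rw [hτ' a ha]
    · refine sameCycle_of_agree hmaps hτ hd ?_
      rw [hA] at hd hd'
      have hy' : ∀ d, J d x → ¬ J d y := fun d hd hdy => hJ (J.trans (J.symm hd) hdy)
      rcases glue_apply.1 (hrot d ((hin d x hd).2 hx) d' ((hin d' x hd').2 hx) hv) with
        h1 | ⟨_, h1⟩ | ⟨h1, _⟩
      · exact h1
      · exact absurd (J.symm ((le_sup_left : cycles _ ≤ J) h1)) (hy' d' hd')
      · exact absurd ((le_sup_left : cycles _ ≤ J) h1) (hy' d hd)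

/-- A planar rotation system has, at every cut-vertex `c` of a connected set, two corners in the
same face at which the rotation at `c` can be split. -/
theorem SubEmbedding.exists_corners {S : Set V} {σ : Perm (Dart G)}
    (h : SubEmbedding G S σ) (hc : ConnOn G S) {c : V} (hcS : c ∈ S)
    (hcut : ¬ ConnOn G (S \ {c})) :
    ∃ x ∈ dartsIn G S, ∃ y ∈ dartsIn G S, x ≠ y ∧ x.vertex = c ∧ y.vertex = c ∧
      (σ * flip G).SameCycle (flip G x) (flip G y) := by
  rw [ConnOn] at hcut
  push Not at hcut
  obtain ⟨X, ⟨x0, hx0S, hx0⟩, ⟨y0, hy0S, hy0⟩, hX⟩ := hcut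
  -- `K` colours an edge by the side of the cut `X` on which it lies. Both ends of an edge have the
  -- same colour, and in the rotation the colour can change only around `c`.
  let K : Dart G → Prop := fun d =>
    (d.vertex ∈ X ∧ d.vertex ≠ c) ∨ ((flip G d).vertex ∈ X ∧ (flip G d).vertex ≠ c)
  have hKf : ∀ d, K (flip G d) ↔ K d := fun d => by
    simp only [K, flip_flip]
    exact or_comm
  have hK : ∀ d ∈ dartsIn G S, d.vertex ≠ c → (K d ↔ d.vertex ∈ X) := by
    intro d hd hdc
    constructor
    · rintro (h1 | ⟨h1, h2⟩)
      · exact h1.1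
      · by_contra h3
        exact hX _ ⟨hd.2, h2⟩ h1 _ ⟨hd.1, hdc⟩ h3 d.joined.symm
    · intro h1
      exact Or.inl ⟨h1, hdc⟩
  have hKc : ∀ d, ¬ (K d ↔ K (σ d)) → d ∈ dartsIn G S ∧ d.vertex = c := by
    intro d hd
    have hdS : d ∈ dartsIn G S := by
      by_contra h1
      rw [h.fixes d h1] at hd
      exact hd Iff.rfl
    refine ⟨hdS, ?_⟩
    by_contra h1
    apply hd
    rw [hK d hdS h1, hK (σ d) ((h.apply_mem_iff d).2 hdS) (by rwa [h.vertex_apply]),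
      h.vertex_apply]
  -- As `S` is connected, `c` has edges to both sides of the cut, and all edge ends at `c` lie in
  -- one cycle, so the colour changes somewhere.
  have hex : ∃ d, ¬ (K d ↔ K (σ d)) := by
    by_contra hcon
    push Not at hcon
    obtain ⟨u, huS, ⟨⟨hu, huc⟩, huS'⟩, v, hvS, hv, huv⟩ := hc ((X \ {c}) ∩ S)
      ⟨x0, hx0S.1, ⟨hx0, hx0S.2⟩, hx0S.1⟩ ⟨c, hcS, fun h => h.1.2 rfl⟩
    obtain ⟨u', huS', ⟨⟨hu', huc'⟩, -⟩, v', hvS', hv', huv'⟩ := hc (Xᶜ \ {c} ∩ S)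
      ⟨y0, hy0S.1, ⟨hy0, hy0S.2⟩, hy0S.1⟩ ⟨c, hcS, fun h => h.1.2 rfl⟩
    have hvc : v = c := by
      by_contra h1
      exact hX u ⟨huS, huc⟩ hu v ⟨hvS, h1⟩ (fun h2 => hv ⟨⟨h2, h1⟩, hvS⟩) huv
    have hvc' : v' = c := by
      by_contra h1
      refine hX v' ⟨hvS', h1⟩ ?_ u' ⟨huS', huc'⟩ hu' huv'.symm
      by_contra h2
      exact hv' ⟨⟨h2, h1⟩, hvS'⟩
    subst hvc
    obtain ⟨a, ha1, rfl⟩ := huv.exists_dart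
    obtain ⟨b, hb1, rfl⟩ := huv'.exists_dart
    have haS : a ∈ dartsIn G S := ⟨ha1 ▸ huS, hvS⟩
    have hbS : b ∈ dartsIn G S := ⟨hb1 ▸ huS', hvS'⟩
    have hs := (h.rotation _ ((flip_mem_dartsIn a).2 haS) _ ((flip_mem_dartsIn b).2 hbS)).2
      hvc'.symm
    have hKab : K (flip G a) = K (flip G b) :=
      (cycles_le_iff (t := Setoid.ker K)).2 (fun d => propext (hcon d)) hs
    have hKa : K a := Or.inl ⟨ha1 ▸ hu, ha1 ▸ huc⟩
    rw [← hKf, hKab, hKf, hK b hbS (hb1 ▸ huc'), hb1] at hKa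
    exact hu' hKa
  obtain ⟨x, hx⟩ := hex
  -- The colour also changes along the face at this corner, hence a second time on the same face,
  -- and again at `c`. These are the two corners.
  obtain ⟨w, hwx, hs, hw⟩ := exists_second_change (φ := σ * flip G) (K := K) (z := flip G x)
    (by rwa [Perm.mul_apply, flip_flip, hKf])
  have hw' : ¬ (K (flip G w) ↔ K (σ (flip G w))) := by rwa [hKf]
  obtain ⟨hxS, hxc⟩ := hKc x hx
  obtain ⟨hwS, hwc⟩ := hKc _ hw'
  refine ⟨x, hxS, flip G w, hwS, fun e => hwx ?_, hxc, hwc, ?_⟩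
  · rw [e, flip_flip]
  · rwa [flip_flip]

/-- An embedding of a connected set can be split at a cut-vertex. -/
theorem SubEmbedding.split (hG : Loopless G) {S : Set V} {σ : Perm (Dart G)}
    (h : SubEmbedding G S σ) (hc : ConnOn G S) {c : V} (hcS : c ∈ S)
    (hcut : ¬ ConnOn G (S \ {c})) :
    ∃ (A B : Set V) (σA σB : Perm (Dart G)), A ∪ B = S ∧ c ∈ A ∧ c ∈ B ∧ A ∩ B ⊆ {c} ∧
      A.Nontrivial ∧ B.Nontrivial ∧ ConnOn G A ∧ ConnOn G B ∧
      (∀ d ∈ dartsIn G S, d ∈ dartsIn G A ∨ d ∈ dartsIn G B) ∧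
      SubEmbedding G A σA ∧ SubEmbedding G B σB ∧
      (∀ v ∈ A, v ≠ c → modality σA v = modality σ v) ∧
      (∀ v ∈ B, v ≠ c → modality σB v = modality σ v) ∧
      (modality σA c - 2) + (modality σB c - 2) ≤ modality σ c - 2 := by
  classical
  obtain ⟨x, hx, y, hy, hxy, hxc, hyc, hface⟩ := h.exists_corners hc hcS hcut
  have hss : σ.SameCycle x y := (h.rotation x hx y hy).2 (hxc.trans hyc.symm)
  rw [← flip_inv_apply, ← flip_inv_apply] at hface
  obtain ⟨hg, hJ⟩ := split_of_same_face hxy hss hface h.planar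
  obtain ⟨A, hA, hAv, hAS, hxA, hAn, hAc, hAd, hAτ⟩ :=
    h.part hG hx hy (hxc.trans hyc.symm) hJ
  have hcomm : swap x y = swap y x := swap_comm x y
  have hJ' : ¬ (cycles (σ * swap y x) ⊔ cycles (flip G)) y x := by
    rw [← hcomm]
    exact fun h' => hJ (Setoid.symm' _ h')
  obtain ⟨B, hB, hBv, hBS, hyB, hBn, hBc, hBd, hBτ⟩ :=
    h.part hG hy hx (hyc.trans hxc.symm) hJ'
  rw [← hcomm] at hB hBv hBτ
  rw [hxc] at hxA hAd
  rw [hyc] at hyB hBd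
  set J := cycles (σ * swap x y) ⊔ cycles (flip G) with hJdef
  have hσ' : ∀ d, J d ((σ * swap x y) d) := cycles_le_iff.1 le_sup_left
  have hfl : ∀ d, J d (flip G d) := cycles_le_iff.1 le_sup_right
  have hcover : ∀ d ∈ dartsIn G S, d ∈ dartsIn G A ∨ d ∈ dartsIn G B := by
    intro d hd
    -- Before the split all edge ends form one orbit, and this orbit is obtained by gluing those of
    -- `x` and `y` after it. So there are only two sides.
    have e := glue_sup_cycles_mul_swap (α := flip G) hss
    have : (cycles σ ⊔ cycles (flip G)) d x := hc.darts_related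
      (s := cycles σ ⊔ cycles (flip G))
      (fun d hd d' hd' hv => (le_sup_left : cycles σ ≤ _) ((h.rotation d hd d' hd').2 hv))
      (cycles_le_iff.1 le_sup_right) hd hx
    rw [← e] at this
    rw [hA, hB]
    rcases glue_apply.1 this with h1 | ⟨h1, _⟩ | ⟨h1, _⟩
    · exact Or.inl h1
    · exact Or.inl h1
    · exact Or.inr h1
  have hdisj : ∀ d, d ∈ dartsIn G A → d ∉ dartsIn G B := by
    intro d h1 h2
    rw [hA] at h1
    rw [hB] at h2
    exact hJ (J.trans (J.symm h1) h2)
  have hmapA : ∀ d, (σ * swap x y) d ∈ dartsIn G A ↔ d ∈ dartsIn G A := by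
    intro d
    rw [hA, hA]
    exact ⟨J.trans (hσ' d), J.trans (J.symm (hσ' d))⟩
  have hmapB : ∀ d, (σ * swap x y) d ∈ dartsIn G B ↔ d ∈ dartsIn G B := by
    intro d
    rw [hB, hB]
    exact ⟨J.trans (hσ' d), J.trans (J.symm (hσ' d))⟩
  obtain ⟨σA, hσA, hσA'⟩ := exists_restriction _ hmapA
  obtain ⟨σB, hσB, hσB'⟩ := exists_restriction _ hmapB
  have hout : ∀ d, d ∉ dartsIn G S → (σ * swap x y) d = d := by
    intro d hd
    have hdx : d ≠ x := by rintro rfl; exact hd hx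
    have hdy : d ≠ y := by rintro rfl; exact hd hy
    rw [Perm.mul_apply, swap_apply_of_ne_of_ne hdx hdy, h.fixes d hd]
  have hBoff : ∀ d, d ∉ dartsIn G A → σB d = (σ * swap x y) d := by
    intro d hd
    by_cases hdB : d ∈ dartsIn G B
    · exact hσB d hdB
    · rw [hσB' d hdB, hout d fun hdS => (hcover d hdS).elim hd hdB]
  -- The genera of the two sides are nonnegative and add up to `0`, so both sides are planar.
  have hgen := genus_eq_add (A := dartsIn G A) (τ := σA) (υ := σB) hmapA
    flip_mem_dartsIn hσA hσA' (fun d hd => hσB' d (hdisj d hd)) hBoff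
  rw [hg] at hgen
  have hg1 := genus_nonneg σA (flip G)
  have hg2 := genus_nonneg σB (flip G)
  have hEA := hAτ σA hσA hσA' (by omega)
  have hEB := hBτ σB hσB hσB' (by omega)
  have hinter : A ∩ B ⊆ {c} := by
    rintro v ⟨hvA, hvB⟩
    by_contra hvc
    obtain ⟨d, hd, rfl⟩ := (hAv v).1 hvA
    have hdS : d ∈ dartsIn G S := by
      have := (hA d).2 hd
      exact ⟨hAS this.1, hAS this.2⟩
    exact hdisj d ((hA d).2 hd) (hBd _ hvB hvc d hdS rfl)
  have hmodA : ∀ v ∈ A, v ≠ c → modality σA v = modality σ v := by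
    intro v hv hvc
    refine modality_congr fun d hd => ?_
    by_cases hdS : d ∈ dartsIn G S
    · rw [hσA d (hAd v hv hvc d hdS hd), Perm.mul_apply, swap_apply_of_ne_of_ne]
      · rintro rfl; exact hvc (hd.symm.trans hxc)
      · rintro rfl; exact hvc (hd.symm.trans hyc)
    · rw [hEA.fixes d fun h' => hdS ⟨hAS h'.1, hAS h'.2⟩, h.fixes d hdS]
  have hmodB : ∀ v ∈ B, v ≠ c → modality σB v = modality σ v := by
    intro v hv hvc
    refine modality_congr fun d hd => ?_
    by_cases hdS : d ∈ dartsIn G S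
    · rw [hσB d (hBd v hv hvc d hdS hd), Perm.mul_apply, swap_apply_of_ne_of_ne]
      · rintro rfl; exact hvc (hd.symm.trans hxc)
      · rintro rfl; exact hvc (hd.symm.trans hyc)
    · rw [hEB.fixes d fun h' => hdS ⟨hBS h'.1, hBS h'.2⟩, h.fixes d hdS]
  refine ⟨A, B, σA, σB, ?_, hxA, hyB, hinter, hAn, hBn, hAc, hBc, hcover, hEA, hEB, hmodA,
    hmodB, ?_⟩
  · refine Set.Subset.antisymm (Set.union_subset hAS hBS) fun v hv => ?_
    by_cases hvc : v = c
    · exact Or.inl (hvc ▸ hxA)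
    · obtain ⟨d, hd, rfl⟩ := hc.exists_dart ⟨v, hv, c, hcS, hvc⟩ hv
      exact (hcover d hd).imp (fun h => h.1) (fun h => h.1)
  -- The exchange creates at most two alternations, which suffices when both sides have positive,
  -- hence even and at least `2`, modality at `c`. A side of modality `0` forces one of the two new
  -- pairs not to alternate; then `htri` shows that the total does not grow at all.
  · have h1 := modality_mul_swap σ hxy hxc hyc
    have h2 : modality σA c + modality σB c = modality (σ * swap x y) c := by
      refine modality_add c fun d => ?_
      by_cases hd : d ∈ dartsIn G A
      · exact Or.inl ⟨hσA d hd, hσB' d (hdisj d hd)⟩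
      · exact Or.inr ⟨hσA' d hd, hBoff d hd⟩
    have eA := even_modality hEA.vertex_apply c
    have eB := even_modality hEB.vertex_apply c
    have hxA' : x ∈ dartsIn G A := (hA x).2 (J.refl x)
    have hyB' : y ∈ dartsIn G B := (hB y).2 (J.refl y)
    have hzA : modality σA c = 0 → alternation x (σ y) = 0 := fun h0 => by
      have := alternation_eq_zero_of_modality h0 hxc
      rwa [hσA x hxA', Perm.mul_apply, swap_apply_left] at this
    have hzB : modality σB c = 0 → alternation y (σ x) = 0 := fun h0 => by
      have := alternation_eq_zero_of_modality h0 hyc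
      rwa [hσB y hyB', Perm.mul_apply, swap_apply_right] at this
    have htri : (alternation x (σ y) = 0 ∨ alternation y (σ x) = 0) →
        alternation x (σ y) + alternation y (σ x) ≤ alternation x (σ x) + alternation y (σ y) := by
      simp only [alternation]
      cases Dart.outgoing x <;> cases Dart.outgoing y <;> cases Dart.outgoing (σ x) <;>
        cases Dart.outgoing (σ y) <;> simp
    have hle : alternation x (σ y) + alternation y (σ x) ≤ 2 := by
      simp only [alternation]
      split_ifs <;> omega
    rcases Nat.eq_zero_or_pos (modality σA c) with h0 | h0
    · have := htri (Or.inl (hzA h0))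
      omega
    · rcases Nat.eq_zero_or_pos (modality σB c) with h0' | h0'
      · have := htri (Or.inr (hzB h0'))
        omega
      · obtain ⟨a, ha⟩ := eA
        obtain ⟨b, hb⟩ := eB
        omega

/-- Embeddings of two connected sets that share one vertex can be merged. -/
theorem SubEmbedding.merge {A B : Set V} {σA σB : Perm (Dart G)}
    (hA : SubEmbedding G A σA) (hB : SubEmbedding G B σB) (hAc : ConnOn G A) (hBc : ConnOn G B)
    (hAn : A.Nontrivial) (hBn : B.Nontrivial) (hG : Loopless G) {c : V} (hcA : c ∈ A) (hcB : c ∈ B)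
    (hAB : A ∩ B ⊆ {c})
    (hcover : ∀ d ∈ dartsIn G (A ∪ B), d ∈ dartsIn G A ∨ d ∈ dartsIn G B) :
    ∃ σ, SubEmbedding G (A ∪ B) σ ∧
      (∀ v ∈ A, v ≠ c → modality σ v = modality σA v) ∧
      (∀ v ∈ B, v ≠ c → modality σ v = modality σB v) ∧
      modality σ c - 2 ≤ (modality σA c - 2) + (modality σB c - 2) := by
  classical
  have hdisj : ∀ d, d ∈ dartsIn G A → d ∉ dartsIn G B := fun d h1 h2 =>
    d.vertex_ne hG ((hAB ⟨h1.1, h2.1⟩).trans (hAB ⟨h1.2, h2.2⟩).symm)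
  have hsubA : ∀ d, d ∈ dartsIn G A → d ∈ dartsIn G (A ∪ B) := fun d h => ⟨.inl h.1, .inl h.2⟩
  have hsubB : ∀ d, d ∈ dartsIn G B → d ∈ dartsIn G (A ∪ B) := fun d h => ⟨.inr h.1, .inr h.2⟩
  have h0A : ∀ d ∈ dartsIn G A, (σA * σB) d = σA d := fun d hd => by
    rw [Perm.mul_apply, hB.fixes d (hdisj d hd)]
  have h0B : ∀ d ∉ dartsIn G A, (σA * σB) d = σB d := fun d hd => by
    rw [Perm.mul_apply]
    by_cases hd' : d ∈ dartsIn G B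
    · exact hA.fixes _ fun h => hdisj _ h ((hB.apply_mem_iff d).2 hd')
    · rw [hB.fixes d hd', hA.fixes d hd]
  have hmap : ∀ d, (σA * σB) d ∈ dartsIn G A ↔ d ∈ dartsIn G A := by
    intro d
    by_cases hd : d ∈ dartsIn G A
    · rw [h0A d hd, hA.apply_mem_iff]
    · refine iff_of_false ?_ hd
      rw [h0B d hd]
      by_cases hd' : d ∈ dartsIn G B
      · exact fun h => hdisj _ h ((hB.apply_mem_iff d).2 hd')
      · rwa [hB.fixes d hd']
  have hg0 : genus (σA * σB) (flip G) = 0 := by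
    rw [genus_eq_add (A := dartsIn G A) (τ := σA) (υ := σB) hmap flip_mem_dartsIn
      (fun d hd => (h0A d hd).symm) hA.fixes (fun d hd => hB.fixes d (hdisj d hd))
      (fun d hd => (h0B d hd).symm), hA.planar, hB.planar, add_zero]
  have hv0 : ∀ d, ((σA * σB) d).vertex = d.vertex := fun d => by
    rw [Perm.mul_apply, hA.vertex_apply, hB.vertex_apply]
  have hm0 : ∀ v, modality σA v + modality σB v = modality (σA * σB) v := fun v => by
    refine modality_add v fun d => ?_
    by_cases hd : d ∈ dartsIn G A
    · exact Or.inl ⟨(h0A d hd).symm, hB.fixes d (hdisj d hd)⟩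
    · exact Or.inr ⟨hA.fixes d hd, (h0B d hd).symm⟩
  -- Choice of the corners. If both modalities are positive, an out-in alternation of `A` is matched
  -- with an in-out alternation of `B`, and both disappear. If one is `0`, that side is inserted
  -- into an alternation of the other whose first end has its orientation, which costs nothing. If
  -- both are `0`, any corners give at most `2`.
  have hch : ∃ x ∈ dartsIn G A, ∃ y ∈ dartsIn G B, x.vertex = c ∧ y.vertex = c ∧
      modality ((σA * σB) * swap x y) c - 2 ≤ (modality σA c - 2) + (modality σB c - 2) := by
    have memA : ∀ d : Dart G, Dart.outgoing (σA d) = !Dart.outgoing d → d ∈ dartsIn G A :=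
      fun d h => by
        by_contra hd
        rw [hA.fixes d hd] at h
        simp at h
    have memB : ∀ d : Dart G, Dart.outgoing (σB d) = !Dart.outgoing d → d ∈ dartsIn G B :=
      fun d h => by
        by_contra hd
        rw [hB.fixes d hd] at h
        simp at h
    have main : ∀ x ∈ dartsIn G A, ∀ y ∈ dartsIn G B, x.vertex = c → y.vertex = c →
        modality ((σA * σB) * swap x y) c + alternation x (σA x) + alternation y (σB y) =
          modality σA c + modality σB c + alternation x (σB y) + alternation y (σA x) := by
      intro x hx y hy hxc hyc
      have hne : x ≠ y := fun e => hdisj x hx (e ▸ hy)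
      have := modality_mul_swap (σA * σB) hne hxc hyc
      rwa [h0A x hx, h0B y (fun h => hdisj y h hy), ← hm0] at this
    obtain ⟨a, haA, hac⟩ := hAc.exists_dart hAn hcA
    obtain ⟨b, hbB, hbc⟩ := hBc.exists_dart hBn hcB
    have haltle : ∀ d d' : Dart G, alternation d d' ≤ 1 := fun d d' => by
      simp only [alternation]
      split_ifs <;> omega
    by_cases hA0 : modality σA c = 0
    · have za := alternation_eq_zero_of_modality hA0 hac
      by_cases hB0 : modality σB c = 0
      · refine ⟨a, haA, b, hbB, hac, hbc, ?_⟩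
        have := main a haA b hbB hac hbc
        have := haltle a (σB b)
        have := haltle b (σA a)
        omega
      · obtain ⟨y, hyc, hy1, hy2⟩ := exists_alternation hB.vertex_apply hB0 (Dart.outgoing a)
        have hyB := memB y (by rw [hy2, hy1])
        refine ⟨a, haA, y, hyB, hac, hyc, ?_⟩
        have := main a haA y hyB hac hyc
        have e : alternation a (σB y) + alternation y (σA a) ≤ alternation y (σB y) := by
          simp only [alternation, hy1, hy2] at za ⊢
          simp at za
          simp [za]
        omega
    · by_cases hB0 : modality σB c = 0
      · have zb := alternation_eq_zero_of_modality hB0 hbc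
        obtain ⟨x, hxc, hx1, hx2⟩ := exists_alternation hA.vertex_apply hA0 (Dart.outgoing b)
        have hxA := memA x (by rw [hx2, hx1])
        refine ⟨x, hxA, b, hbB, hxc, hbc, ?_⟩
        have := main x hxA b hbB hxc hbc
        have e : alternation x (σB b) + alternation b (σA x) ≤ alternation x (σA x) := by
          simp only [alternation, hx1, hx2] at zb ⊢
          simp at zb
          simp [zb]
        omega
      · obtain ⟨x, hxc, hx1, hx2⟩ := exists_alternation hA.vertex_apply hA0 true
        obtain ⟨y, hyc, hy1, hy2⟩ := exists_alternation hB.vertex_apply hB0 false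
        have hxA := memA x (by rw [hx2, hx1])
        have hyB := memB y (by rw [hy2, hy1])
        refine ⟨x, hxA, y, hyB, hxc, hyc, ?_⟩
        have := main x hxA y hyB hxc hyc
        simp only [alternation, hx1, hx2, hy1, hy2] at this
        simp at this
        have eA := even_modality hA.vertex_apply c
        have eB := even_modality hB.vertex_apply c
        obtain ⟨a, ha⟩ := eA
        obtain ⟨b, hb⟩ := eB
        omega
  obtain ⟨x, hxA, y, hyB, hxc, hyc, hmod⟩ := hch
  have hxy : x ≠ y := fun e => hdisj x hxA (e ▸ hyB)
  -- The product rotation keeps the two sides in different orbits, so `genus_merge` applies to the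
  -- swap.
  have hJ : ¬ (cycles (σA * σB) ⊔ cycles (flip G)) x y := by
    intro h
    have hle : cycles (σA * σB) ⊔ cycles (flip G) ≤ Setoid.ker fun d => d ∈ dartsIn G A :=
      sup_le (cycles_le_iff.2 fun d => propext (hmap d).symm)
        (cycles_le_iff.2 fun d => propext (flip_mem_dartsIn d).symm)
    have h' : (x ∈ dartsIn G A) = (y ∈ dartsIn G A) := hle h
    exact hdisj y (h' ▸ hxA) hyB
  have hv : ∀ d, ((σA * σB * swap x y) d).vertex = d.vertex := by
    intro d
    rw [Perm.mul_apply, hv0]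
    rcases eq_or_ne d x with rfl | h1
    · rw [swap_apply_left, hxc, hyc]
    · rcases eq_or_ne d y with rfl | h2
      · rw [swap_apply_right, hxc, hyc]
      · rw [swap_apply_of_ne_of_ne h1 h2]
  have hmodne : ∀ v, v ≠ c → modality (σA * σB * swap x y) v = modality (σA * σB) v := by
    intro v hvc
    refine modality_congr fun d hd => ?_
    rw [Perm.mul_apply, swap_apply_of_ne_of_ne]
    · rintro rfl; exact hvc (hd.symm.trans hxc)
    · rintro rfl; exact hvc (hd.symm.trans hyc)
  have hzero : ∀ {S : Set V} {τ : Perm (Dart G)}, SubEmbedding G S τ → ∀ v, v ∉ S →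
      modality τ v = 0 := by
    intro S τ hτ v hv
    have : IsEmpty {d : Dart G // d.vertex = v ∧ Dart.outgoing (τ d) ≠ Dart.outgoing d} :=
      ⟨fun ⟨d, hd, hd'⟩ => hd' (by rw [hτ.fixes d fun h => hv (hd ▸ h.1)])⟩
    exact Nat.card_of_isEmpty
  refine ⟨σA * σB * swap x y, ⟨?_, ?_, ?_⟩, ?_, ?_, hmod⟩
  · intro d hd
    have h1 : d ∉ dartsIn G A := fun h => hd (hsubA d h)
    have h2 : d ∉ dartsIn G B := fun h => hd (hsubB d h)
    rw [Perm.mul_apply, swap_apply_of_ne_of_ne, h0B d h1, hB.fixes d h2]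
    · rintro rfl; exact h1 hxA
    · rintro rfl; exact h2 hyB
  · have hle : cycles (σA * σB) ≤ cycles (σA * σB * swap x y) ∧
        cycles (σA * σB * swap x y) x y := by
      have hn : ¬ (σA * σB).SameCycle x y := fun h => hJ ((le_sup_left : cycles _ ≤ _) h)
      have hs := sameCycle_mul_swap_of_not hn
      have e := glue_cycles_mul_swap (σA * σB) x y
      rw [glue_eq_self (s := cycles (σA * σB * swap x y)) hs] at e
      exact ⟨e ▸ le_glue, hs⟩
    have kA : ∀ d ∈ dartsIn G A, ∀ d' ∈ dartsIn G A, d.vertex = d'.vertex →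
        cycles (σA * σB * swap x y) d d' := fun d hd d' hd' hv =>
      hle.1 (sameCycle_of_agree (A := dartsIn G A) (fun d hd => (hA.apply_mem_iff d).2 hd) h0A hd
        ((hA.rotation d hd d' hd').2 hv))
    have kB : ∀ d ∈ dartsIn G B, ∀ d' ∈ dartsIn G B, d.vertex = d'.vertex →
        cycles (σA * σB * swap x y) d d' := fun d hd d' hd' hv =>
      hle.1 (sameCycle_of_agree (A := dartsIn G B) (fun d hd => (hB.apply_mem_iff d).2 hd)
        (fun d hd => h0B d fun h => hdisj d h hd) hd ((hB.rotation d hd d' hd').2 hv))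
    have kAB : ∀ d ∈ dartsIn G A, ∀ d' ∈ dartsIn G B, d.vertex = d'.vertex →
        cycles (σA * σB * swap x y) d d' := fun d hd d' hd' hv => by
      have hdc : d.vertex = c := hAB ⟨hd.1, hv ▸ hd'.1⟩
      exact Setoid.trans' _ (Setoid.trans' _ (kA d hd x hxA (hdc.trans hxc.symm)) hle.2)
        (kB y hyB d' hd' (hyc.trans (hdc.symm.trans hv)))
    intro d hd d' hd'
    constructor
    · intro hs
      exact (cycles_le_iff (t := Setoid.ker Dart.vertex)).2 (fun a => (hv a).symm) hs
    · intro hvv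
      rcases hcover d hd with h1 | h1 <;> rcases hcover d' hd' with h2 | h2
      · exact kA d h1 d' h2 hvv
      · exact kAB d h1 d' h2 hvv
      · exact (kAB d' h2 d h1 hvv.symm).symm
      · exact kB d h1 d' h2 hvv
  · rw [genus_merge hJ, hg0]
  · intro v hvA hvc
    rw [hmodne v hvc, ← hm0, hzero hB v fun h => hvc (hAB ⟨hvA, h⟩), add_zero]
  · intro v hvB hvc
    rw [hmodne v hvc, ← hm0, hzero hA v fun h => hvc (hAB ⟨h, hvB⟩), zero_add]

end OneSums
end KModal

namespace KModal

open Equiv Equiv.Perm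

/-! ### Decomposing an embedding into embeddings of the blocks. -/

section Blocks

variable {V : Type} {G : Digraph V}

theorem connOn_diff_singleton_of_biconnected {B : Finset V} (hB : Biconnected (induce G B)) (c : V) :
    ConnOn G (B \ {c}) := by
  rw [biconnected_induce_iff] at hB
  by_cases hc : c ∈ B
  · exact hB.2.2 c hc
  · rw [Set.sdiff_singleton_eq_self (by exact_mod_cast hc)]
    exact hB.2.1

/-- A biconnected set is not separated by one vertex. -/
theorem subset_or_subset_of_biconnected {β : Finset V} (hβ : Biconnected (induce G β)) {A B : Set V}
    {c : V} (hsub : (β : Set V) ⊆ A ∪ B) (hAB : A ∩ B ⊆ {c})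
    (hcover : ∀ d ∈ dartsIn G (A ∪ B), d ∈ dartsIn G A ∨ d ∈ dartsIn G B) :
    (β : Set V) ⊆ A ∨ (β : Set V) ⊆ B := by
  by_contra hcon
  rw [not_or, Set.not_subset, Set.not_subset] at hcon
  obtain ⟨⟨a, haβ, haA⟩, b, hbβ, hbB⟩ := hcon
  have haB : a ∈ B := (hsub haβ).resolve_left haA
  have hbA : b ∈ A := (hsub hbβ).resolve_right hbB
  -- An edge of `β` that leaves `A` can do so only from `c`. This contradicts connectedness of `β`
  -- if `a` or `b` is `c`, and connectedness of `β` without `c` otherwise.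
  have key : ∀ x ∈ β, x ∈ A → ∀ y ∈ β, y ∉ A → Joined G x y → x = c ∧ x ∈ B := by
    intro x hx hxA y hy hyA hj
    obtain ⟨d, rfl, rfl⟩ := hj.exists_dart
    rcases hcover d ⟨hsub hx, hsub hy⟩ with h | h
    · exact absurd h.2 hyA
    · exact ⟨hAB ⟨hxA, h.1⟩, h.1⟩
  by_cases hab : a = c ∨ b = c
  · obtain ⟨x, hx, hxA, y, hy, hyA, hxy⟩ :=
      ((biconnected_induce_iff G β).1 hβ).2.1 A ⟨b, hbβ, hbA⟩ ⟨a, haβ, haA⟩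
    obtain ⟨hxc, hxB⟩ := key x hx hxA y hy hyA hxy
    rcases hab with h | h
    · exact haA (h ▸ hxc ▸ hxA)
    · exact hbB (h ▸ hxc ▸ hxB)
  · rw [not_or] at hab
    obtain ⟨x, hx, hxA, y, hy, hyA, hxy⟩ := connOn_diff_singleton_of_biconnected hβ c A
      ⟨b, ⟨hbβ, hab.2⟩, hbA⟩ ⟨a, ⟨haβ, hab.1⟩, haA⟩
    exact hx.2 (key x hx.1 hxA y hy.1 hyA hxy).1

variable [Fintype V]

open Classical in
/-- The maximal biconnected subsets of `S`. -/
noncomputable def blocksIn (G : Digraph V) (S : Set V) : Finset (Finset V) :=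
  Finset.univ.filter fun B => Maximal (fun A : Finset V => ↑A ⊆ S ∧ Biconnected (induce G A)) B

theorem mem_blocksIn {S : Set V} {B : Finset V} : B ∈ blocksIn G S ↔
    Maximal (fun A : Finset V => ↑A ⊆ S ∧ Biconnected (induce G A)) B := by
  simp [blocksIn]

theorem blocksIn_univ : blocksIn G Set.univ = blocks G := by
  ext B
  simp only [mem_blocksIn, blocks, Finset.mem_filter, Finset.mem_univ, true_and, Set.subset_univ]

-- Induction on the size of `S`: split at a cut-vertex and treat both sides. Each block of `S` lies
-- in one side, and the inequality of `SubEmbedding.split` makes the bounds at `c` add up. Without a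
-- cut-vertex `S` is its own only block.
open Classical in
theorem SubEmbedding.exists_blocks (hG : Loopless G) {S : Set V} {σ : Perm (Dart G)}
    (h : SubEmbedding G S σ) (hc : ConnOn G S) (hn : S.Nontrivial) :
    ∃ τ : Finset V → Perm (Dart G), (∀ β ∈ blocksIn G S, SubEmbedding G β (τ β)) ∧
      ∀ v, ∑ β ∈ blocksIn G S with v ∈ β, (modality (τ β) v - 2) ≤ modality σ v - 2 := by
  obtain ⟨k, hk⟩ : ∃ k, k = S.ncard := ⟨_, rfl⟩
  induction k using Nat.strong_induction_on generalizing S σ with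
  | _ k ih =>
    by_cases hcut : ∃ c ∈ S, ¬ ConnOn G (S \ {c})
    · obtain ⟨c, hcS, hcut⟩ := hcut
      obtain ⟨A, B, σA, σB, rfl, hcA, hcB, hAB, hAn, hBn, hAc, hBc, hcover, hEA, hEB, hmA, hmB,
        hsum⟩ := h.split hG hc hcS hcut
      have hltA : A.ncard < k := by
        rw [hk]
        refine Set.ncard_lt_ncard ⟨Set.subset_union_left, fun hs => ?_⟩ (Set.toFinite _)
        obtain ⟨b, hb, hbc⟩ := hBn.exists_ne c
        exact hbc (hAB ⟨hs (Or.inr hb), hb⟩)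
      have hltB : B.ncard < k := by
        rw [hk]
        refine Set.ncard_lt_ncard ⟨Set.subset_union_right, fun hs => ?_⟩ (Set.toFinite _)
        obtain ⟨b, hb, hbc⟩ := hAn.exists_ne c
        exact hbc (hAB ⟨hb, hs (Or.inl hb)⟩)
      obtain ⟨τA, hτA, hsA⟩ := ih _ hltA hEA hAc hAn rfl
      obtain ⟨τB, hτB, hsB⟩ := ih _ hltB hEB hBc hBn rfl
      have hmem : ∀ β ∈ blocksIn G (A ∪ B), ((β : Set V) ⊆ A → β ∈ blocksIn G A) ∧
          (¬ (β : Set V) ⊆ A → β ∈ blocksIn G B) := by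
        intro β hβ
        rw [mem_blocksIn] at hβ
        constructor
        · intro hA
          rw [mem_blocksIn]
          exact ⟨⟨hA, hβ.1.2⟩, fun C hC => hβ.2 ⟨hC.1.trans Set.subset_union_left, hC.2⟩⟩
        · intro hA
          have hB := (subset_or_subset_of_biconnected hβ.1.2 hβ.1.1 hAB hcover).resolve_left hA
          rw [mem_blocksIn]
          exact ⟨⟨hB, hβ.1.2⟩, fun C hC => hβ.2 ⟨hC.1.trans Set.subset_union_right, hC.2⟩⟩
      refine ⟨fun β => if (β : Set V) ⊆ A then τA β else τB β, ?_, ?_⟩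
      · intro β hβ
        dsimp only
        split_ifs with hA
        · exact hτA β ((hmem β hβ).1 hA)
        · exact hτB β ((hmem β hβ).2 hA)
      · intro v
        have hsplit : ∑ β ∈ blocksIn G (A ∪ B) with v ∈ β,
            (modality (if (β : Set V) ⊆ A then τA β else τB β) v - 2) ≤
            ∑ β ∈ blocksIn G A with v ∈ β, (modality (τA β) v - 2) +
            ∑ β ∈ blocksIn G B with v ∈ β, (modality (τB β) v - 2) := by
          rw [← Finset.sum_filter_add_sum_filter_not _ (fun β : Finset V => (β : Set V) ⊆ A)]
          refine add_le_add ?_ ?_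
          · refine (Finset.sum_le_sum_of_subset (f := fun β : Finset V => modality
              (if (β : Set V) ⊆ A then τA β else τB β) v - 2)
              (t := (blocksIn G A).filter (v ∈ ·) |>.filter fun β => (β : Set V) ⊆ A) ?_).trans ?_
            · intro β hβ
              simp only [Finset.mem_filter] at hβ ⊢
              exact ⟨⟨(hmem β hβ.1.1).1 hβ.2, hβ.1.2⟩, hβ.2⟩
            · rw [Finset.sum_congr rfl (g := fun β : Finset V => modality (τA β) v - 2) fun β hβ => by
                rw [if_pos (Finset.mem_filter.1 hβ).2]]
              exact Finset.sum_le_sum_of_subset (Finset.filter_subset _ _)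
          · rw [Finset.sum_congr rfl (g := fun β : Finset V => modality (τB β) v - 2) fun β hβ => by
                rw [if_neg (Finset.mem_filter.1 hβ).2]]
            refine Finset.sum_le_sum_of_subset fun β hβ => ?_
            simp only [Finset.mem_filter] at hβ ⊢
            exact ⟨(hmem β hβ.1.1).2 hβ.2, hβ.1.2⟩
        have hzero : ∀ (C : Set V) (τ : Finset V → Perm (Dart G)), v ∉ C →
            ∑ β ∈ blocksIn G C with v ∈ β, (modality (τ β) v - 2) = 0 := by
          intro C τ hv
          rw [Finset.filter_eq_empty_iff.2, Finset.sum_empty]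
          intro β hβ hvβ
          rw [mem_blocksIn] at hβ
          exact hv (hβ.1.1 hvβ)
        have h1 := hsA v
        have h2 := hsB v
        refine hsplit.trans ?_
        by_cases hvc : v = c
        · subst hvc
          omega
        · by_cases hvA : v ∈ A
          · rw [hzero B τB fun hvB => hvc (hAB ⟨hvA, hvB⟩), add_zero, ← hmA v hvA hvc]
            exact h1
          · rw [hzero A τA hvA, zero_add]
            by_cases hvB : v ∈ B
            · rw [← hmB v hvB hvc]
              exact h2
            · rw [hzero B τB hvB]
              exact Nat.zero_le _
    · push Not at hcut
      have hS : Biconnected (induce G S.toFinset) := by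
        rw [biconnected_induce_iff]
        simp only [Set.coe_toFinset, Set.mem_toFinset]
        refine ⟨?_, hc, hcut⟩
        rw [Finset.Nontrivial, Set.coe_toFinset]
        exact hn
      have hB : ∀ β ∈ blocksIn G S, β = S.toFinset := by
        intro β hβ
        rw [mem_blocksIn] at hβ
        have hle : β ≤ S.toFinset := fun v hv => Set.mem_toFinset.2 (hβ.1.1 hv)
        exact le_antisymm hle (hβ.2 ⟨by simp, hS⟩ hle)
      refine ⟨fun _ => σ, fun β hβ => ?_, fun v => ?_⟩
      · rw [hB β hβ, Set.coe_toFinset]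
        exact h
      · refine (Finset.sum_le_sum_of_subset (t := {S.toFinset}) fun β hβ => ?_).trans_eq
          (Finset.sum_singleton _ _)
        exact Finset.mem_singleton.2 (hB β (Finset.mem_filter.1 hβ).1)

end Blocks

/-! ### Graphs built up block by block. -/

section Sequences

variable {V : Type} {G : Digraph V}

/-- A sequence of biconnected sets, indexed by `I`, each of which shares only the vertex `head i`
with the earlier ones, that contains all edges. -/
structure BlockSequence (G : Digraph V) (I : Finset ℕ) (B : ℕ → Finset V) (head : ℕ → V) :
    Prop where
  biconnected : ∀ i ∈ I, Biconnected (induce G (B i))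
  head_mem : ∀ i ∈ I, head i ∈ B i
  inter : ∀ i ∈ I, ∀ j ∈ I, j < i → ∀ v ∈ B i, v ∈ B j → v = head i
  prev : ∀ i ∈ I, (∃ j ∈ I, j < i) → ∃ j ∈ I, j < i ∧ head i ∈ B j
  edge : ∀ u v, Joined G u v → ∃ i ∈ I, u ∈ B i ∧ v ∈ B i

namespace BlockSequence

variable {I : Finset ℕ} {B : ℕ → Finset V} {head : ℕ → V}

/-- The union of the sets with index less than `n`. -/
def initial (I : Finset ℕ) (B : ℕ → Finset V) (n : ℕ) : Set V := {v | ∃ j ∈ I, j < n ∧ v ∈ B j}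

theorem initial_succ_of_mem {n : ℕ} (hn : n ∈ I) :
    initial I B (n + 1) = initial I B n ∪ B n := by
  ext v
  constructor
  · rintro ⟨j, hj, hjn, hv⟩
    rcases Nat.lt_succ_iff_lt_or_eq.1 hjn with h | rfl
    · exact Or.inl ⟨j, hj, h, hv⟩
    · exact Or.inr hv
  · rintro (⟨j, hj, hjn, hv⟩ | hv)
    · exact ⟨j, hj, by omega, hv⟩
    · exact ⟨n, hn, by omega, hv⟩

theorem initial_succ_of_not_mem {n : ℕ} (hn : n ∉ I) :
    initial I B (n + 1) = initial I B n := by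
  ext v
  constructor
  · rintro ⟨j, hj, hjn, hv⟩
    rcases Nat.lt_succ_iff_lt_or_eq.1 hjn with h | rfl
    · exact ⟨j, hj, h, hv⟩
    · exact absurd hj hn
  · rintro ⟨j, hj, hjn, hv⟩
    exact ⟨j, hj, by omega, hv⟩

/-- A later set that contained both ends of the edge would share them with earlier sets, so both
would be its head. -/
theorem exists_of_dart (T : BlockSequence G I B head) (hG : Loopless G) {n : ℕ} {d : Dart G}
    (hd : d ∈ dartsIn G (initial I B n)) : ∃ j ∈ I, j < n ∧ d ∈ dartsIn G (B j) := by
  obtain ⟨⟨i, hi, hin, hdi⟩, i', hi', hin', hdi'⟩ := hd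
  obtain ⟨j, hj, h1, h2⟩ := T.edge _ _ d.joined
  by_cases hjn : j < n
  · exact ⟨j, hj, hjn, h1, h2⟩
  · have e1 := T.inter j hj i hi (by omega) _ h1 hdi
    have e2 := T.inter j hj i' hi' (by omega) _ h2 hdi'
    exact absurd (e1.trans e2.symm) (d.vertex_ne hG)

theorem inter_initial (T : BlockSequence G I B head) {n : ℕ} (hn : n ∈ I) : initial I B n ∩ B n ⊆ {head n} := by
  rintro v ⟨⟨j, hj, hjn, hv⟩, hv'⟩
  exact T.inter n hn j hj hjn v hv' hv

theorem dart_cover (T : BlockSequence G I B head) (hG : Loopless G) {n : ℕ} (hn : n ∈ I) :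
    ∀ d ∈ dartsIn G (initial I B n ∪ B n), d ∈ dartsIn G (initial I B n) ∨ d ∈ dartsIn G (B n) := by
  intro d hd
  rw [← initial_succ_of_mem hn] at hd
  obtain ⟨j, hj, hjn, h⟩ := T.exists_of_dart hG hd
  rcases Nat.lt_succ_iff_lt_or_eq.1 hjn with h' | rfl
  · exact Or.inl ⟨⟨j, hj, h', h.1⟩, j, hj, h', h.2⟩
  · exact Or.inr h

theorem connOn (T : BlockSequence G I B head) (i : ℕ) (hi : i ∈ I) : ConnOn G (B i) :=
  ((biconnected_induce_iff G (B i)).1 (T.biconnected i hi)).2.1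

theorem nontrivial (T : BlockSequence G I B head) (i : ℕ) (hi : i ∈ I) : (B i).Nontrivial :=
  ((biconnected_induce_iff G (B i)).1 (T.biconnected i hi)).1

theorem head_mem_initial (T : BlockSequence G I B head) {n : ℕ} (hn : n ∈ I) (h : ∃ j ∈ I, j < n) : head n ∈ initial I B n := by
  obtain ⟨j, hj, hjn, hh⟩ := T.prev n hn h
  exact ⟨j, hj, hjn, hh⟩

theorem connOn_union {A C : Set V} (hA : ConnOn G A) (hC : ConnOn G C) {c : V} (hcA : c ∈ A)
    (hcC : c ∈ C) : ConnOn G (A ∪ C) := by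
  rintro X ⟨x, hx, hxX⟩ ⟨y, hy, hyX⟩
  have key : ∀ D : Set V, D ⊆ A ∪ C → ConnOn G D → (∃ x ∈ D, x ∈ X) → (∃ y ∈ D, y ∉ X) →
      ∃ x ∈ A ∪ C, x ∈ X ∧ ∃ y ∈ A ∪ C, y ∉ X ∧ Joined G x y := by
    intro D hD hDc h1 h2
    obtain ⟨x, hx, hxX, y, hy, hyX, hxy⟩ := hDc X h1 h2
    exact ⟨x, hD hx, hxX, y, hD hy, hyX, hxy⟩
  have kA := key A Set.subset_union_left hA
  have kC := key C Set.subset_union_right hC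
  by_cases hcX : c ∈ X
  · rcases hy with hy | hy
    · exact kA ⟨c, hcA, hcX⟩ ⟨y, hy, hyX⟩
    · exact kC ⟨c, hcC, hcX⟩ ⟨y, hy, hyX⟩
  · rcases hx with hx | hx
    · exact kA ⟨x, hx, hxX⟩ ⟨c, hcA, hcX⟩
    · exact kC ⟨x, hx, hxX⟩ ⟨c, hcC, hcX⟩

theorem initial_connOn (T : BlockSequence G I B head) (n : ℕ) : ConnOn G (initial I B n) := by
  induction n with
  | zero =>
    rintro X ⟨x, ⟨j, _, hj, _⟩, _⟩
    omega
  | succ n ih =>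
    by_cases hn : n ∈ I
    · rw [initial_succ_of_mem hn]
      by_cases h : ∃ j ∈ I, j < n
      · exact connOn_union ih (T.connOn n hn) (T.head_mem_initial hn h) (T.head_mem n hn)
      · have : initial I B n = ∅ := by
          ext v
          simp only [Set.mem_empty_iff_false, iff_false]
          rintro ⟨j, hj, hjn, -⟩
          exact h ⟨j, hj, hjn⟩
        rw [this, Set.empty_union]
        exact T.connOn n hn
    · rw [initial_succ_of_not_mem hn]
      exact ih

/-- Strip off the sets from the end: the last one meets the union of the others in at most one
vertex, and a biconnected set cannot be separated there. -/
theorem subset_of_biconnected (T : BlockSequence G I B head) (hG : Loopless G) {A : Finset V} (hA : Biconnected (induce G A)) :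
    ∃ i ∈ I, A ⊆ B i := by
  have hA' := (biconnected_induce_iff G A).1 hA
  have key : ∀ n, (A : Set V) ⊆ initial I B n → ∃ i ∈ I, A ⊆ B i := by
    intro n
    induction n with
    | zero =>
      intro h
      obtain ⟨v, hv⟩ := hA'.1.nonempty
      obtain ⟨j, _, hj, _⟩ := h hv
      omega
    | succ n ih =>
      intro h
      by_cases hn : n ∈ I
      · rw [initial_succ_of_mem hn] at h
        rcases subset_or_subset_of_biconnected hA h (T.inter_initial hn) (T.dart_cover hG hn) with
          h' | h'
        · exact ih h'
        · exact ⟨n, hn, by exact_mod_cast h'⟩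
      · rw [initial_succ_of_not_mem hn] at h
        exact ih h
  refine key (I.sup id + 1) fun v hv => ?_
  obtain ⟨d, -, rfl⟩ := hA'.2.1.exists_dart hA'.1 hv
  obtain ⟨j, hj, h1, -⟩ := T.edge _ _ d.joined
  exact ⟨j, hj, Nat.lt_succ_of_le (Finset.le_sup (f := id) hj), h1⟩

/-- Different sets share at most one vertex, while each has at least two. -/
theorem eq_of_subset (T : BlockSequence G I B head) {i j : ℕ} (hi : i ∈ I) (hj : j ∈ I) (h : B i ⊆ B j) : i = j := by
  obtain ⟨u, hu, v, hv, huv⟩ := T.nontrivial i hi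
  rcases lt_trichotomy i j with hij | hij | hij
  · exact absurd ((T.inter j hj i hi hij u (h hu) hu).trans
      (T.inter j hj i hi hij v (h hv) hv).symm) huv
  · exact hij
  · exact absurd ((T.inter i hi j hj hij u hu (h hu)).trans
      (T.inter i hi j hj hij v hv (h hv)).symm) huv

theorem injOn (T : BlockSequence G I B head) : Set.InjOn B I := fun _ hi _ hj h => T.eq_of_subset hi hj h.subset

open Classical in
theorem blocks_eq [Fintype V] (T : BlockSequence G I B head) (hG : Loopless G) : blocks G = I.image B := by
  ext A
  simp only [blocks, Finset.mem_filter, Finset.mem_univ, true_and, Finset.mem_image]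
  constructor
  · intro hA
    obtain ⟨i, hi, hAi⟩ := T.subset_of_biconnected hG hA.1
    exact ⟨i, hi, le_antisymm (hA.2 (T.biconnected i hi) hAi) hAi⟩
  · rintro ⟨i, hi, rfl⟩
    refine ⟨T.biconnected i hi, fun A hA hle => ?_⟩
    obtain ⟨j, hj, hAj⟩ := T.subset_of_biconnected hG hA
    have := T.eq_of_subset hi hj (hle.trans hAj)
    exact this ▸ hAj

-- The sets are merged in order, each at its head. The union so far is connected, meets the next set
-- exactly there, and only at that vertex do reduced modalities have to be added.
open Classical in
theorem exists_merged [Fintype V] (T : BlockSequence G I B head) (hG : Loopless G) {τ : ℕ → Perm (Dart G)}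
    (hτ : ∀ i ∈ I, SubEmbedding G (B i) (τ i)) (n : ℕ) (hn : ∃ j ∈ I, j < n) :
    ∃ σ, SubEmbedding G (initial I B n) σ ∧
      ∀ v ∈ initial I B n, modality σ v - 2 ≤
        ∑ i ∈ I with i < n ∧ v ∈ B i, (modality (τ i) v - 2) := by
  induction n with
  | zero => obtain ⟨j, _, hj⟩ := hn; omega
  | succ n ih =>
    by_cases hnI : n ∈ I
    · rw [initial_succ_of_mem hnI]
      have hsum : ∀ v, v ∈ B n → ∑ i ∈ I with i < n + 1 ∧ v ∈ B i, (modality (τ i) v - 2) =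
          ∑ i ∈ I with i < n ∧ v ∈ B i, (modality (τ i) v - 2) + (modality (τ n) v - 2) := by
        intro v hv
        rw [add_comm _ (modality (τ n) v - 2),
          ← Finset.sum_insert (f := fun i => modality (τ i) v - 2) (by simp)]
        congr 1
        ext i
        simp only [Finset.mem_filter, Finset.mem_insert]
        constructor
        · rintro ⟨h1, h2, h3⟩
          rcases Nat.lt_succ_iff_lt_or_eq.1 h2 with h | h
          · exact Or.inr ⟨h1, h, h3⟩
          · exact Or.inl h
        · rintro (rfl | ⟨h1, h2, h3⟩)
          · exact ⟨hnI, by omega, hv⟩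
          · exact ⟨h1, by omega, h3⟩
      by_cases h : ∃ j ∈ I, j < n
      · obtain ⟨σ, hσ, hm⟩ := ih h
        have hin : (initial I B n).Nontrivial := by
          obtain ⟨j, hj, hjn⟩ := h
          exact (T.nontrivial j hj).mono fun v hv => ⟨j, hj, hjn, hv⟩
        obtain ⟨ρ, hρ, h1, h2, h3⟩ := hσ.merge (hτ n hnI) (T.initial_connOn n) (T.connOn n hnI) hin
          (T.nontrivial n hnI) hG (T.head_mem_initial hnI h) (T.head_mem n hnI)
          (T.inter_initial hnI) (T.dart_cover hG hnI)
        refine ⟨ρ, hρ, fun v hv => ?_⟩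
        by_cases hvn : v ∈ B n
        · rw [hsum v hvn]
          by_cases hvh : v = head n
          · have := hm (head n) (T.head_mem_initial hnI h)
            rw [hvh]
            omega
          · rw [h2 v hvn hvh]
            omega
        · have hvi : v ∈ initial I B n := hv.resolve_right hvn
          have hvh : v ≠ head n := fun e => hvn (e ▸ T.head_mem n hnI)
          rw [h1 v hvi hvh]
          refine (hm v hvi).trans (Finset.sum_le_sum_of_subset fun i hi => ?_)
          simp only [Finset.mem_filter] at hi ⊢
          exact ⟨hi.1, by omega, hi.2.2⟩
      · have he : initial I B n = ∅ := by
          ext v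
          simp only [Set.mem_empty_iff_false, iff_false]
          rintro ⟨j, hj, hjn, -⟩
          exact h ⟨j, hj, hjn⟩
        rw [he, Set.empty_union]
        exact ⟨τ n, hτ n hnI, fun v hv => by rw [hsum v hv]; omega⟩
    · rw [initial_succ_of_not_mem hnI]
      have hn' : ∃ j ∈ I, j < n := by
        obtain ⟨j, hj, hjn⟩ := hn
        rcases Nat.lt_succ_iff_lt_or_eq.1 hjn with h | rfl
        · exact ⟨j, hj, h⟩
        · exact absurd hj hnI
      obtain ⟨σ, hσ, hm⟩ := ih hn'
      refine ⟨σ, hσ, fun v hv => (hm v hv).trans (Finset.sum_le_sum_of_subset fun i hi => ?_)⟩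
      simp only [Finset.mem_filter] at hi ⊢
      exact ⟨hi.1, by omega, hi.2.2⟩

open Classical in
/-- The modalities of the embeddings of the blocks that make up an embedding of the graph. -/
theorem maxModality_iff_exists [Fintype V] (T : BlockSequence G I B head) (hG : Loopless G) (hc : SimplyConnected G) [Nontrivial V]
    {m : V → ℕ} (hm : ∀ v, Even (m v)) :
    MaxModality G m ↔ (∀ v, m v = 0 → Monochromatic G v) ∧
      ∃ τ : ℕ → Perm (Dart G), (∀ i ∈ I, SubEmbedding G (B i) (τ i)) ∧
        ∀ v, ∑ i ∈ I with v ∈ B i, (modality (τ i) v - 2) ≤ m v - 2 := by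
  rw [maxModality_iff hc]
  have hcon := ((simplyConnected_iff G).1 hc).1
  constructor
  · rintro ⟨σ, hσ, hle⟩
    refine ⟨fun v hv => monochromatic_of_modality_eq_zero hσ (by have := hle v; omega), ?_⟩
    obtain ⟨τ, hτ, hs⟩ := hσ.exists_blocks hG hcon Set.nontrivial_univ
    rw [blocksIn_univ, T.blocks_eq hG] at hτ hs
    refine ⟨fun i => τ (B i), fun i hi => hτ _ (Finset.mem_image_of_mem B hi), fun v => ?_⟩
    have h1 := hs v
    rw [Finset.filter_image, Finset.sum_image (T.injOn.mono fun i hi => (Finset.mem_filter.1 hi).1)] at h1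
    exact h1.trans (Nat.sub_le_sub_right (hle v) 2)
  · rintro ⟨hmono, τ, hτ, hs⟩
    have hcov : ∀ v, ∃ i ∈ I, v ∈ B i := fun v => by
      obtain ⟨d, -, rfl⟩ := hcon.exists_dart Set.nontrivial_univ (Set.mem_univ v)
      obtain ⟨j, hj, h1, -⟩ := T.edge _ _ d.joined
      exact ⟨j, hj, h1⟩
    have hlt : ∀ i ∈ I, i < I.sup id + 1 := fun i hi =>
      Nat.lt_succ_of_le (Finset.le_sup (f := id) hi)
    have huniv : initial I B (I.sup id + 1) = Set.univ := by
      ext v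
      obtain ⟨i, hi, hv⟩ := hcov v
      exact iff_of_true ⟨i, hi, hlt i hi, hv⟩ trivial
    obtain ⟨i0, hi0, -⟩ := hcov (Classical.arbitrary V)
    obtain ⟨σ, hσ, hb⟩ := T.exists_merged hG hτ (I.sup id + 1) ⟨i0, hi0, hlt i0 hi0⟩
    rw [huniv] at hσ hb
    refine ⟨σ, hσ, fun v => ?_⟩
    -- Here the truncated bound would allow modality `2`; the condition on the orientations takes
    -- over.
    by_cases hv0 : m v = 0
    · rw [(hmono v hv0).modality_eq_zero hσ.vertex_apply]
      exact Nat.zero_le _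
    · have h1 := hb v trivial
      have h2 := hs v
      have h3 : ∑ i ∈ I with i < I.sup id + 1 ∧ v ∈ B i, (modality (τ i) v - 2) =
          ∑ i ∈ I with v ∈ B i, (modality (τ i) v - 2) := by
        congr 1
        ext i
        simp only [Finset.mem_filter]
        exact ⟨fun h => ⟨h.1, h.2.2⟩, fun h => ⟨h.1, hlt i h.1, h.2⟩⟩
      obtain ⟨a, ha⟩ := hm v
      omega

end BlockSequence

end Sequences
end KModal

namespace KModal

/-! ### Blocks from a depth-first search tree. -/

section DepthFirst

/-- `a` is an ancestor of `b` (or equal to `b`) with respect to the parent function `P`. -/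
def Anc (P : ℕ → ℕ) (a b : ℕ) : Prop := ∃ k, P^[k] b = a

theorem Anc.refl (P : ℕ → ℕ) (a : ℕ) : Anc P a a := ⟨0, rfl⟩

theorem Anc.of_parent {P : ℕ → ℕ} {a b : ℕ} (h : Anc P a (P b)) : Anc P a b := by
  obtain ⟨k, hk⟩ := h
  exact ⟨k + 1, by rwa [Function.iterate_succ_apply]⟩

theorem Anc.parent {P : ℕ → ℕ} {a b : ℕ} (h : Anc P a b) (hab : a ≠ b) : Anc P a (P b) := by
  obtain ⟨k, hk⟩ := h
  cases k with
  | zero => exact absurd hk.symm hab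
  | succ k => exact ⟨k, by rwa [Function.iterate_succ_apply] at hk⟩

theorem Anc.trans {P : ℕ → ℕ} {a b c : ℕ} (h : Anc P a b) (h' : Anc P b c) : Anc P a c := by
  obtain ⟨k, rfl⟩ := h
  obtain ⟨l, rfl⟩ := h'
  exact ⟨k + l, by rw [Function.iterate_add_apply]⟩

/-- Every vertex but the root has a smaller parent. -/
structure IsParent (n : ℕ) (P : ℕ → ℕ) : Prop where
  zero : P 0 = 0
  lt : ∀ i, 0 < i → i < n → P i < i

namespace IsParent

variable {n : ℕ} {P : ℕ → ℕ}

theorem le (hP : IsParent n P) {i : ℕ} (hi : i < n) : P i ≤ i := by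
  rcases Nat.eq_zero_or_pos i with rfl | h
  · exact hP.zero.le
  · exact (hP.lt i h hi).le

theorem anc_le (hP : IsParent n P) {a b : ℕ} (hb : b < n) (h : Anc P a b) : a ≤ b := by
  obtain ⟨k, rfl⟩ := h
  induction k generalizing b with
  | zero => exact le_rfl
  | succ k ih =>
    rw [Function.iterate_succ_apply]
    exact (ih ((hP.le hb).trans_lt hb)).trans (hP.le hb)

theorem anc_of_le (hP : IsParent n P) {a b c : ℕ} (hc : c < n) (ha : Anc P a c) (hb : Anc P b c) (hab : a ≤ b) :
    Anc P a b := by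
  obtain ⟨k, rfl⟩ := ha
  obtain ⟨l, rfl⟩ := hb
  rcases le_total l k with h | h
  · exact ⟨k - l, by rw [← Function.iterate_add_apply, Nat.sub_add_cancel h]⟩
  · have hle : P^[l] c ≤ P^[k] c := hP.anc_le ((hP.anc_le hc ⟨k, rfl⟩).trans_lt hc)
      ⟨l - k, by rw [← Function.iterate_add_apply, Nat.sub_add_cancel h]⟩
    rw [le_antisymm hab hle]
    exact Anc.refl P _

end IsParent

variable {V : Type}

/-- A numbering `f 0, …, f (n - 1)` of the vertices with a parent function `P` such that adjacent
vertices are related in the tree, as produced by a depth-first search. -/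
structure DfsOrder (G : Digraph V) (n : ℕ) (f : ℕ → V) (P : ℕ → ℕ) : Prop where
  isParent : IsParent n P
  inj : ∀ i < n, ∀ j < n, f i = f j → i = j
  surj : ∀ v, ∃ i < n, f i = v
  joined : ∀ i, 0 < i → i < n → Joined G (f (P i)) (f i)
  anc : ∀ i j, i < j → j < n → Joined G (f i) (f j) → Anc P i j

/-- `i` is the topmost vertex of a block apart from its head `P i`. -/
def IsTop (G : Digraph V) (n : ℕ) (f : ℕ → V) (P : ℕ → ℕ) (i : ℕ) : Prop :=
  0 < i ∧ i < n ∧ ∀ x < n, Anc P i x → ∀ y < n, Joined G (f y) (f x) → P i ≤ y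

/-- `rep` maps every vertex but the root to the top of the block that contains the edge to its
parent. -/
structure IsRep (G : Digraph V) (n : ℕ) (f : ℕ → V) (P rep : ℕ → ℕ) : Prop where
  zero : rep 0 = 0
  top : ∀ i, IsTop G n f P i → rep i = i
  parent : ∀ i, 0 < i → i < n → ¬ IsTop G n f P i → rep i = rep (P i)

open Classical in
/-- The vertex set of the block with top `b`. -/
noncomputable def blockOf [Fintype V] (n : ℕ) (f : ℕ → V) (P rep : ℕ → ℕ) (b : ℕ) : Finset V :=
  Finset.univ.filter fun v => ∃ i < n, f i = v ∧ (i = P b ∨ rep i = b)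

open Classical in
/-- The tops of the blocks. -/
noncomputable def tops (G : Digraph V) (n : ℕ) (f : ℕ → V) (P : ℕ → ℕ) : Finset ℕ :=
  (Finset.range n).filter (IsTop G n f P)

theorem mem_tops {G : Digraph V} {n : ℕ} {f : ℕ → V} {P : ℕ → ℕ} {i : ℕ} :
    i ∈ tops G n f P ↔ IsTop G n f P i := by
  simp only [tops, Finset.mem_filter, Finset.mem_range, and_iff_right_iff_imp]
  exact fun h => h.2.1

theorem connOn_of_reach {G : Digraph V} {S : Set V} {r : V}
    (h : ∀ z ∈ S, Relation.ReflTransGen (fun x y => x ∈ S ∧ y ∈ S ∧ Joined G x y) z r) :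
    ConnOn G S := by
  rintro X ⟨x, hx, hxX⟩ ⟨y, hy, hyX⟩
  by_contra hcon
  have key : ∀ z, Relation.ReflTransGen (fun x y => x ∈ S ∧ y ∈ S ∧ Joined G x y) z r →
      (z ∈ X ↔ r ∈ X) := by
    intro z hz
    induction hz using Relation.ReflTransGen.head_induction_on with
    | refl => rfl
    | head hab _ ih =>
      rw [← ih]
      constructor
      · intro ha
        by_contra hb
        exact hcon ⟨_, hab.1, ha, _, hab.2.1, hb, hab.2.2⟩
      · intro hb
        by_contra ha
        exact hcon ⟨_, hab.2.1, hb, _, hab.1, ha, hab.2.2.symm⟩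
  exact hyX ((key y (h y hy)).2 ((key x (h x hx)).1 hxX))

namespace DfsOrder

variable {G : Digraph V} {n : ℕ} {f : ℕ → V} {P rep : ℕ → ℕ}

theorem isTop_of_parent_eq_zero {i : ℕ} (h0 : 0 < i) (hi : i < n) (h : P i = 0) :
    IsTop G n f P i := ⟨h0, hi, fun _ _ _ _ _ _ => h ▸ Nat.zero_le _⟩

theorem isTop_rep (D : DfsOrder G n f P) (R : IsRep G n f P rep) {i : ℕ} (h0 : 0 < i) (hi : i < n) :
    IsTop G n f P (rep i) ∧ rep i ≤ i ∧ Anc P (rep i) i := by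
  induction i using Nat.strong_induction_on with
  | _ i ih =>
    by_cases ht : IsTop G n f P i
    · rw [R.top i ht]
      exact ⟨ht, le_rfl, Anc.refl P i⟩
    · have hlt := D.isParent.lt i h0 hi
      have hP0 : 0 < P i := Nat.pos_of_ne_zero fun h => ht (isTop_of_parent_eq_zero h0 hi h)
      obtain ⟨h1, h2, h3⟩ := ih (P i) hlt hP0 (hlt.trans hi)
      rw [R.parent i h0 hi ht]
      exact ⟨h1, by omega, h3.of_parent⟩

/-- On the way up from `j` to `i` one either stays below the top of the block of `j`, and all
vertices passed have the same top, or one passes through that top and its parent. -/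
theorem rep_eq_or_anc (D : DfsOrder G n f P) (R : IsRep G n f P rep) {i j : ℕ} (hj : j < n) (h : Anc P i j) (hij : i < j) :
    rep i = rep j ∨ Anc P i (P (rep j)) := by
  induction j using Nat.strong_induction_on with
  | _ j ih =>
    have h0 : 0 < j := by omega
    by_cases ht : IsTop G n f P j
    · rw [R.top j ht]
      exact Or.inr (h.parent hij.ne)
    · have hlt := D.isParent.lt j h0 hj
      rw [R.parent j h0 hj ht]
      have hp := h.parent hij.ne
      rcases (D.isParent.anc_le (hlt.trans hj) hp).eq_or_lt with h' | h'
      · exact Or.inl (by rw [h'])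
      · exact ih _ hlt (hlt.trans hj) hp h'

/-- No edge from the subtree of the top `rep j` reaches above its parent, so an end `i` at or above
the head must be the head. -/
theorem mem_block_of_joined (D : DfsOrder G n f P)
    (R : IsRep G n f P rep) {i j : ℕ} (hj : j < n) (hij : i < j) (h : Joined G (f i) (f j)) :
    i = P (rep j) ∨ rep i = rep j := by
  rcases D.rep_eq_or_anc R hj (D.anc i j hij hj h) hij with h' | h'
  · exact Or.inr h'
  · left
    obtain ⟨ht, hle, ha⟩ := D.isTop_rep R (by omega : 0 < j) hj
    have h1 := ht.2.2 j hj ha i (hij.trans hj) h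
    have h2 := D.isParent.anc_le ((D.isParent.le (hle.trans_lt hj)).trans_lt (hle.trans_lt hj)) h'
    omega

theorem mem_blockOf [Fintype V] (D : DfsOrder G n f P) {b i : ℕ} (hi : i < n) :
    f i ∈ blockOf n f P rep b ↔ i = P b ∨ rep i = b := by
  simp only [blockOf, Finset.mem_filter, Finset.mem_univ, true_and]
  constructor
  · rintro ⟨j, hj, hji, h⟩
    rwa [D.inj j hj i hi hji] at h
  · intro h
    exact ⟨i, hi, rfl, h⟩

theorem parent_of_rep (R : IsRep G n f P rep) {b i : ℕ} (h0 : 0 < i) (hi : i < n) (h : rep i = b) (hib : i ≠ b) :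
    ¬ IsTop G n f P i ∧ rep (P i) = b ∧ 0 < P i := by
  have ht : ¬ IsTop G n f P i := fun ht => hib ((R.top i ht).symm.trans h)
  have h1 := R.parent i h0 hi ht
  exact ⟨ht, h1 ▸ h, Nat.pos_of_ne_zero fun h' => ht (isTop_of_parent_eq_zero h0 hi h')⟩

/-- Without its head the block is connected by tree edges below `b`. If another vertex `w` is
deleted, every remaining vertex still gets to the head: it climbs the tree, and a child of `w`
bypasses `w` by an edge from its subtree, which exists since the child is not a top. -/
theorem biconnected_blockOf [Fintype V] (D : DfsOrder G n f P)
    (R : IsRep G n f P rep) {b : ℕ} (hb : IsTop G n f P b) :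
    Biconnected (induce G (blockOf n f P rep b)) := by
  have hPb := D.isParent.lt b hb.1 hb.2.1
  have hPn : P b < n := hPb.trans hb.2.1
  have hmem := fun {i} (hi : i < n) => D.mem_blockOf (rep := rep) (b := b) hi
  have hbB := (hmem hb.2.1).2 (Or.inr (R.top b hb))
  have hPB := (hmem hPn).2 (Or.inl rfl)
  have hpos : ∀ i < n, rep i = b → 0 < i := fun i _ h => by
    rcases Nat.eq_zero_or_pos i with rfl | h'
    · rw [R.zero] at h
      exact absurd hb.1 (by omega)
    · exact h'
  have hge : ∀ i < n, rep i = b → b ≤ i := fun i hi h =>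
    h ▸ (D.isTop_rep R (hpos i hi h) hi).2.1
  -- vertices reach their ancestors within the block
  have down : ∀ (w z x : ℕ), w < n → w < z → x < n → rep z = b → rep x = b → Anc P z x →
      Relation.ReflTransGen (fun x y => x ∈ (blockOf n f P rep b : Set V) \ {f w} ∧
        y ∈ (blockOf n f P rep b : Set V) \ {f w} ∧ Joined G x y) (f z) (f x) := by
    intro w z x hw hwz hx hz hrx hzx
    induction x using Nat.strong_induction_on with
    | _ x ih =>
      rcases eq_or_ne z x with rfl | hne
      · exact .refl
      · have hzlt := lt_of_le_of_ne (D.isParent.anc_le hx hzx) hne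
        have hx0 : 0 < x := by omega
        have hxb : x ≠ b := by have := hge z (by omega) hz; omega
        obtain ⟨-, h2, -⟩ := parent_of_rep R hx0 hx hrx hxb
        have hlt := D.isParent.lt x hx0 hx
        have hzP := hzx.parent hne
        have hzle := D.isParent.anc_le (hlt.trans hx) hzP
        refine (ih (P x) hlt (hlt.trans hx) h2 hzP).tail ⟨⟨?_, ?_⟩, ⟨?_, ?_⟩, D.joined x hx0 hx⟩
        · exact (hmem (hlt.trans hx)).2 (Or.inr h2)
        · intro h; have := D.inj _ (hlt.trans hx) _ hw h; omega
        · exact (hmem hx).2 (Or.inr hrx)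
        · intro h; have := D.inj _ hx _ hw h; omega
  have symm : ∀ (S : Set V) {x y : V},
      Relation.ReflTransGen (fun x y => x ∈ S ∧ y ∈ S ∧ Joined G x y) x y →
      Relation.ReflTransGen (fun x y => x ∈ S ∧ y ∈ S ∧ Joined G x y) y x := by
    intro S x y h
    induction h with
    | refl => exact .refl
    | tail _ h ih => exact .head ⟨h.2.1, h.1, h.2.2.symm⟩ ih
  -- without the head
  have conn0 : ConnOn G ((blockOf n f P rep b : Set V) \ {f (P b)}) := by
    refine connOn_of_reach (r := f b) ?_
    rintro v ⟨hv, hvP⟩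
    obtain ⟨i, hi, rfl⟩ := D.surj v
    have hri := ((hmem hi).1 hv).resolve_left fun h => hvP (h ▸ rfl)
    refine symm _ (down (P b) b i hPn hPb hi (R.top b hb) hri ?_)
    rw [← hri]
    exact (D.isTop_rep R (hpos i hi hri) hi).2.2
  -- without another vertex
  have conn1 : ∀ w < n, rep w = b → ConnOn G ((blockOf n f P rep b : Set V) \ {f w}) := by
    intro w hw hwb
    have hbw := hge w hw hwb
    have hPS : f (P b) ∈ (blockOf n f P rep b : Set V) \ {f w} :=
      ⟨hPB, fun h => by have := D.inj _ hPn _ hw h; omega⟩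
    have main : ∀ z < n, rep z = b → z ≠ w →
        Relation.ReflTransGen (fun x y => x ∈ (blockOf n f P rep b : Set V) \ {f w} ∧
          y ∈ (blockOf n f P rep b : Set V) \ {f w} ∧ Joined G x y) (f z) (f (P b)) := by
      intro z
      induction z using Nat.strong_induction_on with
      | _ z ih =>
        intro hz hrz hzw
        have hz0 := hpos z hz hrz
        have hlt := D.isParent.lt z hz0 hz
        have hzS : f z ∈ (blockOf n f P rep b : Set V) \ {f w} :=
          ⟨(hmem hz).2 (Or.inr hrz), fun h => hzw (D.inj _ hz _ hw h)⟩
        by_cases hzb : z = b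
        · subst hzb
          exact .single ⟨hzS, hPS, (D.joined z hz0 hz).symm⟩
        · obtain ⟨hnt, hrP, -⟩ := parent_of_rep R hz0 hz hrz hzb
          by_cases hPw : P z = w
          · have hex : ∃ x < n, Anc P z x ∧ ∃ y < n, Joined G (f y) (f x) ∧ y < P z := by
              by_contra hcon
              refine hnt ⟨hz0, hz, fun x hx hzx y hy hyx => ?_⟩
              by_contra hlt'
              exact hcon ⟨x, hx, hzx, y, hy, hyx, by omega⟩
            obtain ⟨x, hx, hzx, y, hy, hyx, hyP⟩ := hex
            have hzx' := D.isParent.anc_le hx hzx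
            -- Otherwise the head of the block of `x` is `z` or below it, while the edge from `x` to
            -- `y` forces this head to have a number at most `y < P z`.
            have hrx : rep x = b := by
              rcases hzx'.eq_or_lt with rfl | hlt'
              · exact hrz
              · rcases D.rep_eq_or_anc R hx hzx hlt' with h' | h'
                · exact h'.symm.trans hrz
                · exfalso
                  obtain ⟨ht, hle, ha⟩ := D.isTop_rep R (by omega : 0 < x) hx
                  have h1 := ht.2.2 x hx ha y hy hyx
                  have h2 := D.isParent.anc_le
                    ((D.isParent.le (hle.trans_lt hx)).trans_lt (hle.trans_lt hx)) h'
                  omega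
            have hyB := D.mem_block_of_joined R hx (by omega) hyx
            rw [hrx] at hyB
            have hyS : f y ∈ (blockOf n f P rep b : Set V) \ {f w} :=
              ⟨(hmem hy).2 hyB, fun h => by have := D.inj _ hy _ hw h; omega⟩
            have hxS : f x ∈ (blockOf n f P rep b : Set V) \ {f w} :=
              ⟨(hmem hx).2 (Or.inr hrx), fun h => by have := D.inj _ hx _ hw h; omega⟩
            refine ((down w z x hw (by omega) hx hrz hrx hzx).tail ⟨hxS, hyS, hyx.symm⟩).trans ?_
            rcases hyB with rfl | hry
            · exact .refl
            · exact ih y (by omega) hy hry (by omega)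
          · exact Relation.ReflTransGen.head ⟨hzS, ⟨(hmem (hlt.trans hz)).2 (Or.inr hrP),
              fun h => hPw (D.inj _ (hlt.trans hz) _ hw h)⟩, (D.joined z hz0 hz).symm⟩
              (ih (P z) hlt (hlt.trans hz) hrP hPw)
    refine connOn_of_reach (r := f (P b)) ?_
    rintro v ⟨hv, hvw⟩
    obtain ⟨i, hi, rfl⟩ := D.surj v
    rcases (hmem hi).1 hv with rfl | hri
    · exact .refl
    · exact main i hi hri fun h => hvw (h ▸ rfl)
  have hne : f (P b) ≠ f b := fun h => by have := D.inj _ hPn _ hb.2.1 h; omega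
  rw [biconnected_induce_iff]
  refine ⟨⟨f (P b), hPB, f b, hbB, hne⟩, ?_, ?_⟩
  · have : (blockOf n f P rep b : Set V) =
        (blockOf n f P rep b : Set V) \ {f (P b)} ∪ {f (P b), f b} := by
      ext v
      simp only [Set.mem_union, Set.mem_sdiff, Set.mem_insert_iff, Set.mem_singleton_iff,
        Finset.mem_coe]
      constructor
      · intro hv
        by_cases h : v = f (P b)
        · exact Or.inr (Or.inl h)
        · exact Or.inl ⟨hv, h⟩
      · rintro (h | rfl | rfl)
        · exact h.1
        · exact hPB
        · exact hbB
    rw [this]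
    refine BlockSequence.connOn_union conn0 ?_ (c := f b) ⟨hbB, hne.symm⟩ (by simp)
    refine connOn_of_reach (r := f (P b)) ?_
    rintro v (rfl | rfl)
    · exact .refl
    · exact .single ⟨by simp, by simp, (D.joined b hb.1 hb.2.1).symm⟩
  · intro v hv
    obtain ⟨i, hi, rfl⟩ := D.surj v
    rcases (hmem hi).1 hv with rfl | hri
    · exact conn0
    · exact conn1 i hi hri

/-- Increasing tops put every block after the one that contains its head. The non-head vertices of
the block with top `i` have `i` as their representative and are numbered at least `i`, so none is
the head of, or represented by, a smaller top. -/
theorem blockSequence [Fintype V] (D : DfsOrder G n f P) (R : IsRep G n f P rep)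
    (hG : Loopless G) :
    BlockSequence G (tops G n f P) (blockOf n f P rep) (fun b => f (P b)) where
  biconnected i hi := D.biconnected_blockOf R (mem_tops.1 hi)
  head_mem i hi := by
    rw [mem_tops] at hi
    exact (D.mem_blockOf ((D.isParent.lt i hi.1 hi.2.1).trans hi.2.1)).2 (Or.inl rfl)
  inter i hi j hj hji v hvi hvj := by
    rw [mem_tops] at hi hj
    obtain ⟨a, ha, rfl⟩ := D.surj v
    rw [D.mem_blockOf ha] at hvi hvj
    rcases hvi with rfl | hvi
    · rfl
    · exfalso
      have ha0 : 0 < a := by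
        rcases Nat.eq_zero_or_pos a with rfl | h'
        · rw [R.zero] at hvi
          exact absurd hi.1 (by omega)
        · exact h'
      have h1 := (D.isTop_rep R ha0 ha).2.1
      have h2 := D.isParent.lt j hj.1 hj.2.1
      omega
  prev i hi := by
    rintro ⟨j, hj, hji⟩
    rw [mem_tops] at hi hj
    have hlt := D.isParent.lt i hi.1 hi.2.1
    rcases Nat.eq_zero_or_pos (P i) with h0 | h0
    -- Vertex `1` is always a child of the root, so top `1` is the smallest one and its block
    -- contains the root.
    · have h1n : 1 < n := by have := hj.1; have := hi.2.1; omega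
      have hP1 : P 1 = 0 := by have := D.isParent.lt 1 one_pos h1n; omega
      refine ⟨1, mem_tops.2 (isTop_of_parent_eq_zero one_pos h1n hP1), by have := hj.1; omega, ?_⟩
      rw [h0, D.mem_blockOf (by omega)]
      exact Or.inl hP1.symm
    · obtain ⟨h1, h2, -⟩ := D.isTop_rep R h0 (hlt.trans hi.2.1)
      exact ⟨rep (P i), mem_tops.2 h1, by omega, (D.mem_blockOf (hlt.trans hi.2.1)).2 (Or.inr rfl)⟩
  edge u v huv := by
    obtain ⟨i, hi, rfl⟩ := D.surj u
    obtain ⟨j, hj, rfl⟩ := D.surj v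
    have key : ∀ i j, i < j → j < n → Joined G (f i) (f j) → ∃ b ∈ tops G n f P,
        f i ∈ blockOf n f P rep b ∧ f j ∈ blockOf n f P rep b := fun i j hij hj h =>
      ⟨rep j, mem_tops.2 (D.isTop_rep R (by omega) hj).1,
        (D.mem_blockOf (hij.trans hj)).2 (D.mem_block_of_joined R hj hij h),
        (D.mem_blockOf hj).2 (Or.inr rfl)⟩
    rcases lt_trichotomy i j with h | rfl | h
    · exact key i j h hj huv
    · exact absurd huv (by rintro (h | h) <;> exact hG _ h)
    · obtain ⟨b, hb, h1, h2⟩ := key j i h hi huv.symm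
      exact ⟨b, hb, h2, h1⟩

/-- The subtree of `b` is attached to the rest only through `P b`. Since `b ≠ 1`, one of the
vertices `0` and `1` is different from `P b` and lies outside this subtree. For `b = 1` there may be
nothing outside. -/
theorem isCutVertex_head (D : DfsOrder G n f P) {b : ℕ} (hb : IsTop G n f P b) (h1 : b ≠ 1) :
    IsCutVertex G (f (P b)) := by
  rw [isCutVertex_iff]
  intro hc
  have hlt := D.isParent.lt b hb.1 hb.2.1
  have hPn := hlt.trans hb.2.1
  have hout : ∃ o < n, o ≠ P b ∧ o < b := by
    have := hb.1
    have := hb.2.1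
    by_cases h0 : P b = 0
    · exact ⟨1, by omega, by omega, by omega⟩
    · exact ⟨0, by omega, by omega, by omega⟩
  obtain ⟨o, ho, hoP, hob⟩ := hout
  obtain ⟨u, huP, ⟨x, hx, hbx, rfl⟩, v, hvP, hv, hxy⟩ := hc {v | ∃ x < n, Anc P b x ∧ f x = v}
    ⟨f b, fun h => by have := D.inj _ hb.2.1 _ hPn h; omega, b, hb.2.1, Anc.refl P b, rfl⟩
    ⟨f o, fun h => hoP (D.inj _ ho _ hPn h), fun ⟨x, hx, hbx, h⟩ => by
      have := D.inj _ hx _ ho h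
      have := D.isParent.anc_le hx hbx
      omega⟩
  obtain ⟨y, hy, rfl⟩ := D.surj v
  have hbx' := D.isParent.anc_le hx hbx
  rcases lt_trichotomy x y with h | rfl | h
  · exact hv ⟨y, hy, hbx.trans (D.anc x y h hy hxy), rfl⟩
  · exact hv ⟨x, hx, hbx, rfl⟩
  · have hyx := D.anc y x h hx hxy.symm
    have hPy := hb.2.2 x hx hbx y hy hxy.symm
    rcases le_or_gt b y with h' | h'
    · exact hv ⟨y, hy, D.isParent.anc_of_le hx hbx hyx h', rfl⟩
    · have := D.isParent.anc_le hPn ((D.isParent.anc_of_le hx hyx hbx h'.le).parent h'.ne)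
      have e : y = P b := by omega
      exact hvP (e ▸ rfl)

end DfsOrder

end DepthFirst
end KModal

namespace KModal

/-! ### Total correctness of programs with step counts. -/

section Calculus

/-- With the subroutine `T`, the program `p` halts when started in `s`, and the final state and the
number of steps satisfy `Q`. -/
def WP (T : Subroutine) (p : Prog) (s : State) (Q : State → ℕ → Prop) : Prop :=
  ∃ s' t, Exec T p s s' t ∧ Q s' t

infixr:60 " ;; " => Prog.seq

variable {T : Subroutine} {p q : Prog} {s : State} {Q : State → ℕ → Prop}

theorem WP.mono {Q' : State → ℕ → Prop} (h : WP T p s Q) (hQ : ∀ s' t, Q s' t → Q' s' t) :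
    WP T p s Q' := by
  obtain ⟨s', t, h1, h2⟩ := h
  exact ⟨s', t, h1, hQ _ _ h2⟩

theorem wp_skip : WP T .skip s Q ↔ Q s 1 := by
  constructor
  · rintro ⟨s', t, h, hQ⟩
    cases h
    exact hQ
  · exact fun h => ⟨_, _, .skip s, h⟩

theorem wp_assign {x : ℕ} {e : Expr} :
    WP T (.assign x e) s Q ↔ Q (s.setReg x (e.eval s)) (e.cost + 1) := by
  constructor
  · rintro ⟨s', t, h, hQ⟩
    cases h
    exact hQ
  · exact fun h => ⟨_, _, .assign x e s, h⟩

theorem wp_write {a : ℕ} {i e : Expr} : WP T (.write a i e) s Q ↔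
    Q (s.setArr a (i.eval s) (e.eval s)) (i.cost + e.cost + 1) := by
  constructor
  · rintro ⟨s', t, h, hQ⟩
    cases h
    exact hQ
  · exact fun h => ⟨_, _, .write a i e s, h⟩

theorem wp_seq : WP T (p ;; q) s Q ↔
    WP T p s fun s' t => WP T q s' fun s'' t' => Q s'' (t + t') := by
  constructor
  · rintro ⟨s', t, h, hQ⟩
    cases h with
    | seq h1 h2 => exact ⟨_, _, h1, _, _, h2, hQ⟩
  · rintro ⟨s', t, h1, s'', t', h2, hQ⟩
    exact ⟨_, _, .seq h1 h2, hQ⟩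

theorem wp_cond {c : Expr} : WP T (.cond c p q) s Q ↔
    (c.eval s ≠ 0 → WP T p s fun s' t => Q s' (c.cost + 1 + t)) ∧
    (c.eval s = 0 → WP T q s fun s' t => Q s' (c.cost + 1 + t)) := by
  constructor
  · rintro ⟨s', t, h, hQ⟩
    cases h with
    | cond_true hc h => exact ⟨fun _ => ⟨_, _, h, hQ⟩, fun h' => absurd h' hc⟩
    | cond_false hc h => exact ⟨fun h' => absurd hc h', fun _ => ⟨_, _, h, hQ⟩⟩
  · rintro ⟨h1, h2⟩
    by_cases hc : c.eval s = 0
    · obtain ⟨s', t, h, hQ⟩ := h2 hc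
      exact ⟨_, _, .cond_false hc h, hQ⟩
    · obtain ⟨s', t, h, hQ⟩ := h1 hc
      exact ⟨_, _, .cond_true hc h, hQ⟩

theorem wp_call {x a : ℕ} {o : Expr} : WP T (.call x a o) s Q ↔
    Q (s.setReg x (if T.answer (s.stored a (o.eval s)) then 1 else 0))
      (o.cost + 1 + T.time (s.stored a (o.eval s))) := by
  constructor
  · rintro ⟨s', t, h, hQ⟩
    cases h
    exact hQ
  · exact fun h => ⟨_, _, .call x a o s, h⟩

theorem setReg_reg (s : State) (x v y : ℕ) :
    (s.setReg x v).reg y = if y = x then v else s.reg y := by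
  simp [State.setReg, Function.update_apply]

theorem setReg_arr (s : State) (x v : ℕ) : (s.setReg x v).arr = s.arr := rfl

theorem setArr_reg (s : State) (a i v : ℕ) : (s.setArr a i v).reg = s.reg := rfl

theorem setArr_arr (s : State) (a i v b : ℕ) :
    (s.setArr a i v).arr b = if b = a then Function.update (s.arr a) i v else s.arr b := by
  by_cases h : b = a
  · subst h
    simp [State.setArr]
  · simp [State.setArr, h]

/-- The registers that a program may change. -/
def Prog.regs : Prog → List ℕ
  | .skip => []
  | .assign x _ => [x]
  | .write _ _ _ => []
  | .seq p q => p.regs ++ q.regs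
  | .cond _ p q => p.regs ++ q.regs
  | .loop _ p => p.regs
  | .call x _ _ => [x]

/-- The arrays that a program may change. -/
def Prog.arrs : Prog → List ℕ
  | .skip => []
  | .assign _ _ => []
  | .write a _ _ => [a]
  | .seq p q => p.arrs ++ q.arrs
  | .cond _ p q => p.arrs ++ q.arrs
  | .loop _ p => p.arrs
  | .call _ _ _ => []

/-- `s'` differs from `s` only in the registers and arrays that `p` may change. -/
def Frame (p : Prog) (s s' : State) : Prop :=
  (∀ a, a ∉ p.arrs → s'.arr a = s.arr a) ∧ ∀ x, x ∉ p.regs → s'.reg x = s.reg x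

/-- The written registers and arrays can be read off the program text; hence `decide` shows that
later phases preserve the data of earlier ones. -/
theorem Exec.frame {s' : State} {t : ℕ} (h : Exec T p s s' t) : Frame p s s' := by
  induction h with
  | skip s => exact ⟨fun _ _ => rfl, fun _ _ => rfl⟩
  | assign x e s =>
    refine ⟨fun _ _ => rfl, fun y hy => ?_⟩
    rw [setReg_reg, if_neg (by simpa [Prog.regs] using hy)]
  | write a i e s =>
    refine ⟨fun b hb => ?_, fun _ _ => rfl⟩
    rw [setArr_arr, if_neg (by simpa [Prog.arrs] using hb)]
  | seq _ _ ih1 ih2 =>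
    simp only [Frame, Prog.arrs, Prog.regs, List.mem_append, not_or] at *
    exact ⟨fun a ha => (ih2.1 a ha.2).trans (ih1.1 a ha.1),
      fun x hx => (ih2.2 x hx.2).trans (ih1.2 x hx.1)⟩
  | cond_true _ _ ih =>
    simp only [Frame, Prog.arrs, Prog.regs, List.mem_append, not_or] at *
    exact ⟨fun a ha => ih.1 a ha.1, fun x hx => ih.2 x hx.1⟩
  | cond_false _ _ ih =>
    simp only [Frame, Prog.arrs, Prog.regs, List.mem_append, not_or] at *
    exact ⟨fun a ha => ih.1 a ha.2, fun x hx => ih.2 x hx.2⟩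
  | loop_true _ _ _ ih1 ih2 =>
    exact ⟨fun a ha => (ih2.1 a ha).trans (ih1.1 a ha), fun x hx => (ih2.2 x hx).trans (ih1.2 x hx)⟩
  | loop_false _ => exact ⟨fun _ _ => rfl, fun _ _ => rfl⟩
  | call x a o s =>
    refine ⟨fun _ _ => rfl, fun y hy => ?_⟩
    rw [setReg_reg, if_neg (by simpa [Prog.regs] using hy)]

theorem WP.frame (h : WP T p s Q) : WP T p s fun s' t => Q s' t ∧ Frame p s s' := by
  obtain ⟨s', t, h1, h2⟩ := h
  exact ⟨s', t, h1, h2, h1.frame⟩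

/-- A loop whose iterations consume fuel; `I k s t` holds when `k` units of fuel are left and `t`
steps were taken. -/
theorem WP.loop {c : Expr} {I : ℕ → State → ℕ → Prop} {k : ℕ} (h0 : I k s 0)
    (step : ∀ k s t, I k s t → c.eval s ≠ 0 →
      WP T p s fun s' t' => ∃ k' < k, I k' s' (t + (c.cost + 1 + t'))) :
    WP T (.loop c p) s fun s' t => ∃ k' t', t = t' + (c.cost + 1) ∧ I k' s' t' ∧ c.eval s' = 0 := by
  suffices h : ∀ k s t0, I k s t0 → WP T (.loop c p) s fun s' t =>
      ∃ k' t', t0 + t = t' + (c.cost + 1) ∧ I k' s' t' ∧ c.eval s' = 0 by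
    refine (h k s 0 h0).mono fun s' t => ?_
    rw [zero_add]
    exact id
  intro k
  induction k using Nat.strong_induction_on with
  | _ k ih =>
    intro s t0 hI
    by_cases hc : c.eval s = 0
    · exact ⟨_, _, .loop_false hc, k, t0, rfl, hI, hc⟩
    · obtain ⟨s1, t1, h1, k', hk', hI'⟩ := step k s t0 hI hc
      obtain ⟨s2, t2, h2, k2, t3, ht, hI2, hc2⟩ := ih k' hk' s1 _ hI'
      exact ⟨s2, _, .loop_true hc h1 h2, k2, t3, by omega, hI2, hc2⟩

/-- A loop whose iterations take at most `K` steps each. -/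
theorem WP.loop_const {c : Expr} {I : ℕ → State → Prop} {k : ℕ} (K : ℕ) (h0 : I k s)
    (step : ∀ k s, I k s → c.eval s ≠ 0 →
      WP T p s fun s' t' => c.cost + 1 + t' ≤ K ∧ ∃ k' < k, I k' s') :
    WP T (.loop c p) s fun s' t => t ≤ K * k + (c.cost + 1) ∧ (∃ k', I k' s') ∧ c.eval s' = 0 := by
  refine (WP.loop (I := fun j s t => I j s ∧ t + K * j ≤ K * k) (k := k) ⟨h0, by simp⟩ ?_).mono ?_
  · rintro j s t ⟨hI, ht⟩ hc
    refine (step j s hI hc).mono ?_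
    rintro s' t' ⟨ht', k', hk', hI'⟩
    refine ⟨k', hk', hI', ?_⟩
    have : K * k' + K ≤ K * j := by
      rw [← Nat.mul_succ]
      exact Nat.mul_le_mul_left K hk'
    omega
  · rintro s' t ⟨k', t', rfl, ⟨hI, ht⟩, hc⟩
    exact ⟨by omega, ⟨k', hI⟩, hc⟩

/-- The program `for x := 0 to N - 1 do p`, where `N` is a register. -/
def Prog.for (x N : ℕ) (p : Prog) : Prog :=
  .assign x (.const 0) ;;
    .loop (.sub (.reg N) (.reg x)) (p ;; .assign x (.add (.reg x) (.const 1)))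

/-- The overhead is `2` steps for the initial assignment, `8` per iteration (`4` for the guard, `4`
for the increment) and `4` for the last guard. The time is part of the invariant because calls of
the subroutine make iterations unequally expensive. -/
theorem WP.for_time {x N : ℕ} {n : ℕ} {I : ℕ → State → ℕ → Prop} (hN : s.reg N = n)
    (hx' : x ∉ p.regs) (hN' : N ∉ p.regs) (hxN : N ≠ x)
    (h0 : I 0 (s.setReg x 0) 2)
    (step : ∀ i s' t, i < n → s'.reg x = i → Frame (.for x N p) s s' → I i s' t →
      WP T p s' fun s'' t' => I (i + 1) (s''.setReg x (i + 1)) (t + t' + 8)) :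
    WP T (.for x N p) s fun s' t => ∃ t', t = t' + 4 ∧ I n s' t' ∧ s'.reg x = n ∧
      Frame (.for x N p) s s' := by
  have hf : ∀ {s1 s2 : State} {q : Prog}, (∀ a, a ∉ p.arrs → a ∉ q.arrs) →
      (∀ y, y ∉ p.regs → y ≠ x → y ∉ q.regs) → Frame (.for x N p) s s1 → Frame q s1 s2 →
      Frame (.for x N p) s s2 := by
    intro s1 s2 q h1 h2 h3 h4
    simp only [Frame, Prog.for, Prog.arrs, Prog.regs, List.mem_append, List.nil_append,
      List.append_nil, List.mem_singleton, not_or] at h3 h4 ⊢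
    exact ⟨fun a ha => (h4.1 a (h1 a ha)).trans (h3.1 a ha),
      fun y hy => (h4.2 y (h2 y hy.2.1 hy.1)).trans (h3.2 y hy)⟩
  have hN0 : ∀ s1, Frame (.for x N p) s s1 → s1.reg N = n := by
    intro s1 h
    rw [h.2 N (by simp [Prog.for, Prog.regs, hN', hxN]), hN]
  rw [Prog.for, wp_seq, wp_assign]
  refine (WP.loop (I := fun k s' t => ∃ i, k = n - i ∧ i ≤ n ∧ s'.reg x = i ∧
    Frame (.for x N p) s s' ∧ I i s' (t + 2)) (k := n) ?_ ?_).mono ?_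
  · refine ⟨0, rfl, Nat.zero_le n, by simp [setReg_reg, Expr.eval], ?_, h0⟩
    refine ⟨fun _ _ => rfl, fun y hy => ?_⟩
    rw [setReg_reg, if_neg]
    rintro rfl
    exact hy (by simp [Prog.for, Prog.regs])
  · rintro k s1 t ⟨i, rfl, hin, hxi, hF, hI⟩ hc
    have hN1 := hN0 s1 hF
    simp only [Expr.eval, hN1, hxi] at hc
    rw [wp_seq]
    refine (step i s1 (t + 2) (by omega) hxi hF hI).frame.mono ?_
    rintro s2 t2 ⟨hI2, hF2⟩
    have hx2 : s2.reg x = i := by rw [hF2.2 x hx', hxi]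
    rw [wp_assign]
    simp only [Expr.eval, hx2]
    refine ⟨n - (i + 1), by omega, i + 1, rfl, by omega, by simp [setReg_reg], ?_, ?_⟩
    · refine hf (q := p ;; .assign x (.const 0)) ?_ ?_ hF (s2 := s2.setReg x (i + 1)) ?_
      · intro a ha
        simpa [Prog.arrs] using ha
      · intro y hy hyx
        simp [Prog.regs, hy, hyx]
      · refine ⟨fun a ha => hF2.1 a ?_, fun y hy => ?_⟩
        · intro h; exact ha (by simp [Prog.arrs, h])
        · simp only [Prog.regs, List.mem_append, List.mem_singleton, not_or] at hy
          rw [setReg_reg, if_neg hy.2, hF2.2 y hy.1]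
    · simp only [Expr.cost]
      have e : t + 2 + t2 + 8 = t + (1 + 1 + 1 + 1 + (t2 + (1 + 1 + 1 + 1))) + 2 := by omega
      rw [← e]
      exact hI2
  · rintro s1 t ⟨k, t', rfl, ⟨i, hk, hin, hxi, hF, hI⟩, hc⟩
    have hN1 := hN0 s1 hF
    simp only [Expr.eval, hN1, hxi] at hc
    obtain rfl : i = n := by omega
    refine ⟨t' + 2, ?_, hI, hxi, hF⟩
    simp only [Expr.cost]
    omega

theorem WP.for {x N : ℕ} {n : ℕ} (K : ℕ) {I : ℕ → State → Prop} (hN : s.reg N = n)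
    (hx' : x ∉ p.regs) (hN' : N ∉ p.regs) (hxN : N ≠ x)
    (h0 : I 0 (s.setReg x 0))
    (step : ∀ i s', i < n → s'.reg x = i → Frame (.for x N p) s s' → I i s' →
      WP T p s' fun s'' t' => t' ≤ K ∧ I (i + 1) (s''.setReg x (i + 1))) :
    WP T (.for x N p) s fun s' t => t ≤ (K + 8) * n + 6 ∧ I n s' ∧ Frame (.for x N p) s s' := by
  refine (WP.for_time (I := fun i s t => I i s ∧ t ≤ (K + 8) * i + 2) hN hx' hN' hxN
    ⟨h0, by simp⟩ ?_).mono ?_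
  · rintro i s' t hi hxi hF ⟨hI, ht⟩
    refine (step i s' hi hxi hF hI).mono ?_
    rintro s'' t' ⟨ht', hI'⟩
    refine ⟨hI', ?_⟩
    rw [Nat.mul_succ]
    omega
  · rintro s' t ⟨t', rfl, ⟨hI, ht⟩, -, hF⟩
    exact ⟨by omega, hI, hF⟩

end Calculus
end KModal

namespace KModal

attribute [simp] wp_skip wp_assign wp_write wp_seq wp_cond wp_call setReg_reg setReg_arr setArr_reg
  setArr_arr Expr.eval Expr.cost

prefix:max "𝔯" => Expr.reg
prefix:max "𝔠" => Expr.const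
infixl:65 " ⊹ " => Expr.add
infixl:65 " ⊖ " => Expr.sub

/-! ### Reading the graph into adjacency lists. -/

section Input

/-- Reads the edges into lists of half-edges with owner `1` and target `2`, and marks the vertices
with outgoing and incoming edges. -/
def readEdges : Prog := .for 4 2
  (.assign 5 (.read 0 (𝔠 2 ⊹ 𝔯 1 ⊹ (𝔯 4 ⊹ 𝔯 4))) ;;
   .assign 6 (.read 0 (𝔠 3 ⊹ 𝔯 1 ⊹ (𝔯 4 ⊹ 𝔯 4))) ;;
   .write 1 (𝔯 4) (𝔯 5) ;;
   .write 2 (𝔯 4) (𝔯 6) ;;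
   .write 1 (𝔯 2 ⊹ 𝔯 4) (𝔯 6) ;;
   .write 2 (𝔯 2 ⊹ 𝔯 4) (𝔯 5) ;;
   .write 20 (𝔯 5) (𝔠 1) ;;
   .write 21 (𝔯 6) (𝔠 1))

/-- Half-edges `j` and `e + j` are the two directions of edge `j`. In the whole program, register
`0` holds the answer, and the arrays hold: `0` the input, `1`, `2` owners and targets, `3`, `4` list
heads and links, `5` search numbers plus one, `6` vertices by number, `7` parents, `8`, `9`
renumbered edge ends and `22` the larger one, `11` low points, `12` tops, `13` to `16` positions and
counts in the blocks, `17`, `18` addresses, `19` the encoded blocks, `20`, `21` the marks. -/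
theorem wp_readEdges {T : Subroutine} {s : State} {n e : ℕ} (hn : s.reg 1 = n) (he : s.reg 2 = e)
    {U W : ℕ → ℕ} (hU : ∀ j < e, s.arr 0 (2 + n + (j + j)) = U j)
    (hW : ∀ j < e, s.arr 0 (3 + n + (j + j)) = W j)
    (h20 : ∀ v, s.arr 20 v = 0) (h21 : ∀ v, s.arr 21 v = 0) :
    WP T readEdges s fun s' t => t ≤ 100 * e + 6 ∧
      ((∀ j < e, s'.arr 1 j = U j ∧ s'.arr 2 j = W j ∧ s'.arr 1 (e + j) = W j ∧
        s'.arr 2 (e + j) = U j) ∧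
      (∀ v, s'.arr 20 v ≠ 0 ↔ ∃ j < e, U j = v) ∧ (∀ v, s'.arr 21 v ≠ 0 ↔ ∃ j < e, W j = v)) ∧
      Frame readEdges s s' := by
  refine (WP.for (n := e) 92 (I := fun i s' =>
    (∀ j < i, s'.arr 1 j = U j ∧ s'.arr 2 j = W j ∧ s'.arr 1 (e + j) = W j ∧
        s'.arr 2 (e + j) = U j) ∧
      (∀ v, s'.arr 20 v ≠ 0 ↔ ∃ j < i, U j = v) ∧ (∀ v, s'.arr 21 v ≠ 0 ↔ ∃ j < i, W j = v))
      he (by decide) (by decide) (by decide) ?_ ?_)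
  · simp [h20, h21]
  · rintro i s1 hi hx hF ⟨h1, h2, h3⟩
    have e0 : s1.arr 0 = s.arr 0 := hF.1 0 (by decide)
    have e1 : s1.reg 1 = n := by rw [hF.2 1 (by decide), hn]
    have e2 : s1.reg 2 = e := by rw [hF.2 2 (by decide), he]
    simp [e0, e1, e2, hx, hU i hi, hW i hi, Function.update_apply]
    refine ⟨?_, ?_, ?_⟩
    · intro j hj
      rcases hj.lt_or_eq with h | rfl
      · have := h1 j h
        have ha : j ≠ e + i := by omega
        have hb : j ≠ i := by omega
        have hc : e + j ≠ i := by omega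
        simp [*]
      · simp
        omega
    · intro v
      have := h2 v
      simp only [le_iff_lt_or_eq, or_and_right, exists_or, exists_eq_left]
      by_cases hv : v = U i
      · simp [hv]
      · simp [hv, this, Ne.symm hv]
    · intro v
      have := h3 v
      simp only [le_iff_lt_or_eq, or_and_right, exists_or, exists_eq_left]
      by_cases hv : v = W i
      · simp [hv]
      · simp [hv, this, Ne.symm hv]

/-- The half-edges with index below `N` form linked lists, one for each owner, with decreasing
indices. The links are shifted by one; `0` is the end of a list. -/
structure HalfEdgeLists (own head next : ℕ → ℕ) (N : ℕ) : Prop where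
  le_head : ∀ h < N, h < head (own h)
  head_le : ∀ u, head u ≤ N
  own_head : ∀ u, head u ≠ 0 → own (head u - 1) = u
  next_le : ∀ h < N, next (h + 1) ≤ h
  own_next : ∀ h < N, next (h + 1) ≠ 0 → own (next (h + 1) - 1) = own h
  le_next : ∀ h < N, ∀ h' < h, own h' = own h → h' < next (h + 1)

theorem HalfEdgeLists.push {own head next : ℕ → ℕ} {N : ℕ} (H : HalfEdgeLists own head next N) :
    HalfEdgeLists own (Function.update head (own N) (N + 1))
      (Function.update next (N + 1) (head (own N))) (N + 1) := by
  obtain ⟨h1, h2, h3, h4, h5, h6⟩ := H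
  refine ⟨?_, ?_, ?_, ?_, ?_, ?_⟩
  · intro h hh
    by_cases hu : own h = own N
    · rw [hu, Function.update_self]
      exact hh
    · rw [Function.update_of_ne hu]
      exact h1 h (lt_of_le_of_ne (Nat.lt_succ_iff.1 hh) fun e => hu (e ▸ rfl))
  · intro u
    by_cases hu : u = own N
    · rw [hu, Function.update_self]
    · rw [Function.update_of_ne hu]
      exact (h2 u).trans (Nat.le_succ N)
  · intro u
    by_cases hu : u = own N
    · rw [hu, Function.update_self]
      simp
    · rw [Function.update_of_ne hu]
      exact h3 u
  all_goals
    intro h hh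
    rcases Nat.lt_succ_iff_lt_or_eq.1 hh with hlt | rfl
  · rw [Function.update_of_ne (by omega)]
    exact h4 h hlt
  · rw [Function.update_self]
    exact h2 _
  · rw [Function.update_of_ne (by omega)]
    exact h5 h hlt
  · rw [Function.update_self]
    exact h3 _
  · rw [Function.update_of_ne (by omega)]
    exact h6 h hlt
  · rw [Function.update_self]
    intro h' hh' e
    rw [← e]
    exact h1 h' hh'

/-- Builds the lists of half-edges. -/
def buildLists : Prog := .for 4 3
  (.assign 5 (.read 1 (𝔯 4)) ;;
   .write 4 (𝔯 4 ⊹ 𝔠 1) (.read 3 (𝔯 5)) ;;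
   .write 3 (𝔯 5) (𝔯 4 ⊹ 𝔠 1))

theorem wp_buildLists {T : Subroutine} {s : State} {N : ℕ} (hN : s.reg 3 = N)
    (h3 : ∀ v, s.arr 3 v = 0) :
    WP T buildLists s fun s' t => t ≤ 50 * N + 6 ∧
      HalfEdgeLists (s.arr 1) (s'.arr 3) (s'.arr 4) N ∧ Frame buildLists s s' := by
  refine (WP.for (n := N) 42 (I := fun i s' => HalfEdgeLists (s.arr 1) (s'.arr 3) (s'.arr 4) i)
      hN (by decide) (by decide) (by decide) ?_ ?_)
  · constructor <;> simp [h3]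
  · rintro i s1 hi hx hF hI
    have e1 : s1.arr 1 = s.arr 1 := hF.1 1 (by decide)
    simp [hx, e1]
    exact hI.push

/-- Rejects if a vertex of modality `0` has both incoming and outgoing edges. -/
def checkMonochromatic : Prog := .for 4 1
  (.cond (.read 0 (𝔠 2 ⊹ 𝔯 4)) .skip
    (.cond (.read 20 (𝔯 4)) (.cond (.read 21 (𝔯 4)) (.assign 0 (𝔠 0)) .skip) .skip))

theorem wp_checkMonochromatic {T : Subroutine} {s : State} {n : ℕ} (hn : s.reg 1 = n) :
    WP T checkMonochromatic s fun s' t => t ≤ 50 * n + 6 ∧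
      (s'.reg 0 = if ∀ i < n, s.arr 0 (2 + i) = 0 → s.arr 20 i ≠ 0 → s.arr 21 i = 0 then s.reg 0
        else 0) ∧ Frame checkMonochromatic s s' := by
  classical
  refine (WP.for (n := n) 42 (I := fun k s' =>
    s'.reg 0 = if ∀ i < k, s.arr 0 (2 + i) = 0 → s.arr 20 i ≠ 0 → s.arr 21 i = 0 then s.reg 0
      else 0) hn (by decide) (by decide) (by decide) ?_ ?_)
  · simp
  · rintro k s1 hi hx hF hI
    have e0 : s1.arr 0 = s.arr 0 := hF.1 0 (by decide)
    have e1 : s1.arr 20 = s.arr 20 := hF.1 20 (by decide)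
    have e2 : s1.arr 21 = s.arr 21 := hF.1 21 (by decide)
    have key : (∀ i < k + 1, s.arr 0 (2 + i) = 0 → s.arr 20 i ≠ 0 → s.arr 21 i = 0) ↔
        (∀ i < k, s.arr 0 (2 + i) = 0 → s.arr 20 i ≠ 0 → s.arr 21 i = 0) ∧
          (s.arr 0 (2 + k) = 0 → s.arr 20 k ≠ 0 → s.arr 21 k = 0) := Nat.forall_lt_succ_right
    simp only [key, wp_cond, wp_skip, wp_assign, Expr.eval, Expr.cost, hx, e0, e1, e2, setReg_reg,
      hI, ne_eq]
    by_cases a1 : s.arr 0 (2 + k) = 0 <;> by_cases a2 : s.arr 20 k = 0 <;>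
      by_cases a3 : s.arr 21 k = 0 <;> simp [a1, a2, a3]

end Input

/-! ### Depth-first search. -/

section Search

/-- The state of the depth-first search: `cnt` vertices have been found, `cur` is the number of the
current vertex. -/
structure DfsInv (n N : ℕ) (own tgt head num vert P : ℕ → ℕ) (cur cnt : ℕ) : Prop where
  cnt_le : cnt ≤ n
  cur_lt : cur < cnt
  vert_spec : ∀ i < cnt, vert i < n ∧ num (vert i) = i + 1
  num_spec : ∀ v, num v ≠ 0 → num v ≤ cnt ∧ vert (num v - 1) = v
  isParent : IsParent cnt P
  joined : ∀ i, 0 < i → i < cnt → ∃ h < N, own h = vert (P i) ∧ tgt h = vert i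
  consumed : ∀ h < N, head (own h) ≤ h → num (tgt h) ≠ 0
  head_le : ∀ u, head u ≤ N
  own_head : ∀ u, head u ≠ 0 → own (head u - 1) = u
  finished : ∀ i < cnt, ¬ Anc P i cur → head (vert i) = 0
  anc : ∀ h < N, num (own h) ≠ 0 → num (own h) < num (tgt h) →
    Anc P (num (own h) - 1) (num (tgt h) - 1)

theorem anc_update {P : ℕ → ℕ} {n c a b : ℕ} (hP : IsParent n P) (hb : b < n) :
    Anc (Function.update P n c) a b ↔ Anc P a b := by
  have key : ∀ k, ∀ b < n, (Function.update P n c)^[k] b = P^[k] b := by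
    intro k
    induction k with
    | zero => exact fun _ _ => rfl
    | succ k ih =>
      intro b hb
      rw [Function.iterate_succ_apply, Function.iterate_succ_apply, Function.update_of_ne hb.ne,
        ih _ ((hP.le hb).trans_lt hb)]
  exact exists_congr fun k => by rw [key k b hb]

namespace DfsInv

variable {n N : ℕ} {own tgt head num vert P : ℕ → ℕ} {cur cnt : ℕ}

theorem pop (I : DfsInv n N own tgt head num vert P cur cnt)
    (hh : head (vert cur) = 0) : DfsInv n N own tgt head num vert P (P cur) cnt :=
  { I with
    cur_lt := (I.isParent.le I.cur_lt).trans_lt I.cur_lt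
    finished := fun i hi hanc => by
      by_cases hic : i = cur
      · rw [hic, hh]
      · exact I.finished i hi fun h => hanc (h.parent hic) }

theorem consume (I : DfsInv n N own tgt head num vert P cur cnt) {next : ℕ → ℕ} {head0 : ℕ → ℕ}
    (H : HalfEdgeLists own head0 next N) {c : ℕ} (hc : c < cnt) (hcc : Anc P c cur)
    (hne : head (vert c) ≠ 0) (hnum : num (tgt (head (vert c) - 1)) ≠ 0) :
    DfsInv n N own tgt (Function.update head (vert c) (next (head (vert c)))) num vert P cur cnt := by
  have hN := I.head_le (vert c)
  have ho := I.own_head _ hne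
  obtain ⟨g, hg⟩ : ∃ g, head (vert c) = g + 1 := ⟨_, (Nat.succ_pred hne).symm⟩
  rw [hg] at hN ho hnum ⊢
  rw [Nat.add_sub_cancel] at ho hnum
  refine { I with consumed := ?_, head_le := ?_, own_head := ?_, finished := ?_ }
  · intro h hh hle
    by_cases hu : own h = vert c
    · rw [hu, Function.update_self] at hle
      rcases lt_trichotomy h g with h' | rfl | h'
      · have := H.le_next g hN h h' (hu.trans ho.symm)
        omega
      · exact hnum
      · exact I.consumed h hh (by rw [hu, hg]; exact h')
    · rw [Function.update_of_ne hu] at hle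
      exact I.consumed h hh hle
  · intro u
    by_cases hu : u = vert c
    · rw [hu, Function.update_self]
      exact (H.next_le g hN).trans (by omega)
    · rw [Function.update_of_ne hu]
      exact I.head_le u
  · intro u
    by_cases hu : u = vert c
    · rw [hu, Function.update_self]
      intro h
      rw [H.own_next g hN h, ho]
    · rw [Function.update_of_ne hu]
      exact I.own_head u
  · intro i hi hanc
    rw [Function.update_of_ne]
    · exact I.finished i hi hanc
    · intro e
      have h1 := (I.vert_spec i hi).2
      have h2 := (I.vert_spec c hc).2
      rw [e, h2] at h1
      exact hanc ((Nat.succ.inj h1) ▸ hcc)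

/-- The point is that every numbered neighbour of the new vertex is an ancestor of it. Otherwise
that neighbour is off the current path, its list is exhausted, and the new vertex would have been
numbered when the joining half-edge was scanned. -/
theorem discover (I : DfsInv n N own tgt head num vert P cur cnt) {h0 : ℕ} (hh0 : h0 < N)
    (ho : own h0 = vert cur) (hw : num (tgt h0) = 0) (hwn : tgt h0 < n) :
    DfsInv n N own tgt head (Function.update num (tgt h0) (cnt + 1))
      (Function.update vert cnt (tgt h0)) (Function.update P cnt cur) cnt (cnt + 1) := by
  have hvw : ∀ i < cnt, vert i ≠ tgt h0 := fun i hi e => by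
    have := (I.vert_spec i hi).2
    rw [e, hw] at this
    omega
  have hnumv : ∀ v, v ≠ tgt h0 → Function.update num (tgt h0) (cnt + 1) v = num v :=
    fun v hv => Function.update_of_ne hv _ _
  have hvert : ∀ i < cnt, Function.update vert cnt (tgt h0) i = vert i :=
    fun i hi => Function.update_of_ne hi.ne _ _
  have hPar : ∀ i < cnt, Function.update P cnt cur i = P i :=
    fun i hi => Function.update_of_ne hi.ne _ _
  have hcnt : 0 < cnt := by have := I.cur_lt; omega
  have hP' : IsParent (cnt + 1) (Function.update P cnt cur) := by
    refine ⟨by rw [hPar 0 hcnt, I.isParent.zero], fun i h0 hi => ?_⟩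
    rcases Nat.lt_succ_iff_lt_or_eq.1 hi with h | rfl
    · rw [hPar i h]
      exact I.isParent.lt i h0 h
    · rw [Function.update_self]
      exact I.cur_lt
  have hup : ∀ {a b : ℕ}, b < cnt → (Anc (Function.update P cnt cur) a b ↔ Anc P a b) :=
    fun hb => anc_update I.isParent hb
  have hcntlt : cnt + 1 ≤ n := by
    have hsub : insert (tgt h0) ((Finset.range cnt).image vert) ⊆ Finset.range n := by
      intro v hv
      rw [Finset.mem_insert, Finset.mem_image] at hv
      rcases hv with rfl | ⟨i, hi, rfl⟩
      · exact Finset.mem_range.2 hwn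
      · exact Finset.mem_range.2 (I.vert_spec i (Finset.mem_range.1 hi)).1
    have hcard := Finset.card_le_card hsub
    rw [Finset.card_insert_of_notMem, Finset.card_image_of_injOn, Finset.card_range,
      Finset.card_range] at hcard
    · exact hcard
    · intro i hi j hj hij
      have h1 := (I.vert_spec i (Finset.mem_range.1 hi)).2
      have h2 := (I.vert_spec j (Finset.mem_range.1 hj)).2
      have hij' : vert i = vert j := hij
      rw [hij', h2] at h1
      omega
    · rw [Finset.mem_image]
      rintro ⟨i, hi, e⟩
      exact hvw i (Finset.mem_range.1 hi) e
  refine ⟨hcntlt, by omega, ?_, ?_, hP', ?_, ?_, I.head_le, I.own_head, ?_, ?_⟩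
  · intro i hi
    rcases Nat.lt_succ_iff_lt_or_eq.1 hi with h | rfl
    · rw [hvert i h, hnumv _ (hvw i h)]
      exact I.vert_spec i h
    · rw [Function.update_self, Function.update_self]
      exact ⟨hwn, rfl⟩
  · intro v hne
    by_cases hvt : v = tgt h0
    · rw [hvt, Function.update_self]
      exact ⟨le_rfl, by rw [Nat.add_sub_cancel, Function.update_self]⟩
    · rw [hnumv v hvt] at hne ⊢
      obtain ⟨h1, h2⟩ := I.num_spec v hne
      exact ⟨by omega, by rw [hvert _ (by omega), h2]⟩
  · intro i hi0 hi
    rcases Nat.lt_succ_iff_lt_or_eq.1 hi with h | rfl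
    · rw [hPar i h, hvert i h, hvert _ ((I.isParent.lt i hi0 h).trans h)]
      exact I.joined i hi0 h
    · rw [Function.update_self, Function.update_self, hvert _ I.cur_lt]
      exact ⟨h0, hh0, ho, rfl⟩
  · intro h hh hle
    by_cases hvt : tgt h = tgt h0
    · rw [hvt, Function.update_self]
      omega
    · rw [hnumv _ hvt]
      exact I.consumed h hh hle
  · intro i hi hanc
    rcases Nat.lt_succ_iff_lt_or_eq.1 hi with h' | rfl
    · rw [hvert i h']
      refine I.finished i h' fun h => hanc (Anc.of_parent ?_)
      rw [Function.update_self, hup I.cur_lt]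
      exact h
    · exact absurd (Anc.refl _ _) hanc
  · intro h hh hne hlt
    by_cases hot : own h = tgt h0
    · exfalso
      rw [hot, Function.update_self] at hlt
      by_cases htt : tgt h = tgt h0
      · rw [htt, Function.update_self] at hlt
        omega
      · rw [hnumv _ htt] at hlt
        have := (I.num_spec (tgt h) (by omega)).1
        omega
    · rw [hnumv _ hot] at hne hlt ⊢
      obtain ⟨ho1, ho2⟩ := I.num_spec _ hne
      by_cases htt : tgt h = tgt h0
      · rw [htt, Function.update_self, Nat.add_sub_cancel]
        refine Anc.of_parent ?_
        rw [Function.update_self, hup I.cur_lt]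
        by_contra hanc
        have h1 := I.finished _ (by omega) hanc
        rw [ho2] at h1
        exact I.consumed h hh (by omega) (htt ▸ hw)
      · rw [hnumv _ htt] at hlt ⊢
        have := (I.num_spec (tgt h) (by omega)).1
        rw [hup (by omega)]
        exact I.anc h hh hne hlt

/-- Back at the root with an exhausted list, all numbered vertices have exhausted lists. So the
numbered vertices are closed under adjacency, and connectivity makes them everything. -/
theorem completed (I : DfsInv n N own tgt head num vert P 0 cnt) (hh : head (vert 0) = 0)
    {r : ℕ} (hnr : num r ≠ 0)
    (hconn : ∀ X : ℕ → Prop, X r → (∀ h < N, X (own h) → X (tgt h)) → ∀ v < n, X v) :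
    cnt = n ∧ ∀ v < n, 0 < num v ∧ num v - 1 < n ∧ vert (num v - 1) = v := by
  have hall : ∀ v < n, num v ≠ 0 := by
    refine hconn (fun v => num v ≠ 0) hnr fun h hh' hne => ?_
    obtain ⟨h1, h2⟩ := I.num_spec _ hne
    refine I.consumed h hh' ?_
    have : head (vert (num (own h) - 1)) = 0 := by
      by_cases h0 : num (own h) - 1 = 0
      · rw [h0, hh]
      · refine I.finished _ (by omega) fun hanc => h0 ?_
        have := I.isParent.anc_le I.cur_lt hanc
        omega
    rw [h2] at this
    omega
  have hcn : n ≤ cnt := by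
    have := Finset.card_le_card_of_injOn (s := Finset.range n) (t := Finset.range cnt)
      (fun v => num v - 1) (fun v hv => by
        have hv' := Finset.mem_range.1 hv
        have h1 := (I.num_spec v (hall v hv')).1
        have h2 := hall v hv'
        exact Finset.mem_coe.2 (Finset.mem_range.2 (show num v - 1 < cnt by omega))) (fun v hv w hw hvw => by
        have h1 := (I.num_spec v (hall v (Finset.mem_range.1 hv))).2
        have h2 := (I.num_spec w (hall w (Finset.mem_range.1 hw))).2
        have hvw' : num v - 1 = num w - 1 := hvw
        rw [← h1, ← h2, hvw'])
    simpa using this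
  refine ⟨le_antisymm I.cnt_le hcn, fun v hv => ?_⟩
  have h1 := I.num_spec v (hall v hv)
  have h2 := hall v hv
  have := I.cnt_le
  exact ⟨by omega, by omega, h1.2⟩

end DfsInv

/-- The depth-first search from vertex `0`. It numbers the vertices, starting from `1`. -/
def search : Prog :=
  .write 6 (𝔠 0) (𝔠 0) ;; .write 7 (𝔠 0) (𝔠 0) ;; .write 5 (𝔠 0) (𝔠 1) ;;
  .assign 5 (𝔠 0) ;; .assign 6 (𝔠 1) ;; .assign 7 (𝔠 1) ;;
  .loop (𝔯 7)
    (.assign 8 (.read 6 (𝔯 5)) ;;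
     .assign 9 (.read 3 (𝔯 8)) ;;
     .cond (𝔯 9)
      (.write 3 (𝔯 8) (.read 4 (𝔯 9)) ;;
       .assign 10 (.read 2 (𝔯 9 ⊖ 𝔠 1)) ;;
       .cond (.read 5 (𝔯 10)) .skip
        (.write 6 (𝔯 6) (𝔯 10) ;;
         .write 7 (𝔯 6) (𝔯 5) ;;
         .assign 5 (𝔯 6) ;;
         .assign 6 (𝔯 6 ⊹ 𝔠 1) ;;
         .write 5 (𝔯 10) (𝔯 6)))
      (.cond (𝔯 5) (.assign 5 (.read 7 (𝔯 5))) (.assign 7 (𝔠 0))))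

/-- What the depth-first search has computed. -/
structure SearchResult (n N : ℕ) (own tgt num vert P : ℕ → ℕ) : Prop where
  vert_spec : ∀ i < n, vert i < n ∧ num (vert i) = i + 1
  num_spec : ∀ v < n, 0 < num v ∧ num v - 1 < n ∧ vert (num v - 1) = v
  isParent : IsParent n P
  joined : ∀ i, 0 < i → i < n → ∃ h < N, own h = vert (P i) ∧ tgt h = vert i
  anc : ∀ h < N, num (own h) ≠ 0 → num (own h) < num (tgt h) →
    Anc P (num (own h) - 1) (num (tgt h) - 1)

/-- The variant is the number of unscanned half-edges, plus the number of undiscovered vertices,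
plus a number `δ` of parent steps to the root, plus `1` while running. A discovery lengthens the
path by one but uses up both a half-edge and an undiscovered vertex. Initially this is at most `N +
n`. -/
theorem wp_search {T : Subroutine} {s : State} {n N : ℕ} (hn : 0 < n)
    (H : HalfEdgeLists (s.arr 1) (s.arr 3) (s.arr 4) N) (h5 : ∀ v, s.arr 5 v = 0)
    (ht : ∀ h < N, s.arr 2 h < n)
    (hconn : ∀ X : ℕ → Prop, X 0 → (∀ h < N, X (s.arr 1 h) → X (s.arr 2 h)) → ∀ v < n, X v) :
    WP T search s fun s' t => t ≤ 50 * (N + n + 2) + 50 ∧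
      SearchResult n N (s.arr 1) (s.arr 2) (s'.arr 5) (s'.arr 6) (s'.arr 7) := by
  simp only [search, wp_seq, wp_write, wp_assign, Expr.eval, Expr.cost]
  set s0 := ((((((s.setArr 6 0 0).setArr 7 0 0).setArr 5 0 1).setReg 5 0).setReg 6 1).setReg 7 1)
    with hs0
  let remaining : (ℕ → ℕ) → ℕ := fun head => ((Finset.range N).filter
    fun h => h < head (s.arr 1 h)).card
  let Inv : ℕ → State → Prop := fun k s' => s'.arr 1 = s.arr 1 ∧ s'.arr 2 = s.arr 2 ∧
    s'.arr 4 = s.arr 4 ∧ s'.arr 5 0 ≠ 0 ∧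
    DfsInv n N (s.arr 1) (s.arr 2) (s'.arr 3) (s'.arr 5) (s'.arr 6) (s'.arr 7) (s'.reg 5)
      (s'.reg 6) ∧ (s'.reg 7 = 0 → s'.reg 5 = 0 ∧ s'.arr 3 (s'.arr 6 0) = 0) ∧
    ∃ δ, (s'.arr 7)^[δ] (s'.reg 5) = 0 ∧
      k = remaining (s'.arr 3) + (n - s'.reg 6) + δ + (if s'.reg 7 = 0 then 0 else 1)
  have hrem : ∀ (head : ℕ → ℕ), remaining head ≤ N := fun head =>
    (Finset.card_filter_le _ _).trans_eq (Finset.card_range N)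
  have hdec : ∀ (head : ℕ → ℕ) (u : ℕ), head u ≠ 0 → head u ≤ N → s.arr 1 (head u - 1) = u →
      remaining (Function.update head u (s.arr 4 (head u))) < remaining head := by
    intro head u h0 hle ho
    have hnext := H.next_le (head u - 1) (by omega)
    rw [Nat.sub_add_cancel (by omega)] at hnext
    refine Finset.card_lt_card ⟨?_, ?_⟩
    · intro h hh
      simp only [Finset.mem_filter] at hh ⊢
      refine ⟨hh.1, ?_⟩
      by_cases hu : s.arr 1 h = u
      · rw [hu, Function.update_self] at hh
        rw [hu]
        omega
      · rw [Function.update_of_ne hu] at hh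
        exact hh.2
    · intro hsub
      have h1 : head u - 1 ∈ (Finset.range N).filter fun h => h < head (s.arr 1 h) := by
        simp only [Finset.mem_filter, Finset.mem_range, ho]
        omega
      have h2 := hsub h1
      simp only [Finset.mem_filter, ho, Function.update_self] at h2
      omega
  have hinit : Inv (remaining (s0.arr 3) + (n - 1) + 0 + 1) s0 := by
    refine ⟨by simp [hs0], by simp [hs0], by simp [hs0], by simp [hs0], ?_, by simp [hs0],
      0, by simp [hs0], by simp [hs0]⟩
    have e3 : s0.arr 3 = s.arr 3 := by simp [hs0]
    have e5 : ∀ v, s0.arr 5 v = if v = 0 then 1 else 0 := fun v => by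
      simp [hs0, Function.update_apply, h5]
    have e6 : s0.arr 6 0 = 0 := by simp [hs0]
    have e7 : s0.arr 7 0 = 0 := by simp [hs0]
    have r5 : s0.reg 5 = 0 := by simp [hs0]
    have r6 : s0.reg 6 = 1 := by simp [hs0]
    rw [r5, r6, e3]
    refine ⟨hn, one_pos, ?_, ?_, ⟨e7, by omega⟩, by omega, ?_, H.head_le, H.own_head, ?_, ?_⟩
    · intro i hi
      obtain rfl : i = 0 := by omega
      rw [e6, e5]
      exact ⟨hn, rfl⟩
    · intro v hv
      rw [e5] at hv ⊢
      split_ifs at hv ⊢ with h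
      · exact ⟨le_rfl, by rw [e6, h]⟩
      · exact absurd rfl hv
    · intro h hh hle
      exact absurd (H.le_head h hh) (by omega)
    · intro i hi hanc
      obtain rfl : i = 0 := by omega
      exact absurd (Anc.refl _ _) hanc
    · intro h _ hne hlt
      rw [e5] at hne
      rw [e5, e5] at hlt
      split_ifs at hne hlt
      all_goals omega
  refine (WP.loop_const (I := Inv) 50 hinit ?_).mono ?_
  · rintro k s1 ⟨e1, e2, e4, e50, I, hgo, δ, hδ, hk⟩ hc
    simp only [Expr.eval] at hc
    rw [if_neg hc] at hk
    by_cases hh : s1.arr 3 (s1.arr 6 (s1.reg 5)) = 0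
    · by_cases h0 : s1.reg 5 = 0
      · simp only [wp_seq, wp_assign, wp_cond, wp_skip, wp_write, Expr.eval, Expr.cost, setReg_reg,
          setReg_arr, setArr_reg, setArr_arr]
        rw [h0] at hh I
        simp [h0, hh]
        refine ⟨remaining (s1.arr 3) + (n - s1.reg 6) + δ, by omega, ?_⟩
        exact ⟨by simp [e1], by simp [e2], by simp [e4], by simpa using e50, by simpa [h0] using I,
          by simp [h0, hh], δ, by simpa using hδ, by simp⟩
      · simp only [wp_seq, wp_assign, wp_cond, wp_skip, wp_write, Expr.eval, Expr.cost, setReg_reg,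
          setReg_arr, setArr_reg, setArr_arr]
        simp [h0, hh]
        cases δ with
        | zero => exact absurd hδ h0
        | succ δ =>
          rw [Function.iterate_succ_apply] at hδ
          refine ⟨remaining (s1.arr 3) + (n - s1.reg 6) + δ + 1, by omega, ?_⟩
          exact ⟨by simp [e1], by simp [e2], by simp [e4], by simpa using e50,
            by simpa using I.pop hh, by simp [hc], δ, by simpa using hδ, by simp [hc]⟩
    · have hle := I.head_le (s1.arr 6 (s1.reg 5))
      have ho := I.own_head _ hh
      have hd := hdec _ _ hh hle ho
      by_cases hw : s1.arr 5 (s.arr 2 (s1.arr 3 (s1.arr 6 (s1.reg 5)) - 1)) = 0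
      · have hw' : s1.arr 5 (s1.arr 2 (s1.arr 3 (s1.arr 6 (s1.reg 5)) - 1)) = 0 := by rw [e2, hw]
        simp only [wp_seq, wp_assign, wp_cond, wp_skip, wp_write, Expr.eval, Expr.cost, setReg_reg,
          setReg_arr, setArr_reg, setArr_arr]
        simp [hh, hw']
        -- The invariant wants targets of scanned half-edges to be numbered, so the discovery is
        -- accounted for first, although the program advances the list before.
        have I1 := I.discover (h0 := s1.arr 3 (s1.arr 6 (s1.reg 5)) - 1) (by omega) ho hw
          (ht _ (by omega))
        have hcur := I.cur_lt
        have I2 := I1.consume H (c := s1.reg 5) (by omega)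
          (Anc.of_parent (by rw [Function.update_self]; exact Anc.refl _ _))
          (by rwa [Function.update_of_ne hcur.ne])
          (by rw [Function.update_of_ne hcur.ne, Function.update_self]; omega)
        rw [Function.update_of_ne hcur.ne] at I2
        have hcn := I1.cnt_le
        refine ⟨_, ?_, by simp [e1], by simp [e2], by simp [e4], ?_, ?_, by simp [hc], δ + 1, ?_,
          rfl⟩
        · simp [hc, e4]
          omega
        · have hne : ∀ w c, Function.update (s1.arr 5) w (c + 1) 0 ≠ 0 := fun w c => by
            rw [Function.update_apply]
            split_ifs
            exacts [Nat.succ_ne_zero c, e50]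
          simp only [setReg_arr, setArr_arr]
          exact hne _ _
        · simpa [e2, e4] using I2
        · simp [Function.iterate_succ_apply]
          have : ∀ k, ∀ b < s1.reg 6,
              (Function.update (s1.arr 7) (s1.reg 6) (s1.reg 5))^[k] b = (s1.arr 7)^[k] b := by
            intro k
            induction k with
            | zero => exact fun _ _ => rfl
            | succ k ih =>
              intro b hb
              rw [Function.iterate_succ_apply, Function.iterate_succ_apply,
                Function.update_of_ne hb.ne, ih _ ((I.isParent.le hb).trans_lt hb)]
          rw [this δ _ hcur, hδ]
      · have hw' : s1.arr 5 (s1.arr 2 (s1.arr 3 (s1.arr 6 (s1.reg 5)) - 1)) ≠ 0 := by rwa [e2]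
        simp only [wp_seq, wp_assign, wp_cond, wp_skip, wp_write, Expr.eval, Expr.cost, setReg_reg,
          setReg_arr, setArr_reg, setArr_arr]
        simp [hh, hw']
        have I2 := I.consume H I.cur_lt (Anc.refl _ _) hh hw
        refine ⟨_, ?_, by simp [e1], by simp [e2], by simp [e4], by simpa using e50, ?_,
          by simp [hc], δ, by simpa using hδ, rfl⟩
        · simp [hc, e4]
          omega
        · simpa [e4] using I2
  · rintro s1 t ⟨htime, ⟨k, e1, e2, e4, e50, I, hgo, -⟩, hc⟩
    simp only [Expr.eval] at hc
    obtain ⟨h0, hh⟩ := hgo hc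
    rw [h0] at I
    obtain ⟨hcn, hnum⟩ := I.completed hh e50 hconn
    constructor
    · have := hrem (s0.arr 3)
      simp only [Expr.cost] at htime
      have h2 : 50 * (remaining (s0.arr 3) + (n - 1) + 0 + 1) ≤ 50 * (N + n) :=
        Nat.mul_le_mul_left _ (by omega)
      omega
    · rw [hcn] at I
      exact ⟨I.vert_spec, hnum, I.isParent, I.joined, I.anc⟩

end Search

end KModal

namespace KModal

/-! ### Low points, tops and positions within the blocks. -/

section Numbering

def initLow : Prog := .for 4 1 (.write 11 (𝔯 4) (𝔯 4))

theorem wp_initLow {T : Subroutine} {s : State} {n : ℕ} (hn : s.reg 1 = n) :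
    WP T initLow s fun s' t => t ≤ 50 * n + 6 ∧ (∀ x < n, s'.arr 11 x = x) ∧
      Frame initLow s s' := by
  refine (WP.for (n := n) 42 (I := fun k s' => ∀ x < k, s'.arr 11 x = x)
    hn (by decide) (by decide) (by decide) (by simp) ?_)
  rintro k s1 hk hx hF hI
  simp [hx]
  intro x hxk
  rcases hxk.lt_or_eq with h | rfl
  · rw [Function.update_of_ne h.ne, hI x h]
  · rw [Function.update_self]

/-- Replaces the ends of the edges by their numbers, and computes for every vertex the smallest
neighbour. -/
def renumber : Prog := .for 4 2
  (.assign 5 (.read 5 (.read 1 (𝔯 4)) ⊖ 𝔠 1) ;;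
   .assign 6 (.read 5 (.read 2 (𝔯 4)) ⊖ 𝔠 1) ;;
   .write 8 (𝔯 4) (𝔯 5) ;;
   .write 9 (𝔯 4) (𝔯 6) ;;
   .cond (𝔯 5 ⊖ 𝔯 6) .skip (.assign 7 (𝔯 5) ;; .assign 5 (𝔯 6) ;; .assign 6 (𝔯 7)) ;;
   .write 22 (𝔯 4) (𝔯 5) ;;
   .cond (.read 11 (𝔯 5) ⊖ 𝔯 6) (.write 11 (𝔯 5) (𝔯 6)) .skip)

/-- `low x` is attained by `x` or by a neighbour of a descendant of `x`, and is at most the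
smallest neighbour of `x`. From `m` on, it is at most `low` of the children. -/
structure IsLow (n e : ℕ) (U W P low : ℕ → ℕ) (m : ℕ) : Prop where
  attained : ∀ x < n, low x = x ∨ ∃ z < n, Anc P x z ∧ ∃ j < e, max (U j) (W j) = z ∧
    low x = min (U j) (W j)
  edge : ∀ j < e, low (max (U j) (W j)) ≤ min (U j) (W j)
  parent : ∀ i, m ≤ i → 0 < i → i < n → low (P i) ≤ low i
  le_self : ∀ x < n, low x ≤ x

/-- An edge joins a descendant, its larger end, to an ancestor, so only `low` at the larger end has
to be updated. The block of the edge will be that of its larger end. -/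
theorem wp_renumber {T : Subroutine} {s : State} {n e : ℕ} (he : s.reg 2 = e)
    (hlow : ∀ x < n, s.arr 11 x = x) {U W : ℕ → ℕ} (P : ℕ → ℕ)
    (hU : ∀ j < e, s.arr 5 (s.arr 1 j) - 1 = U j) (hW : ∀ j < e, s.arr 5 (s.arr 2 j) - 1 = W j)
    (hlt : ∀ j < e, U j < n ∧ W j < n) :
    WP T renumber s fun s' t => t ≤ 100 * e + 6 ∧
      ((∀ j < e, s'.arr 8 j = U j ∧ s'.arr 9 j = W j ∧ s'.arr 22 j = max (U j) (W j)) ∧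
        IsLow n e U W P (s'.arr 11) n) ∧ Frame renumber s s' := by
  refine (WP.for (n := e) 92 (I := fun k s' =>
    (∀ j < k, s'.arr 8 j = U j ∧ s'.arr 9 j = W j ∧ s'.arr 22 j = max (U j) (W j)) ∧
      IsLow n k U W P (s'.arr 11) n) he (by decide) (by decide) (by decide) ?_ ?_)
  · simp only [Nat.not_lt_zero, setReg_arr]
    exact ⟨fun j hj => hj.elim, fun x hx => Or.inl (hlow x hx), fun j hj => by omega,
      fun i h1 _ h2 => by omega, fun x hx => (hlow x hx).le⟩
  rintro k s1 hk hx hF ⟨h1, h2, h3, -, hself⟩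
  have e1 : s1.arr 1 = s.arr 1 := hF.1 1 (by decide)
  have e2 : s1.arr 2 = s.arr 2 := hF.1 2 (by decide)
  have e5 : s1.arr 5 = s.arr 5 := hF.1 5 (by decide)
  obtain ⟨hUn, hWn⟩ := hlt k hk
  have key : ∀ (a8 a9 a22 a11 : ℕ → ℕ), a8 = Function.update (s1.arr 8) k (U k) →
      a9 = Function.update (s1.arr 9) k (W k) →
      a22 = Function.update (s1.arr 22) k (max (U k) (W k)) →
      (∀ x, x ≠ max (U k) (W k) → a11 x = s1.arr 11 x) →
      a11 (max (U k) (W k)) = min (s1.arr 11 (max (U k) (W k))) (min (U k) (W k)) →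
      (∀ j ≤ k, a8 j = U j ∧ a9 j = W j ∧ a22 j = max (U j) (W j)) ∧
        IsLow n (k + 1) U W P a11 n := by
    rintro a8 a9 a22 a11 rfl rfl rfl hne heq
    have hle : ∀ x, a11 x ≤ s1.arr 11 x := fun x => by
      by_cases hxm : x = max (U k) (W k)
      · rw [hxm, heq]
        exact min_le_left _ _
      · exact (hne x hxm).le
    refine ⟨fun j hj => ?_, fun x hxn => ?_, fun j hj => ?_, fun i h1 _ h2 => by omega,
      fun x hxn => (hle x).trans (hself x hxn)⟩
    · rcases hj.lt_or_eq with h | rfl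
      · simpa only [Function.update_of_ne h.ne] using h1 j h
      · simp only [Function.update_self, and_self]
    · by_cases hnew : a11 x = s1.arr 11 x
      · rcases h2 x hxn with h | ⟨z, hz, ha, j, hj, h⟩
        · exact Or.inl (hnew.trans h)
        · exact Or.inr ⟨z, hz, ha, j, by omega, hnew ▸ h⟩
      · have hxm : x = max (U k) (W k) := by
          by_contra h
          exact hnew (hne x h)
        refine Or.inr ⟨x, hxn, Anc.refl P x, k, by omega, hxm.symm, ?_⟩
        rw [hxm] at hnew ⊢
        omega
    · rcases Nat.lt_succ_iff_lt_or_eq.1 hj with h | rfl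
      · exact (hle _).trans (h3 j h)
      · rw [heq]
        exact min_le_right _ _
  simp only [wp_seq, wp_assign, wp_cond, wp_skip, wp_write, Expr.eval, Expr.cost, setReg_reg,
    setReg_arr, setArr_reg, setArr_arr]
  simp [hx, e1, e2, e5, hU k hk, hW k hk]
  refine ⟨fun hUW => ⟨fun hl => ?_, fun hl => ?_⟩, fun hUW => ⟨fun hl => ?_, fun hl => ?_⟩⟩
  all_goals refine key _ _ _ _ rfl rfl ?_ ?_ ?_
  all_goals first | rw [max_eq_left (by omega)] | rw [max_eq_right (by omega)]
  all_goals first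
    | (intro x hx'; first | rfl | exact Function.update_of_ne hx' _ _)
    | (rw [Function.update_self]; omega)
    | omega

/-- Minimizes over the subtrees. -/
def pushLow : Prog := .for 4 13
  (.assign 5 (𝔯 13 ⊖ 𝔯 4) ;;
   .assign 6 (.read 7 (𝔯 5)) ;;
   .cond (.read 11 (𝔯 6) ⊖ .read 11 (𝔯 5)) (.write 11 (𝔯 6) (.read 11 (𝔯 5))) .skip)

theorem IsLow.step {n e : ℕ} {U W P low : ℕ → ℕ} {m : ℕ} (L : IsLow n e U W P low (m + 1))
    (hP : IsParent n P) (h0 : 0 < m) (hm : m < n) {low' : ℕ → ℕ}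
    (hne : ∀ x, x ≠ P m → low' x = low x) (heq : low' (P m) = min (low (P m)) (low m)) :
    IsLow n e U W P low' m := by
  have hlt := hP.lt m h0 hm
  have hle : ∀ x, low' x ≤ low x := fun x => by
    by_cases hx : x = P m
    · rw [hx, heq]
      exact min_le_left _ _
    · exact (hne x hx).le
  refine ⟨fun x hx => ?_, fun j hj => (hle _).trans (L.edge j hj), fun i hi hi0 hin => ?_,
    fun x hx => (hle x).trans (L.le_self x hx)⟩
  · by_cases hnew : low' x = low x
    · rw [hnew]
      exact L.attained x hx
    · have hxm : x = P m := by
        by_contra h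
        exact hnew (hne x h)
      subst hxm
      have hlm : low' (P m) = low m := by omega
      have hanc : Anc P (P m) m := ⟨1, rfl⟩
      rw [hlm]
      rcases L.attained m hm with h | ⟨z, hz, ha, j, hj, h1, h2⟩
      · have := L.le_self (P m) hx
        omega
      · exact Or.inr ⟨z, hz, hanc.trans ha, j, hj, h1, h2⟩
  · rcases hi.eq_or_lt with rfl | hi'
    · rw [heq]
      have : low' m = low m := hne m hlt.ne'
      omega
    · have h1 := L.parent i hi' hi0 hin
      have h2 : low' i = low i := hne i (by omega)
      rw [h2]
      exact (hle _).trans h1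

/-- Vertices are treated by decreasing number, so all children of a vertex have passed on their
values before the vertex does. -/
theorem wp_pushLow {T : Subroutine} {s : State} {n e : ℕ} (hn : s.reg 13 = n - 1)
    {U W : ℕ → ℕ} (hP : IsParent n (s.arr 7)) (hL : IsLow n e U W (s.arr 7) (s.arr 11) n) :
    WP T pushLow s fun s' t => t ≤ 50 * (n - 1) + 6 ∧
      IsLow n e U W (s.arr 7) (s'.arr 11) 1 ∧ Frame pushLow s s' := by
  refine (WP.for (n := n - 1) 42 (I := fun k s' => IsLow n e U W (s.arr 7) (s'.arr 11) (n - k))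
    hn (by decide) (by decide) (by decide) ?_ ?_).mono ?_
  · simpa using hL
  · rintro k s1 hk hx hF hI
    have e7 : s1.arr 7 = s.arr 7 := hF.1 7 (by decide)
    have e13 : s1.reg 13 = n - 1 := by rw [hF.2 13 (by decide), hn]
    have hnk : n - k = n - 1 - k + 1 := by omega
    rw [hnk] at hI
    have hnk' : n - (k + 1) = n - 1 - k := by omega
    have hst := fun low' => hI.step (low' := low') hP (by omega) (by omega)
    simp [hx, e7, e13, hnk']
    refine ⟨fun hl => hst _ ?_ ?_, fun hl => hst _ ?_ ?_⟩
    · intro x hx'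
      exact Function.update_of_ne hx' _ _
    · rw [Function.update_self]
      omega
    · exact fun _ _ => rfl
    · omega
  · rintro s' t ⟨h1, h2, h3⟩
    refine ⟨h1, ?_, h3⟩
    rcases Nat.eq_zero_or_pos n with rfl | h
    · exact ⟨h2.attained, h2.edge, fun i _ _ h => by omega, h2.le_self⟩
    · rwa [Nat.sub_sub_self h] at h2

/-- If `low i` comes from an edge of the subtree, topness bounds it; if it is `i` itself, it exceeds
`P i` anyway. Conversely `low` is monotone along tree paths, so `low i` bounds every edge leaving
the subtree from below. -/
theorem IsLow.isTop_iff {V : Type} {G : Digraph V} {f : ℕ → V} {n e : ℕ} {U W P low : ℕ → ℕ}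
    (L : IsLow n e U W P low 1) (hP : IsParent n P)
    (hjoined : ∀ x < n, ∀ y < n, Joined G (f x) (f y) ↔
      ∃ j < e, (U j = x ∧ W j = y) ∨ (U j = y ∧ W j = x))
    {i : ℕ} (h0 : 0 < i) (hi : i < n) : IsTop G n f P i ↔ P i ≤ low i := by
  have hlt := hP.lt i h0 hi
  constructor
  · rintro ⟨-, -, h⟩
    rcases L.attained i hi with h' | ⟨z, hz, ha, j, hj, h1, h2⟩
    · omega
    · rw [h2]
      refine h z hz ha _ (by omega) ((hjoined _ (by omega) _ hz).2 ⟨j, hj, ?_⟩)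
      omega
  · intro hle
    refine ⟨h0, hi, fun x hx ha y hy hj => ?_⟩
    have hix := hP.anc_le hx ha
    have hlow : ∀ d x, x = i + d → x < n → Anc P i x → low i ≤ low x := by
      intro d
      induction d using Nat.strong_induction_on with
      | _ d ih =>
        rintro x rfl hx ha
        rcases Nat.eq_zero_or_pos d with rfl | hd
        · exact le_rfl
        · have hp := ha.parent (by omega)
          have hPx := hP.lt (i + d) (by omega) hx
          have hpi := hP.anc_le (hPx.trans hx) hp
          exact (ih (P (i + d) - i) (by omega) _ (by omega) (hPx.trans hx) hp).trans
            (L.parent _ (by omega) (by omega) hx)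
    have h1 := hlow (x - i) x (by omega) hx ha
    obtain ⟨j, hj, h⟩ := (hjoined y hy x hx).1 hj
    have h2 := L.edge j hj
    rcases le_total y x with hyx | hyx
    · have e1 : max (U j) (W j) = x := by omega
      have e2 : min (U j) (W j) = y := by omega
      rw [e1, e2] at h2
      omega
    · omega

/-- Computes the tops of the blocks. -/
def computeReps : Prog := .for 4 13
  (.assign 5 (𝔯 4 ⊹ 𝔠 1) ;;
   .assign 6 (.read 7 (𝔯 5)) ;;
   .cond (𝔯 6 ⊖ .read 11 (𝔯 5)) (.write 12 (𝔯 5) (.read 12 (𝔯 6))) (.write 12 (𝔯 5) (𝔯 5)))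

theorem wp_computeReps {T : Subroutine} {s : State} {n : ℕ} (hn : s.reg 13 = n - 1)
    (hP : IsParent n (s.arr 7)) (h12 : s.arr 12 0 = 0) :
    WP T computeReps s fun s' t => t ≤ 50 * (n - 1) + 6 ∧
      (s'.arr 12 0 = 0 ∧ ∀ i, 0 < i → i < n →
        s'.arr 12 i = if s.arr 7 i ≤ s.arr 11 i then i else s'.arr 12 (s.arr 7 i)) ∧
      Frame computeReps s s' := by
  refine (WP.for (n := n - 1) 42 (I := fun k s' => s'.arr 12 0 = 0 ∧ ∀ i, 0 < i → i < k + 1 →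
        s'.arr 12 i = if s.arr 7 i ≤ s.arr 11 i then i else s'.arr 12 (s.arr 7 i))
    hn (by decide) (by decide) (by decide) ?_ ?_).mono ?_
  · refine ⟨h12, fun i _ _ => by omega⟩
  · rintro k s1 hk hx hF ⟨hI0, hI⟩
    have e7 : s1.arr 7 = s.arr 7 := hF.1 7 (by decide)
    have e11 : s1.arr 11 = s.arr 11 := hF.1 11 (by decide)
    have hlt := hP.lt (k + 1) (by omega) (by omega)
    have key : ∀ a12 : ℕ → ℕ, (∀ x, x ≠ k + 1 → a12 x = s1.arr 12 x) →
        a12 (k + 1) = (if s.arr 7 (k + 1) ≤ s.arr 11 (k + 1) then k + 1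
          else s1.arr 12 (s.arr 7 (k + 1))) →
        s1.arr 12 0 = 0 ∧ ∀ i, 0 < i → i ≤ k + 1 →
          a12 i = if s.arr 7 i ≤ s.arr 11 i then i else a12 (s.arr 7 i) := by
      intro a12 hne heq
      refine ⟨hI0, fun i h0 hi => ?_⟩
      rcases hi.lt_or_eq with h | rfl
      · have := hP.lt i h0 (by omega)
        rw [hne i (by omega), hne (s.arr 7 i) (by omega)]
        exact hI i h0 h
      · rw [hne (s.arr 7 (k + 1)) (by omega)]
        exact heq
    simp [hx, e7, e11]
    refine ⟨fun hl => key _ ?_ ?_, fun hl => key _ ?_ ?_⟩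
    · exact fun x hx' => Function.update_of_ne hx' _ _
    · rw [Function.update_self, if_neg (by omega)]
    · exact fun x hx' => Function.update_of_ne hx' _ _
    · rw [Function.update_self, if_pos (by omega)]
  · rintro s' t ⟨h1, ⟨h2, h3⟩, h4⟩
    exact ⟨h1, ⟨h2, fun i h0 hi => h3 i h0 (by omega)⟩, h4⟩

/-- The items `j < k` with the same key are numbered consecutively from `0`. -/
structure Buckets (k : ℕ) (key pos cnt : ℕ → ℕ) : Prop where
  lt : ∀ j < k, pos j < cnt (key j)
  inj : ∀ i < k, ∀ j < k, key i = key j → pos i = pos j → i = j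
  surj : ∀ b l, l < cnt b → ∃ j < k, key j = b ∧ pos j = l

theorem Buckets.push {k : ℕ} {key pos cnt : ℕ → ℕ} (B : Buckets k key pos cnt) :
    Buckets (k + 1) key (Function.update pos k (cnt (key k)))
      (Function.update cnt (key k) (cnt (key k) + 1)) := by
  refine ⟨fun j hj => ?_, fun i hi j hj => ?_, fun b l hl => ?_⟩
  · rcases Nat.lt_succ_iff_lt_or_eq.1 hj with h | rfl
    · rw [Function.update_of_ne h.ne]
      have := B.lt j h
      rw [Function.update_apply]
      split_ifs with hk
      · rw [hk] at this
        omega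
      · exact this
    · rw [Function.update_self, Function.update_self]
      exact Nat.lt_succ_self _
  · rcases Nat.lt_succ_iff_lt_or_eq.1 hi with h | rfl <;>
      rcases Nat.lt_succ_iff_lt_or_eq.1 hj with h' | rfl
    · rw [Function.update_of_ne h.ne, Function.update_of_ne h'.ne]
      exact B.inj i h j h'
    · rw [Function.update_of_ne h.ne, Function.update_self]
      intro h1 h2
      have := B.lt i h
      rw [h1] at this
      omega
    · rw [Function.update_of_ne h'.ne, Function.update_self]
      intro h1 h2
      have := B.lt j h'
      rw [← h1] at this
      omega
    · exact fun _ _ => rfl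
  · have old : l < cnt b → ∃ j < k + 1, key j = b ∧ Function.update pos k (cnt (key k)) j = l := by
      intro h
      obtain ⟨j, hj, h1, h2⟩ := B.surj b l h
      exact ⟨j, by omega, h1, by rw [Function.update_of_ne hj.ne, h2]⟩
    rw [Function.update_apply] at hl
    split_ifs at hl with hb
    · subst hb
      rcases Nat.lt_succ_iff_lt_or_eq.1 hl with h | rfl
      · exact old h
      · exact ⟨k, by omega, rfl, by rw [Function.update_self]⟩
    · exact old hl

def fillBuckets (N : ℕ) (key : Expr) (p c : ℕ) : Prog := .for 4 N
  (.assign 5 key ;;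
   .write p (𝔯 4) (.read c (𝔯 5)) ;;
   .write c (𝔯 5) (.read c (𝔯 5) ⊹ 𝔠 1))

theorem wp_fillBuckets {T : Subroutine} {s : State} {N n p c : ℕ} {key : Expr} {κ : ℕ → ℕ}
    (hN : s.reg N = n) (hN4 : N ≠ 4) (hN5 : N ≠ 5) (hpc : p ≠ c) (hcost : key.cost ≤ 10)
    (hkey : ∀ s' i, i < n → s'.reg 4 = i → (∀ a, a ≠ p → a ≠ c → s'.arr a = s.arr a) →
      key.eval s' = κ i) (hc : ∀ b, s.arr c b = 0) :
    WP T (fillBuckets N key p c) s fun s' t => t ≤ 50 * n + 6 ∧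
      Buckets n κ (s'.arr p) (s'.arr c) ∧ Frame (fillBuckets N key p c) s s' := by
  refine (WP.for (n := n) 42 (I := fun k s' => Buckets k κ (s'.arr p) (s'.arr c))
    hN (by simp [Prog.regs]) (by simpa [Prog.regs] using hN5) hN4 ?_ ?_)
  · simp only [setReg_arr]
    exact ⟨fun j hj => by omega, fun i hi => by omega, fun b l hl => by rw [hc] at hl; omega⟩
  · rintro k s1 hk hx hF hI
    have hev := hkey s1 k hk hx fun a h1 h2 => hF.1 a (by
      simp [Prog.for, Prog.arrs, h1, h2])
    simp [hx, hev, hpc, Ne.symm hpc]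
    refine ⟨by omega, hI.push⟩

end Numbering

end KModal

namespace KModal

/-! ### Storing all blocks as encoded instances. -/

section Storage

/-- The data that determine where the blocks are stored: the tops `rep` of the blocks of the
vertices and `key` of the blocks of the edges, the positions `vp`, `ep` of the vertices and edges
in their blocks, the numbers `vc`, `ec` of vertices and edges of the blocks, and the addresses
`off`. -/
structure Layout where
  n : ℕ
  e : ℕ
  rep : ℕ → ℕ
  vp : ℕ → ℕ
  vc : ℕ → ℕ
  key : ℕ → ℕ
  ep : ℕ → ℕ
  ec : ℕ → ℕ
  off : ℕ → ℕ
  U : ℕ → ℕ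
  W : ℕ → ℕ

namespace Layout

variable (D : Layout)

/-- The number of the vertex `x` inside the block with top `b`; the head of the block gets `0`. -/
def loc (b x : ℕ) : ℕ := if D.rep x = b then D.vp x + 1 else 0

/-- The record of a block consists of its two counts, the value at the head in cell `2`, the budgets
of its `vc b` other vertices, and two cells per edge. -/
def size (b : ℕ) : ℕ := 3 + D.vc b + 2 * D.ec b

def vaddr (i : ℕ) : ℕ := D.off (D.rep i) + 3 + D.vp i

def eaddr (j : ℕ) : ℕ := D.off (D.key j) + D.vc (D.key j) + 3 + (D.ep j + D.ep j)

structure Numbered : Prop where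
  verts : Buckets D.n D.rep D.vp D.vc
  edges : Buckets D.e D.key D.ep D.ec
  rep_le : ∀ i < D.n, D.rep i ≤ i
  rep_rep : ∀ i < D.n, D.rep (D.rep i) = D.rep i
  key_lt : ∀ j < D.e, D.key j < D.n
  rep_key : ∀ j < D.e, D.rep (D.key j) = D.key j

def Separated : Prop := ∀ b < D.n, D.rep b = b → ∀ b' < D.n, D.rep b' = b' →
  ∀ l < D.size b, ∀ l' < D.size b', D.off b + l = D.off b' + l' → b = b' ∧ l = l'

/-- The array `A` contains the sizes of the blocks, the numbers `M i` for the vertices `i < k`, and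
the edges `j < l`. -/
structure Stored (M : ℕ → ℕ) (k l : ℕ) (A : ℕ → ℕ) : Prop where
  sizes : ∀ b < D.n, D.rep b = b → A (D.off b) = D.vc b + 1 ∧ A (D.off b + 1) = D.ec b
  vert : ∀ i < k, A (D.vaddr i) = M i
  edge : ∀ j < l, A (D.eaddr j) = D.loc (D.key j) (D.U j) ∧
    A (D.eaddr j + 1) = D.loc (D.key j) (D.W j)

variable {D}

theorem vaddr_ne_vaddr (N : D.Numbered) (S : D.Separated) {i i' : ℕ} (hi : i < D.n)
    (hi' : i' < D.n) (h : i ≠ i') : D.vaddr i ≠ D.vaddr i' := by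
  intro heq
  have h1 := N.verts.lt i hi
  have h2 := N.verts.lt i' hi'
  obtain ⟨h3, h4⟩ := S (D.rep i) ((N.rep_le i hi).trans_lt hi) (N.rep_rep i hi) (D.rep i')
    ((N.rep_le i' hi').trans_lt hi') (N.rep_rep i' hi') (3 + D.vp i) (by unfold size; omega)
    (3 + D.vp i') (by unfold size; omega) (by unfold vaddr at heq; omega)
  exact h (N.verts.inj i hi i' hi' h3 (by omega))

theorem vaddr_ne_off (N : D.Numbered) (S : D.Separated) {i b l : ℕ} (hi : i < D.n)
    (hb : b < D.n) (hbb : D.rep b = b) (hl : l < 3) : D.vaddr i ≠ D.off b + l := by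
  intro heq
  have h1 := N.verts.lt i hi
  obtain ⟨h3, h4⟩ := S (D.rep i) ((N.rep_le i hi).trans_lt hi) (N.rep_rep i hi) b hb hbb
    (3 + D.vp i) (by unfold size; omega) l (by unfold size; omega)
    (by unfold vaddr at heq; omega)
  omega

theorem eaddr_ne_vaddr (N : D.Numbered) (S : D.Separated) {i j l : ℕ} (hi : i < D.n)
    (hj : j < D.e) (hl : l < 2) : D.eaddr j + l ≠ D.vaddr i := by
  intro heq
  have h1 := N.verts.lt i hi
  have h2 := N.edges.lt j hj
  obtain ⟨h3, h4⟩ := S (D.key j) (N.key_lt j hj) (N.rep_key j hj) (D.rep i)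
    ((N.rep_le i hi).trans_lt hi) (N.rep_rep i hi)
    (3 + D.vc (D.key j) + 2 * D.ep j + l) (by unfold size; omega)
    (3 + D.vp i) (by unfold size; omega) (by unfold vaddr eaddr at heq; omega)
  rw [h3] at h4
  omega

theorem eaddr_ne_off (N : D.Numbered) (S : D.Separated) {j b l l' : ℕ} (hj : j < D.e)
    (hb : b < D.n) (hbb : D.rep b = b) (hl : l < 2) (hl' : l' < 3) :
    D.eaddr j + l ≠ D.off b + l' := by
  intro heq
  have h2 := N.edges.lt j hj
  obtain ⟨h3, h4⟩ := S (D.key j) (N.key_lt j hj) (N.rep_key j hj) b hb hbb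
    (3 + D.vc (D.key j) + 2 * D.ep j + l) (by unfold size; omega) l' (by unfold size; omega)
    (by unfold eaddr at heq; omega)
  omega

theorem eaddr_ne_eaddr (N : D.Numbered) (S : D.Separated) {j j' l l' : ℕ} (hj : j < D.e)
    (hj' : j' < D.e) (h : j ≠ j') (hl : l < 2) (hl' : l' < 2) :
    D.eaddr j + l ≠ D.eaddr j' + l' := by
  intro heq
  have h1 := N.edges.lt j hj
  have h2 := N.edges.lt j' hj'
  obtain ⟨h3, h4⟩ := S (D.key j) (N.key_lt j hj) (N.rep_key j hj) (D.key j')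
    (N.key_lt j' hj') (N.rep_key j' hj')
    (3 + D.vc (D.key j) + 2 * D.ep j + l) (by unfold size; omega)
    (3 + D.vc (D.key j') + 2 * D.ep j' + l') (by unfold size; omega)
    (by unfold eaddr at heq; omega)
  rw [h3] at h4
  exact h (N.edges.inj j hj j' hj' h3 (by omega))

/-- Both `M` and `k` may change, so that this covers filling the next cell as well as the later
reduction of a budget. -/
theorem Stored.write_vert {M M' : ℕ → ℕ} {k k' l v i : ℕ} {A : ℕ → ℕ} (H : D.Stored M k l A)
    (N : D.Numbered) (S : D.Separated) (hi : i < D.n) (hk' : k' ≤ D.n) (hl : l ≤ D.e)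
    (hk : ∀ x < k', x ≠ i → x < k ∧ M' x = M x) (hM : M' i = v) :
    D.Stored M' k' l (Function.update A (D.vaddr i) v) := by
  refine ⟨fun b hb hbb => ?_, fun x hx => ?_, fun j hj => ?_⟩
  · have h0 : D.vaddr i ≠ D.off b := vaddr_ne_off N S hi hb hbb (l := 0) (by omega)
    have h1 := vaddr_ne_off N S hi hb hbb (l := 1) (by omega)
    rw [Function.update_of_ne h0.symm, Function.update_of_ne h1.symm]
    exact H.sizes b hb hbb
  · by_cases hxi : x = i
    · rw [hxi, Function.update_self, hM]
    · rw [Function.update_of_ne (vaddr_ne_vaddr N S (by omega) hi hxi), H.vert x (hk x hx hxi).1,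
        (hk x hx hxi).2]
  · have h0 : D.eaddr j ≠ D.vaddr i := eaddr_ne_vaddr N S hi (hj.trans_le hl) (l := 0) (by omega)
    have h1 := eaddr_ne_vaddr N S hi (hj.trans_le hl) (l := 1) (by omega)
    rw [Function.update_of_ne h0, Function.update_of_ne h1]
    exact H.edge j hj

/-- `Stored` says nothing about the cell of the head, so trial values can be written there at will.
-/
theorem Stored.write_head {M : ℕ → ℕ} {k l v b : ℕ} {A : ℕ → ℕ} (H : D.Stored M k l A)
    (N : D.Numbered) (S : D.Separated) (hb : b < D.n) (hbb : D.rep b = b) (hk : k ≤ D.n)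
    (hl : l ≤ D.e) : D.Stored M k l (Function.update A (D.off b + 2) v) := by
  refine ⟨fun b' hb' hbb' => ?_, fun x hx => ?_, fun j hj => ?_⟩
  · have hne : ∀ l' < 2, D.off b' + l' ≠ D.off b + 2 := fun l' hl' h => by
      have := (S b' hb' hbb' b hb hbb l' (by unfold size; omega) 2 (by unfold size; omega) h).2
      omega
    have h0 : D.off b' ≠ D.off b + 2 := hne 0 (by omega)
    rw [Function.update_of_ne h0, Function.update_of_ne (hne 1 (by omega))]
    exact H.sizes b' hb' hbb'
  · rw [Function.update_of_ne (vaddr_ne_off N S (by omega) hb hbb (by omega))]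
    exact H.vert x hx
  · have hne : ∀ l' < 2, D.eaddr j + l' ≠ D.off b + 2 := fun l' hl' =>
      eaddr_ne_off N S (hj.trans_le hl) hb hbb hl' (by omega)
    have h0 : D.eaddr j ≠ D.off b + 2 := hne 0 (by omega)
    rw [Function.update_of_ne h0, Function.update_of_ne (hne 1 (by omega))]
    exact H.edge j hj

theorem Stored.write_edge {M : ℕ → ℕ} {k l : ℕ} {A : ℕ → ℕ} (H : D.Stored M k l A)
    (N : D.Numbered) (S : D.Separated) (hk : k ≤ D.n) (hl : l < D.e) :
    D.Stored M k (l + 1) (Function.update (Function.update A (D.eaddr l)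
      (D.loc (D.key l) (D.U l))) (D.eaddr l + 1) (D.loc (D.key l) (D.W l))) := by
  have key : ∀ x, (∀ l' < 2, D.eaddr l + l' ≠ x) →
      Function.update (Function.update A (D.eaddr l)
      (D.loc (D.key l) (D.U l))) (D.eaddr l + 1) (D.loc (D.key l) (D.W l)) x = A x := fun x hx => by
    have h0 : D.eaddr l ≠ x := hx 0 (by omega)
    rw [Function.update_of_ne (hx 1 (by omega)).symm, Function.update_of_ne h0.symm]
  refine ⟨fun b' hb' hbb' => ?_, fun x hx => ?_, fun j hj => ?_⟩
  · rw [key (D.off b') fun l' hl' => eaddr_ne_off N S hl hb' hbb' hl' (l' := 0) (by omega),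
      key _ fun l' hl' => eaddr_ne_off N S hl hb' hbb' hl' (l' := 1) (by omega)]
    exact H.sizes b' hb' hbb'
  · rw [key _ fun l' hl' => eaddr_ne_vaddr N S (by omega) hl hl']
    exact H.vert x hx
  · rcases Nat.lt_succ_iff_lt_or_eq.1 hj with h | rfl
    · have hne : ∀ l' < 2, ∀ l'' < 2, D.eaddr l + l'' ≠ D.eaddr j + l' := fun l' h1 l'' h2 =>
        eaddr_ne_eaddr N S hl (h.trans hl) h.ne' h2 h1
      rw [key (D.eaddr j) (hne 0 (by omega)), key _ (hne 1 (by omega))]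
      exact H.edge j h
    · rw [Function.update_self, Function.update_of_ne (by omega), Function.update_self]
      exact ⟨rfl, rfl⟩

end Layout

/-- Assigns the addresses and stores the sizes of the blocks. -/
def storeSizes : Prog := .assign 8 (𝔠 0) ;; .for 4 1
  (.cond (𝔯 4 ⊖ .read 12 (𝔯 4)) .skip
    (.write 17 (𝔯 4) (𝔯 8) ;;
     .write 19 (𝔯 8) (.read 14 (𝔯 4) ⊹ 𝔠 1) ;;
     .write 19 (𝔯 8 ⊹ 𝔠 1) (.read 16 (𝔯 4)) ;;
     .assign 8 (𝔯 8 ⊹ 𝔠 3 ⊹ .read 14 (𝔯 4) ⊹ (.read 16 (𝔯 4) ⊹ .read 16 (𝔯 4)))))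

theorem wp_storeSizes {T : Subroutine} {s : State} {D : Layout} (hn : s.reg 1 = D.n)
    (h12 : s.arr 12 = D.rep) (h14 : s.arr 14 = D.vc) (h16 : s.arr 16 = D.ec)
    (hrep : ∀ i < D.n, D.rep i ≤ i) (M : ℕ → ℕ) :
    WP T storeSizes s fun s' t => t ≤ 100 * D.n + 8 ∧
      (({D with off := s'.arr 17} : Layout).Separated ∧
        ({D with off := s'.arr 17} : Layout).Stored M 0 0 (s'.arr 19)) ∧ Frame storeSizes s s' := by
  suffices h : WP T storeSizes s fun s' t => t ≤ 100 * D.n + 8 ∧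
      (({D with off := s'.arr 17} : Layout).Separated ∧
        ({D with off := s'.arr 17} : Layout).Stored M 0 0 (s'.arr 19)) from
    h.frame.mono fun s' t h => ⟨h.1.1, h.1.2, h.2⟩
  rw [storeSizes, wp_seq, wp_assign]
  -- Register `8` is the first free address; all records assigned so far end before it.
  refine (WP.for (n := D.n) 92 (I := fun k s' =>
    (∀ b < k, D.rep b = b → s'.arr 17 b + D.size b ≤ s'.reg 8 ∧
      s'.arr 19 (s'.arr 17 b) = D.vc b + 1 ∧ s'.arr 19 (s'.arr 17 b + 1) = D.ec b) ∧
    ∀ b' < k, ∀ b < b', D.rep b = b → D.rep b' = b' → s'.arr 17 b + D.size b ≤ s'.arr 17 b')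
    (by simp [hn]) (by decide) (by decide) (by decide) ?_ ?_).mono ?_
  · simp
  · rintro k s1 hk hx hF ⟨h1, h2⟩
    have e12 : s1.arr 12 = D.rep := by rw [hF.1 12 (by decide), setReg_arr, h12]
    have e14 : s1.arr 14 = D.vc := by rw [hF.1 14 (by decide), setReg_arr, h14]
    have e16 : s1.arr 16 = D.ec := by rw [hF.1 16 (by decide), setReg_arr, h16]
    have hle := hrep k hk
    simp [hx, e12, e14, e16, -Order.lt_add_one_iff]
    constructor
    · intro hlt
      refine ⟨fun b hb hbb => ?_, fun b' hb' b hb hbb hbb' => ?_⟩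
      · rcases Nat.lt_succ_iff_lt_or_eq.1 hb with h | rfl
        · exact h1 b h hbb
        · omega
      · rcases Nat.lt_succ_iff_lt_or_eq.1 hb' with h | rfl
        · exact h2 b' h b hb hbb hbb'
        · omega
    · intro hge
      refine ⟨fun b hb hbb => ?_, fun b' hb' b hb hbb hbb' => ?_⟩
      · rcases Nat.lt_succ_iff_lt_or_eq.1 hb with h | rfl
        · obtain ⟨h3, h4, h5⟩ := h1 b h hbb
          have hs : 3 ≤ D.size b := by unfold Layout.size; omega
          rw [Function.update_of_ne h.ne, Function.update_of_ne (by omega),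
            Function.update_of_ne (by omega), Function.update_of_ne (by omega),
            Function.update_of_ne (by omega)]
          exact ⟨by omega, h4, h5⟩
        · rw [Function.update_self, Function.update_self, Function.update_of_ne (by omega),
            Function.update_self]
          exact ⟨by unfold Layout.size; omega, rfl, rfl⟩
      · rcases Nat.lt_succ_iff_lt_or_eq.1 hb' with h | rfl
        · rw [Function.update_of_ne h.ne, Function.update_of_ne (by omega)]
          exact h2 b' h b hb hbb hbb'
        · rw [Function.update_self, Function.update_of_ne hb.ne]
          exact (h1 b hb hbb).1
  · rintro s' t ⟨ht, ⟨h1, h2⟩, -⟩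
    simp only [Expr.cost]
    refine ⟨by omega, ?_, ⟨fun b hb hbb => (h1 b hb hbb).2, fun i hi => absurd hi (Nat.not_lt_zero i),
      fun j hj => absurd hj (Nat.not_lt_zero j)⟩⟩
    intro b hb hbb b' hb' hbb' l hl l' hl' heq
    have hl1 : l < D.size b := hl
    have hl2 : l' < D.size b' := hl'
    have heq' : s'.arr 17 b + l = s'.arr 17 b' + l' := heq
    rcases lt_trichotomy b b' with h | rfl | h
    · have := h2 b' hb' b h hbb hbb'
      omega
    · exact ⟨rfl, by omega⟩
    · have := h2 b hb b' h hbb' hbb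
      omega

/-- Stores the vertices. -/
def storeVerts : Prog := .for 4 1
  (.assign 5 (.read 17 (.read 12 (𝔯 4)) ⊹ 𝔠 3 ⊹ .read 13 (𝔯 4)) ;;
   .write 18 (𝔯 4) (𝔯 5) ;;
   .write 19 (𝔯 5) (.read 0 (𝔠 2 ⊹ .read 6 (𝔯 4))))

/-- Each budget is stored once, in the block where the vertex is not the head. The root is the head
of all its blocks; as its representative is `0`, its budget goes to a record with key `0` that is
never tested. -/
theorem wp_storeVerts {T : Subroutine} {s : State} {D : Layout} (hn : s.reg 1 = D.n)
    (h12 : s.arr 12 = D.rep) (h13 : s.arr 13 = D.vp) (h17 : s.arr 17 = D.off)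
    (N : D.Numbered) (S : D.Separated) {M : ℕ → ℕ} (hM : ∀ i < D.n, s.arr 0 (2 + s.arr 6 i) = M i)
    (H : D.Stored M 0 0 (s.arr 19)) :
    WP T storeVerts s fun s' t => t ≤ 100 * D.n + 6 ∧
      ((∀ i < D.n, s'.arr 18 i = D.vaddr i) ∧ D.Stored M D.n 0 (s'.arr 19)) ∧
      Frame storeVerts s s' := by
  refine (WP.for (n := D.n) 92 (I := fun k s' =>
    (∀ i < k, s'.arr 18 i = D.vaddr i) ∧ D.Stored M k 0 (s'.arr 19))
    hn (by decide) (by decide) (by decide) ⟨fun i hi => absurd hi (Nat.not_lt_zero i), H⟩ ?_)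
  rintro k s1 hk hx hF ⟨h1, h2⟩
  have e0 : s1.arr 0 = s.arr 0 := hF.1 0 (by decide)
  have e6 : s1.arr 6 = s.arr 6 := hF.1 6 (by decide)
  have e12 : s1.arr 12 = D.rep := by rw [hF.1 12 (by decide), h12]
  have e13 : s1.arr 13 = D.vp := by rw [hF.1 13 (by decide), h13]
  have e17 : s1.arr 17 = D.off := by rw [hF.1 17 (by decide), h17]
  simp [hx, e0, e6, e12, e13, e17, -Order.lt_add_one_iff]
  refine ⟨fun i hi => ?_, ?_⟩
  · rcases Nat.lt_succ_iff_lt_or_eq.1 hi with h | rfl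
    · rw [Function.update_of_ne h.ne, h1 i h]
    · rw [Function.update_self, Layout.vaddr]
  · exact h2.write_vert N S hk hk (Nat.zero_le _) (fun x hx hxk => ⟨by omega, rfl⟩) (hM k hk).symm

/-- Stores the edges. -/
def storeEdges : Prog := .for 4 2
  (.assign 5 (.read 12 (.read 22 (𝔯 4))) ;;
   .assign 6 (.read 17 (𝔯 5) ⊹ .read 14 (𝔯 5) ⊹ 𝔠 3 ⊹ (.read 15 (𝔯 4) ⊹ .read 15 (𝔯 4))) ;;
   .assign 7 (.read 8 (𝔯 4)) ;;
   .cond (𝔯 5 ⊖ .read 12 (𝔯 7)) (.write 19 (𝔯 6) (𝔠 0))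
    (.write 19 (𝔯 6) (.read 13 (𝔯 7) ⊹ 𝔠 1)) ;;
   .assign 7 (.read 9 (𝔯 4)) ;;
   .cond (𝔯 5 ⊖ .read 12 (𝔯 7)) (.write 19 (𝔯 6 ⊹ 𝔠 1) (𝔠 0))
    (.write 19 (𝔯 6 ⊹ 𝔠 1) (.read 13 (𝔯 7) ⊹ 𝔠 1)))

/-- The only comparison is truncated subtraction. By `hUW` the representative of an end is at most
the key, so the difference is `0` exactly when they agree; otherwise the end is the head and gets
local number `0`. -/
theorem wp_storeEdges {T : Subroutine} {s : State} {D : Layout} (he : s.reg 2 = D.e)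
    (h12 : s.arr 12 = D.rep) (h13 : s.arr 13 = D.vp) (h14 : s.arr 14 = D.vc)
    (h15 : s.arr 15 = D.ep) (h17 : s.arr 17 = D.off)
    (h8 : ∀ j < D.e, s.arr 8 j = D.U j) (h9 : ∀ j < D.e, s.arr 9 j = D.W j)
    (h22 : ∀ j < D.e, D.rep (s.arr 22 j) = D.key j)
    (hUW : ∀ j < D.e, D.rep (D.U j) ≤ D.key j ∧ D.rep (D.W j) ≤ D.key j)
    (N : D.Numbered) (S : D.Separated) {M : ℕ → ℕ} (H : D.Stored M D.n 0 (s.arr 19)) :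
    WP T storeEdges s fun s' t => t ≤ 100 * D.e + 6 ∧ D.Stored M D.n D.e (s'.arr 19) ∧
      Frame storeEdges s s' := by
  refine (WP.for (n := D.e) 92 (I := fun k s' => D.Stored M D.n k (s'.arr 19))
    he (by decide) (by decide) (by decide) H ?_)
  rintro k s1 hk hx hF hI
  have e8 : s1.arr 8 = s.arr 8 := hF.1 8 (by decide)
  have e9 : s1.arr 9 = s.arr 9 := hF.1 9 (by decide)
  have e22 : s1.arr 22 = s.arr 22 := hF.1 22 (by decide)
  have e12 : s1.arr 12 = D.rep := by rw [hF.1 12 (by decide), h12]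
  have e13 : s1.arr 13 = D.vp := by rw [hF.1 13 (by decide), h13]
  have e14 : s1.arr 14 = D.vc := by rw [hF.1 14 (by decide), h14]
  have e15 : s1.arr 15 = D.ep := by rw [hF.1 15 (by decide), h15]
  have e17 : s1.arr 17 = D.off := by rw [hF.1 17 (by decide), h17]
  have hst := hI.write_edge N S le_rfl hk
  obtain ⟨hU, hW⟩ := hUW k hk
  have ea : D.off (D.key k) + D.vc (D.key k) + 3 + (D.ep k + D.ep k) = D.eaddr k := rfl
  by_cases hu : D.rep (D.U k) = D.key k <;> by_cases hw : D.rep (D.W k) = D.key k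
  all_goals
    simp only [Layout.loc, hu, hw, if_true, if_false] at hst
    have hu' : D.key k - D.rep (D.U k) = 0 ↔ D.rep (D.U k) = D.key k := by omega
    have hw' : D.key k - D.rep (D.W k) = 0 ↔ D.rep (D.W k) = D.key k := by omega
    simp only [wp_seq, wp_assign, wp_cond, wp_write, Expr.eval, Expr.cost, setReg_reg,
      setReg_arr, setArr_reg, setArr_arr]
    simp [hx, e8, e9, e22, e12, e13, e14, e15, e17, h8 k hk, h9 k hk, h22 k hk, ea, hu', hw',
      hu, hw, hst]

end Storage

end KModal

namespace KModal

/-! ### Encoded instances as lists indexed by position. -/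

section Encodings

theorem flatMap_pair_eq (u w : ℕ → ℕ) (e : ℕ) :
    (List.range e).flatMap (fun j => [u j, w j]) =
      (List.range (2 * e)).map fun i => if i % 2 = 0 then u (i / 2) else w (i / 2) := by
  induction e with
  | zero => rfl
  | succ e ih =>
    rw [List.range_succ, List.flatMap_append, ih, Nat.mul_succ, List.range_succ, List.range_succ]
    have h1 : 2 * e % 2 = 0 := by omega
    have h2 : (2 * e + 1) % 2 ≠ 0 := by omega
    have h3 : 2 * e / 2 = e := by omega
    have h4 : (2 * e + 1) / 2 = e := by omega
    simp [h3, h4]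

/-- The entries of an encoded instance. -/
def entry (n e : ℕ) (a u w : ℕ → ℕ) (i : ℕ) : ℕ :=
  if i = 0 then n else if i = 1 then e else if i < 2 + n then a (i - 2)
  else if (i - (2 + n)) % 2 = 0 then u ((i - (2 + n)) / 2) else w ((i - (2 + n)) / 2)

/-- With a formula for the entry at each position, lists in memory and encodings are compared cell
by cell. -/
theorem encoding_eq (n e : ℕ) (a u w : ℕ → ℕ) :
    [n, e] ++ (List.range n).map a ++ (List.range e).flatMap (fun j => [u j, w j]) =
      (List.range (2 + n + 2 * e)).map (entry n e a u w) := by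
  rw [flatMap_pair_eq, List.range_add, List.range_add, List.map_append, List.map_append]
  congr 1
  · congr 1
    rw [List.map_map]
    refine List.map_congr_left fun i hi => ?_
    have := List.mem_range.1 hi
    simp only [Function.comp_apply, entry]
    rw [if_neg (c := 2 + i = 0) (by omega), if_neg (c := 2 + i = 1) (by omega),
      if_pos (c := 2 + i < 2 + n) (by omega), Nat.add_sub_cancel_left]
  · rw [List.map_map]
    refine List.map_congr_left fun i _ => ?_
    simp only [Function.comp_apply, entry]
    rw [if_neg (c := 2 + n + i = 0) (by omega), if_neg (c := 2 + n + i = 1) (by omega),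
      if_neg (c := 2 + n + i < 2 + n) (by omega), Nat.add_sub_cancel_left]

theorem finRange_flatMap {k : ℕ} {α : Type} (h : Fin k → List α) (h' : ℕ → List α)
    (hh : ∀ i : Fin k, h i = h' i) : (List.finRange k).flatMap h = (List.range k).flatMap h' := by
  rw [← List.map_coe_finRange_eq_range, List.flatMap_map]
  exact congrArg (List.flatMap · (List.finRange k)) (funext hh)

theorem ofFn_eq_map_range {k : ℕ} {α : Type} (h : Fin k → α) (h' : ℕ → α)
    (hh : ∀ i : Fin k, h i = h' i) : List.ofFn h = (List.range k).map h' := by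
  rw [← List.map_coe_finRange_eq_range, List.ofFn_eq_map, List.map_map]
  exact congrArg (List.map · (List.finRange k)) (funext hh)

variable {V : Type}

/-- What can be read from an encoded instance. -/
theorem Encodes.exists_getD {G : Digraph V} {m : V → ℕ} {L : List ℕ} (h : Encodes G m L) :
    ∃ (n e : ℕ) (f : Fin n ≃ V) (u w : Fin e → Fin n),
      Nat.card V = n ∧ Nat.card (Edge G) = e ∧ L.getD 0 0 = n ∧ L.getD 1 0 = e ∧
      (∀ i : Fin n, L.getD (2 + i) 0 = m (f i)) ∧
      (∀ j : Fin e, L.getD (2 + n + (j + j)) 0 = u j ∧ L.getD (3 + n + (j + j)) 0 = w j) ∧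
      (∀ x y, G.Adj (f x) (f y) ↔ ∃ j, u j = x ∧ w j = y) ∧
      ∀ i j, u i = u j → w i = w j → i = j := by
  classical
  obtain ⟨n, f, E, hnd, hmem, rfl⟩ := h
  let u : Fin E.length → Fin n := fun j => f.symm E[j].1
  let w : Fin E.length → Fin n := fun j => f.symm E[j].2
  let a' : ℕ → ℕ := fun i => if h : i < n then m (f ⟨i, h⟩) else 0
  let u' : ℕ → ℕ := fun i => if h : i < E.length then u ⟨i, h⟩ else 0
  let w' : ℕ → ℕ := fun i => if h : i < E.length then w ⟨i, h⟩ else 0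
  have hL : [n, E.length] ++ List.ofFn (fun i => m (f i)) ++
      E.flatMap (fun p => [(f.symm p.1 : ℕ), (f.symm p.2 : ℕ)]) =
      (List.range (2 + n + 2 * E.length)).map (entry n E.length a' u' w') := by
    rw [← encoding_eq, ofFn_eq_map_range (fun i => m (f i)) a' (fun i => by simp [a'])]
    congr 1
    conv_lhs => rw [← List.ofFn_getElem (xs := E), List.ofFn_eq_map, List.flatMap_map]
    exact finRange_flatMap _ _ fun i => by simp [u', w', u, w]
  rw [hL]
  have hget : ∀ i, i < 2 + n + 2 * E.length →
      ((List.range (2 + n + 2 * E.length)).map (entry n E.length a' u' w')).getD i 0 =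
        entry n E.length a' u' w' i := fun i hi => by
    rw [List.getD_eq_getElem _ _ (by simpa using hi)]
    simp
  refine ⟨n, E.length, f, u, w, ?_, ?_, ?_, ?_, fun i => ?_, fun j => ⟨?_, ?_⟩, fun x y => ?_,
    fun i j hu hw => ?_⟩
  · rw [Nat.card_congr f.symm, Nat.card_fin]
  · have he : Edge G ≃ Fin E.length :=
      ((List.Nodup.getEquiv E hnd).trans (Equiv.subtypeEquivRight fun p => hmem p)).symm
    rw [Nat.card_congr he, Nat.card_fin]
  · rw [hget 0 (by omega)]
    rfl
  · rw [hget 1 (by omega)]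
    rfl
  · have := i.2
    rw [hget _ (by omega), entry, if_neg (by omega), if_neg (by omega), if_pos (by omega)]
    simp [a']
  · have := j.2
    rw [hget _ (by omega), entry, if_neg (by omega), if_neg (by omega), if_neg (by omega),
      if_pos (by omega), show (2 + n + (j + j) - (2 + n)) / 2 = (j : ℕ) by omega]
    simp [u']
  · have := j.2
    rw [hget _ (by omega), entry, if_neg (by omega), if_neg (by omega), if_neg (by omega),
      if_neg (by omega), show (3 + n + (j + j) - (2 + n)) / 2 = (j : ℕ) by omega]
    simp [w']
  · rw [← hmem (f x, f y), List.mem_iff_getElem]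
    constructor
    · rintro ⟨j, hj, h⟩
      exact ⟨⟨j, hj⟩, by simp [u, h], by simp [w, h]⟩
    · rintro ⟨j, h1, h2⟩
      exact ⟨j, j.2, Prod.ext (by simp [← h1, u]) (by simp [← h2, w])⟩
  · have h1 : E[i] = E[j] := Prod.ext (f.symm.injective hu) (f.symm.injective hw)
    exact Fin.ext ((hnd.getElem_inj_iff).1 h1)

/-- A stored list of numbers is an encoding. -/
theorem encodes_stored {s : State} {a o : ℕ} {G : Digraph V} {m : V → ℕ} {n e : ℕ}
    (hn : s.arr a o = n) (he : s.arr a (o + 1) = e) (f : Fin n ≃ V)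
    (hm : ∀ i : Fin n, s.arr a (o + (2 + i)) = m (f i)) (u w : Fin e → Fin n)
    (hu : ∀ j : Fin e, s.arr a (o + (2 + n + 2 * j)) = u j)
    (hw : ∀ j : Fin e, s.arr a (o + (2 + n + 2 * j + 1)) = w j)
    (hadj : ∀ x y, G.Adj (f x) (f y) ↔ ∃ j, u j = x ∧ w j = y)
    (hinj : ∀ i j, u i = u j → w i = w j → i = j) : Encodes G m (s.stored a o) := by
  refine ⟨n, f, List.ofFn fun j => (f (u j), f (w j)), ?_, ?_, ?_⟩
  · refine List.nodup_ofFn.2 fun i j h => ?_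
    have h' := Prod.ext_iff.1 h
    exact hinj i j (f.injective h'.1) (f.injective h'.2)
  · rintro ⟨x, y⟩
    obtain ⟨x, rfl⟩ := f.surjective x
    obtain ⟨y, rfl⟩ := f.surjective y
    rw [hadj, List.mem_ofFn]
    simp
  · rw [State.stored, hn, he, List.length_ofFn]
    rw [ofFn_eq_map_range (fun i => m (f i)) (fun i => s.arr a (o + (2 + i)))
      (fun i => (hm i).symm), List.ofFn_eq_map (n := e), List.flatMap_map,
      finRange_flatMap (k := e) _ (fun j => [s.arr a (o + (2 + n + 2 * j)),
        s.arr a (o + (2 + n + 2 * j + 1))]) (fun j => by simp [hu, hw]), encoding_eq,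
      ofFn_eq_map_range _ (fun i => s.arr a (o + i)) (fun _ => rfl)]
    refine List.map_congr_left fun i _ => ?_
    unfold entry
    split_ifs with h1 h2 h3 h4
    · rw [h1, Nat.add_zero, hn]
    · rw [h2, he]
    · congr 2
      omega
    · congr 2
      omega
    · congr 2
      omega

end Encodings

end KModal

namespace KModal

/-! ### The stored records encode the blocks. -/

section StoredBlocks

variable {V : Type}

/-- The layout `D` describes the blocks of `G`, whose vertices are numbered by a depth-first
search. -/
structure Decomposed (G : Digraph V) (D : Layout) (P : ℕ → ℕ) (f : ℕ → V) : Prop where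
  order : DfsOrder G D.n f P
  isRep : IsRep G D.n f P D.rep
  numbered : D.Numbered
  separated : D.Separated
  ends : ∀ j < D.e, D.U j < D.n ∧ D.W j < D.n
  key_eq : ∀ j < D.e, D.key j = D.rep (max (D.U j) (D.W j))
  adj : ∀ x < D.n, ∀ y < D.n, G.Adj (f x) (f y) ↔ ∃ j < D.e, D.U j = x ∧ D.W j = y
  inj : ∀ i < D.e, ∀ j < D.e, D.U i = D.U j → D.W i = D.W j → i = j

namespace Decomposed

variable {G : Digraph V} {D : Layout} {P : ℕ → ℕ} {f : ℕ → V}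

theorem le_of_rep_eq (X : Decomposed G D P f) {b i : ℕ} (hi : i < D.n) (h : D.rep i = b) :
    b ≤ i := h ▸ X.numbered.rep_le i hi

theorem isTop_iff (X : Decomposed G D P f) {b : ℕ} (h0 : 0 < b) (hb : b < D.n) :
    IsTop G D.n f P b ↔ D.rep b = b :=
  ⟨X.isRep.top b, fun h => h ▸ (X.order.isTop_rep X.isRep h0 hb).1⟩

theorem rep_parent_ne (X : Decomposed G D P f) {b : ℕ} (hb : IsTop G D.n f P b) :
    D.rep (P b) ≠ b := by
  have hlt := X.order.isParent.lt b hb.1 hb.2.1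
  have := X.numbered.rep_le (P b) (hlt.trans hb.2.1)
  omega

theorem loc_injOn (X : Decomposed G D P f) {b x y : ℕ} (hx : x < D.n) (hy : y < D.n)
    (hbx : x = P b ∨ D.rep x = b) (hby : y = P b ∨ D.rep y = b)
    (h : D.loc b x = D.loc b y) : x = y := by
  unfold Layout.loc at h
  split_ifs at h with h1 h2
  · exact X.numbered.verts.inj x hx y hy (h1.trans h2.symm) (by omega)
  · rw [hbx.resolve_right h1, hby.resolve_right (by assumption)]

theorem exists_loc_eq (X : Decomposed G D P f) {b l : ℕ} (hb : IsTop G D.n f P b)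
    (hl : l < D.vc b + 1) : ∃ x < D.n, D.loc b x = l ∧ (x = P b ∨ D.rep x = b) := by
  rcases Nat.eq_zero_or_pos l with rfl | h0
  · exact ⟨P b, (X.order.isParent.lt b hb.1 hb.2.1).trans hb.2.1,
      if_neg (X.rep_parent_ne hb), Or.inl rfl⟩
  · obtain ⟨x, hx, h1, h2⟩ := X.numbered.verts.surj b (l - 1) (by omega)
    refine ⟨x, hx, ?_, Or.inr h1⟩
    rw [Layout.loc, if_pos h1]
    omega

theorem loc_lt (X : Decomposed G D P f) {b x : ℕ} (hx : x < D.n) : D.loc b x < D.vc b + 1 := by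
  unfold Layout.loc
  split_ifs with h
  · have := X.numbered.verts.lt x hx
    rw [h] at this
    omega
  · omega

theorem joined (X : Decomposed G D P f) {j : ℕ} (hj : j < D.e) :
    Joined G (f (D.U j)) (f (D.W j)) :=
  Or.inl ((X.adj _ (X.ends j hj).1 _ (X.ends j hj).2).2 ⟨j, hj, rfl, rfl⟩)

theorem ends_ne (X : Decomposed G D P f) (hG : Loopless G) {j : ℕ} (hj : j < D.e) :
    D.U j ≠ D.W j := fun h => by
  have := (X.adj _ (X.ends j hj).1 _ (X.ends j hj).2).2 ⟨j, hj, rfl, rfl⟩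
  rw [h] at this
  exact hG _ this

theorem ends_mem (X : Decomposed G D P f) (hG : Loopless G) {j : ℕ} (hj : j < D.e) :
    (D.U j = P (D.key j) ∨ D.rep (D.U j) = D.key j) ∧
      (D.W j = P (D.key j) ∨ D.rep (D.W j) = D.key j) := by
  obtain ⟨hU, hW⟩ := X.ends j hj
  rw [X.key_eq j hj]
  rcases lt_or_gt_of_ne (X.ends_ne hG hj) with h | h
  · rw [max_eq_right h.le]
    exact ⟨X.order.mem_block_of_joined X.isRep hW h (X.joined hj), Or.inr rfl⟩
  · rw [max_eq_left h.le]
    exact ⟨Or.inr rfl, X.order.mem_block_of_joined X.isRep hU h (X.joined hj).symm⟩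

/-- The larger end of such an edge cannot be the head, because the other vertices of the block are
numbered at least `b`, above `P b`. So it is represented by `b`. -/
theorem key_of_mem (X : Decomposed G D P f) (hG : Loopless G) {b j : ℕ}
    (hb : IsTop G D.n f P b) (hj : j < D.e)
    (hU : D.U j = P b ∨ D.rep (D.U j) = b) (hW : D.W j = P b ∨ D.rep (D.W j) = b) :
    D.key j = b := by
  have hlt := X.order.isParent.lt b hb.1 hb.2.1
  have hne := X.ends_ne hG hj
  obtain ⟨hUn, hWn⟩ := X.ends j hj
  have h1 := fun h => X.le_of_rep_eq hUn (b := b) h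
  have h2 := fun h => X.le_of_rep_eq hWn (b := b) h
  rw [X.key_eq j hj]
  rcases lt_or_gt_of_ne hne with h | h
  · rw [max_eq_right h.le]
    refine hW.resolve_left fun h' => ?_
    rcases hU with hU | hU
    · omega
    · have := h1 hU
      omega
  · rw [max_eq_left h.le]
    refine hU.resolve_left fun h' => ?_
    rcases hW with hW | hW
    · omega
    · have := h2 hW
      omega

/-- The required numbering of the vertices is the inverse of `loc b`. The edges of the induced
subgraph are precisely those with key `b`, and `ep` enumerates them without repetition. -/
theorem encodes_block [Fintype V] (X : Decomposed G D P f) (hG : Loopless G) {b : ℕ}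
    (hb : IsTop G D.n f P b) {M : ℕ → ℕ} {s : State} {a : ℕ} (H : D.Stored M D.n D.e (s.arr a))
    {m : V → ℕ} (hm : ∀ i < D.n, D.rep i = b → m (f i) = M i)
    (hh : m (f (P b)) = s.arr a (D.off b + 2)) :
    Encodes (induce G (blockOf D.n f P D.rep b)) (fun v => m v) (s.stored a (D.off b)) := by
  have hbb := X.isRep.top b hb
  have hmem := fun {i} (hi : i < D.n) => X.order.mem_blockOf (rep := D.rep) (b := b) hi
  choose x hxn hxl hxb using fun l : Fin (D.vc b + 1) => X.exists_loc_eq hb l.2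
  choose j hjn hjb hjl using fun l : Fin (D.ec b) => X.numbered.edges.surj b l l.2
  have hx_eq : ∀ (l : Fin (D.vc b + 1)) (y : ℕ), y < D.n → (y = P b ∨ D.rep y = b) →
      D.loc b y = l → x l = y := fun l y hy hyb hl =>
    X.loc_injOn (hxn l) hy (hxb l) hyb ((hxl l).trans hl.symm)
  have hends : ∀ l, (D.U (j l) = P b ∨ D.rep (D.U (j l)) = b) ∧
      (D.W (j l) = P b ∨ D.rep (D.W (j l)) = b) := fun l => by
    have := X.ends_mem hG (hjn l)
    rwa [hjb l] at this
  let g : Fin (D.vc b + 1) → blockOf D.n f P D.rep b := fun l =>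
    ⟨f (x l), (hmem (hxn l)).2 (hxb l)⟩
  have hg : Function.Bijective g := by
    constructor
    · intro l l' h
      have h1 := X.order.inj _ (hxn l) _ (hxn l') (Subtype.ext_iff.1 h)
      rw [Fin.ext_iff, ← hxl l, ← hxl l', h1]
    · rintro ⟨v, hv⟩
      obtain ⟨i, hi, rfl⟩ := X.order.surj v
      exact ⟨⟨D.loc b i, X.loc_lt hi⟩, Subtype.ext
        (congrArg f (hx_eq _ i hi ((hmem hi).1 hv) rfl))⟩
  obtain ⟨hs1, hs2⟩ := H.sizes b hb.2.1 hbb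
  refine encodes_stored hs1 hs2 (Equiv.ofBijective g hg) ?_
    (fun l => ⟨D.loc b (D.U (j l)), X.loc_lt (X.ends _ (hjn l)).1⟩)
    (fun l => ⟨D.loc b (D.W (j l)), X.loc_lt (X.ends _ (hjn l)).2⟩) ?_ ?_ ?_ ?_
  · intro l
    change _ = m (f (x l))
    rcases Nat.eq_zero_or_pos (l : ℕ) with h0 | h0
    · rw [h0, hx_eq l (P b) ((X.order.isParent.lt b hb.1 hb.2.1).trans hb.2.1) (Or.inl rfl)
        (by rw [h0, Layout.loc, if_neg (X.rep_parent_ne hb)]), hh]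
    · have hl := hxl l
      have hr : D.rep (x l) = b := by
        by_contra h
        rw [Layout.loc, if_neg h] at hl
        omega
      rw [Layout.loc, if_pos hr] at hl
      rw [hm _ (hxn l) hr, ← H.vert _ (hxn l), Layout.vaddr, hr]
      congr 1
      omega
  · intro l
    have h := (H.edge (j l) (hjn l)).1
    rw [hjb] at h
    simp only
    rw [← h, Layout.eaddr, hjb, hjl]
    congr 1
    omega
  · intro l
    have h := (H.edge (j l) (hjn l)).2
    rw [hjb] at h
    simp only
    rw [← h, Layout.eaddr, hjb, hjl]
    congr 1
    omega
  · intro y z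
    change G.Adj (f (x y)) (f (x z)) ↔ _
    rw [X.adj _ (hxn y) _ (hxn z)]
    constructor
    · rintro ⟨i, hi, h1, h2⟩
      have hk := X.key_of_mem hG hb hi (h1 ▸ hxb y) (h2 ▸ hxb z)
      have hlt := X.numbered.edges.lt i hi
      rw [hk] at hlt
      have hji : j ⟨D.ep i, hlt⟩ = i := X.numbered.edges.inj _ (hjn _) i hi
        ((hjb _).trans hk.symm) (hjl _)
      refine ⟨⟨D.ep i, hlt⟩, Fin.ext ?_, Fin.ext ?_⟩
      · simp only [hji, h1, hxl]
      · simp only [hji, h2, hxl]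
    · rintro ⟨l, h1, h2⟩
      exact ⟨j l, hjn l, (hx_eq y _ (X.ends _ (hjn l)).1 (hends l).1 (Fin.ext_iff.1 h1)).symm,
        (hx_eq z _ (X.ends _ (hjn l)).2 (hends l).2 (Fin.ext_iff.1 h2)).symm⟩
  · intro l l' h1 h2
    have hU := X.loc_injOn (X.ends _ (hjn l)).1 (X.ends _ (hjn l')).1 (hends l).1 (hends l').1
      (Fin.ext_iff.1 h1)
    have hW := X.loc_injOn (X.ends _ (hjn l)).2 (X.ends _ (hjn l')).2 (hends l).2 (hends l').2
      (Fin.ext_iff.1 h2)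
    have := X.inj _ (hjn l) _ (hjn l') hU hW
    rw [Fin.ext_iff, ← hjl l, ← hjl l', this]

end Decomposed

end StoredBlocks

end KModal

namespace KModal

/-! ### Testing one block and minimizing the value at its head. -/

section Bisection

def bisect : Prog := .loop (𝔯 11 ⊖ 𝔯 10)
  (.assign 12 (.half (𝔯 10 ⊹ 𝔯 11)) ;;
   .write 19 (𝔯 6) (𝔯 12 ⊹ 𝔯 12) ;;
   .call 9 19 (.read 17 (𝔯 5)) ;;
   .cond (𝔯 9) (.assign 11 (𝔯 12)) (.assign 10 (𝔯 12 ⊹ 𝔠 1)))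

/-- Tests the block with top `b`, which is in register `5`, and finds the smallest modality that the
head of the block can have. The budget of the head is reduced accordingly. -/
def processBlock : Prog :=
  .assign 6 (.read 17 (𝔯 5) ⊹ 𝔠 2) ;;
  .assign 7 (.read 18 (.read 7 (𝔯 5))) ;;
  .assign 8 (.read 19 (𝔯 7)) ;;
  .write 19 (𝔯 6) (𝔯 8) ;;
  .call 9 19 (.read 17 (𝔯 5)) ;;
  .cond (𝔯 9)
    (.assign 10 (𝔠 1) ;;
     .assign 11 (.half (𝔯 8)) ;;
     .cond (𝔯 5 ⊖ 𝔠 1) .skip (.assign 10 (𝔯 11)) ;;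
     bisect ;;
     .cond (𝔯 8) (.write 19 (𝔯 7) (𝔯 8 ⊹ 𝔠 2 ⊖ (𝔯 11 ⊹ 𝔯 11))) .skip)
    (.assign 0 (𝔠 0))

/-- What the calls of the subroutine for the block with top `b` and head value `h` do: they decide
`F h`, and take at most `R` steps if `RT R`. -/
def CallSpec (T : Subroutine) (D : Layout) (M : ℕ → ℕ) (b p : ℕ) (F : ℕ → Prop) (RT : ℕ → Prop) :
    Prop :=
  ∀ s : State, D.Stored M D.n D.e (s.arr 19) → Even (s.arr 19 (D.off b + 2)) →
    s.arr 19 (D.off b + 2) ≤ M p → (b = 1 → s.arr 19 (D.off b + 2) = M p) →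
    (T.answer (s.stored 19 (D.off b)) = true ↔ F (s.arr 19 (D.off b + 2))) ∧
      ∀ R, RT R → T.time (s.stored 19 (D.off b)) ≤ R

/-- The binary length of the search interval is the fuel of the bisection and bounds the number of
calls. -/
theorem size_half_lt {d d' : ℕ} (hd : d ≠ 0) (h : d' ≤ d / 2) : Nat.size d' < Nat.size d := by
  obtain ⟨k, hk⟩ : ∃ k, Nat.size d = k + 1 :=
    ⟨_, (Nat.succ_pred (fun h => hd (Nat.size_eq_zero.1 h))).symm⟩
  rw [hk, Nat.lt_succ_iff, Nat.size_le]
  have := Nat.size_le.1 hk.le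
  rw [pow_succ] at this
  omega

/-- The registers `10` and `11` bound half of the value, since all values are even. `F` holds at the
upper bound, and fails just below the lower bound unless that is `1`. `F` need not be monotone: it
is only needed that the final value works and the next smaller one does not. -/
theorem wp_bisect {T : Subroutine} {s : State} {D : Layout} (N : D.Numbered) (S : D.Separated)
    {M : ℕ → ℕ} {b p : ℕ} {F RT : ℕ → Prop} (hb : b < D.n) (hbb : D.rep b = b)
    (hT : CallSpec T D M b p F RT) (h17 : s.arr 17 = D.off) (h5 : s.reg 5 = b)
    (h6 : s.reg 6 = D.off b + 2) (H : D.Stored M D.n D.e (s.arr 19))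
    (h10' : s.reg 10 < s.reg 11 → b ≠ 1 ∧ s.reg 10 = 1) (h11 : 2 * s.reg 11 ≤ M p)
    (hF : F (2 * s.reg 11)) :
    WP T bisect s fun s' t => (∀ R, RT R → t ≤ Nat.size (s.reg 11 - s.reg 10) * (R + 50) + 4) ∧
      D.Stored M D.n D.e (s'.arr 19) ∧ 2 * s'.reg 11 ≤ M p ∧ F (2 * s'.reg 11) ∧
      (s.reg 11 ≤ s.reg 10 → s'.reg 11 = s.reg 11) ∧
      (s.reg 10 < s.reg 11 → 0 < s'.reg 11 ∧ (s'.reg 11 = 1 ∨ ¬ F (2 * s'.reg 11 - 2))) := by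
  refine (WP.loop (k := Nat.size (s.reg 11 - s.reg 10)) (I := fun k s' t =>
    k = Nat.size (s'.reg 11 - s'.reg 10) ∧ (s'.arr 17 = D.off ∧ s'.reg 5 = b ∧
      s'.reg 6 = D.off b + 2) ∧ D.Stored M D.n D.e (s'.arr 19) ∧ 2 * s'.reg 11 ≤ M p ∧
      F (2 * s'.reg 11) ∧ (s.reg 11 ≤ s.reg 10 → s'.reg 11 = s.reg 11 ∧ s'.reg 10 = s.reg 10) ∧
      (s.reg 10 < s.reg 11 → 0 < s'.reg 10 ∧ s'.reg 10 ≤ s'.reg 11 ∧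
        (s'.reg 10 = 1 ∨ ¬ F (2 * s'.reg 10 - 2))) ∧
      ∀ R, RT R → t + k * (R + 50) ≤ Nat.size (s.reg 11 - s.reg 10) * (R + 50)) ?_ ?_).mono ?_
  · exact ⟨rfl, ⟨h17, h5, h6⟩, H, h11, hF, fun _ => ⟨rfl, rfl⟩,
      fun h => ⟨by have := (h10' h).2; omega, h.le, Or.inl (h10' h).2⟩, fun R _ => by omega⟩
  · rintro k s1 t ⟨rfl, ⟨e17, e5, e6⟩, H1, h1, hF1, h2, h3, ht⟩ hc
    simp only [Expr.eval] at hc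
    have hlt : s.reg 10 < s.reg 11 := by
      by_contra h
      obtain ⟨h4, h5⟩ := h2 (by omega)
      omega
    obtain ⟨h4, h5', h6'⟩ := h3 hlt
    have hb1 := (h10' hlt).1
    set mid := (s1.reg 10 + s1.reg 11) / 2 with hmid
    have hw := H1.write_head N S hb hbb le_rfl le_rfl (v := mid + mid)
    simp only [wp_seq, wp_assign, wp_cond, wp_write, wp_call, Expr.eval, Expr.cost, setReg_reg,
      setReg_arr, setArr_reg, setArr_arr]
    simp [e17, e5, e6, ← hmid, -Order.lt_add_one_iff]
    set s2 := (((s1.setReg 12 mid).setArr 19 (D.off b + 2) (mid + mid))) with hs2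
    have e19 : s2.arr 19 = Function.update (s1.arr 19) (D.off b + 2) (mid + mid) := by simp [hs2]
    have e19' : s2.arr 19 (D.off b + 2) = 2 * mid := by rw [e19, Function.update_self, two_mul]
    obtain ⟨ha, htime⟩ := hT s2 (by rwa [e19]) (by rw [e19']; exact even_two_mul mid)
      (by rw [e19']; omega) (fun h => absurd h hb1)
    rw [e19'] at ha
    -- Each iteration pays for one call, `R`, and at most `50` further steps with one unit of binary
    -- length.
    have step : ∀ d' τ, d' ≤ (s1.reg 11 - s1.reg 10) / 2 →
        (∀ R, RT R → τ ≤ R + 50) → ∀ R, RT R → t + τ + Nat.size d' * (R + 50) ≤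
          Nat.size (s.reg 11 - s.reg 10) * (R + 50) := by
      intro d' τ hd hτ R hR
      have h7 := size_half_lt hc hd
      have h8 := ht R hR
      have h9 := hτ R hR
      have h10 : (Nat.size d' + 1) * (R + 50) ≤
        Nat.size (s1.reg 11 - s1.reg 10) * (R + 50) := Nat.mul_le_mul_right _ h7
      rw [Nat.add_mul] at h10
      omega
    constructor
    · intro hans
      refine ⟨size_half_lt hc (d' := mid - s1.reg 10) (by omega), hw, by omega,
        ha.1 hans, fun h => by omega, fun _ => ⟨h4, by omega, h6'⟩, ?_⟩
      exact step _ _ (by omega) fun R hR => (by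
        have := htime R hR
        omega)
    · intro hans
      have hans' : ¬ F (2 * mid) := fun h => by simp [ha.2 h] at hans
      refine ⟨size_half_lt hc (d' := s1.reg 11 - (mid + 1)) (by omega), hw, h1,
        hF1, fun h => by omega, fun _ => ⟨by omega, Or.inr ?_⟩, ?_⟩
      · rwa [show 2 * (mid + 1) - 2 = 2 * mid by omega]
      exact step _ _ (by omega) fun R hR => (by
        have := htime R hR
        omega)
  · rintro s' t ⟨k, t', rfl, ⟨rfl, -, H1, h1, hF1, h2, h3, ht⟩, hc⟩
    simp only [Expr.eval, Expr.cost] at hc ⊢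
    refine ⟨fun R hR => ?_, H1, h1, hF1, fun h => (h2 h).1, fun h => ?_⟩
    · have := ht R hR
      omega
    · obtain ⟨h4, h5, h6⟩ := h3 h
      have : s'.reg 10 = s'.reg 11 := by omega
      rw [this] at h4 h6
      exact ⟨h4, h6⟩

/-- The first call offers the whole budget `M p` to the head and decides about rejection; it
accounts for the `+ 1`. A value `h` spends `h - 2`, which leaves `M p + 2 - h`, and a zero budget
stays zero. For `b = 1` the search interval is empty, so `h = M p`. -/
theorem wp_processBlock {T : Subroutine} {s : State} {D : Layout} (N : D.Numbered)
    (S : D.Separated) {M : ℕ → ℕ} {b p : ℕ} {F RT : ℕ → Prop} (hb0 : 0 < b) (hb : b < D.n)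
    (hbb : D.rep b = b) (hp : p < D.n) (hT : CallSpec T D M b p F RT) (h17 : s.arr 17 = D.off) (h5 : s.reg 5 = b)
    (h7 : s.arr 7 b = p) (h18 : s.arr 18 p = D.vaddr p) (H : D.Stored M D.n D.e (s.arr 19))
    (hM : Even (M p)) :
    WP T processBlock s fun s' t =>
      (∀ R, RT R → t ≤ (Nat.size (M p / 2 - 1) + 1) * (R + 50) + 100) ∧
      ((s'.reg 0 = 0 ∧ ¬ F (M p)) ∨ (s'.reg 0 = s.reg 0 ∧ ∃ h, F h ∧ Even h ∧ h ≤ M p ∧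
        (M p ≠ 0 → 2 ≤ h) ∧ (b ≠ 1 → h ≤ 2 ∨ ¬ F (h - 2)) ∧
        D.Stored (Function.update M p (if M p = 0 then 0 else M p + 2 - h)) D.n D.e
          (s'.arr 19))) := by
  have hp19 := H.vert p hp
  have hw := H.write_head N S hb hbb le_rfl le_rfl (v := M p)
  obtain ⟨q, hq⟩ := hM
  have hq2 : M p / 2 = q := by omega
  rw [processBlock]
  simp only [wp_seq, wp_assign, wp_cond, wp_write, wp_call, wp_skip, Expr.eval, Expr.cost, setReg_reg,
      setReg_arr, setArr_reg, setArr_arr]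
  simp [h17, h5, h7, h18, hp19, hq2]
  set s2 := ((((s.setReg 6 (D.off b + 2)).setReg 7 (D.vaddr p)).setReg 8 (M p)).setArr 19
    (D.off b + 2) (M p)) with hs2
  have e19 : s2.arr 19 = Function.update (s.arr 19) (D.off b + 2) (M p) := by simp [hs2]
  have e19' : s2.arr 19 (D.off b + 2) = M p := by rw [e19, Function.update_self]
  obtain ⟨ha, htime⟩ := hT s2 (by rwa [e19]) (by rw [e19', hq]; exact ⟨q, rfl⟩)
    (by rw [e19']) (fun h => e19')
  rw [e19'] at ha
  have hans1 : T.answer (s2.stored 19 (D.off b)) = true → F (2 * q) := fun h => by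
    rw [two_mul, ← hq]; exact ha.1 h
  -- Both initial lower bounds are treated at once: `q` for the last block, which makes the loop
  -- void, and `1` for the others.
  have core : ∀ s3 : State, s3.arr 17 = D.off → s3.reg 5 = b → s3.reg 6 = D.off b + 2 →
      s3.reg 0 = s.reg 0 → s3.reg 7 = D.vaddr p → s3.reg 8 = M p →
      D.Stored M D.n D.e (s3.arr 19) → s3.reg 11 = q → (s3.reg 10 = if b = 1 then q else 1) →
      F (2 * q) →
      WP T bisect s3 fun s' t => (∀ R, RT R → t ≤ Nat.size (q - 1) * (R + 50) + 4) ∧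
        s'.reg 0 = s.reg 0 ∧ s'.reg 7 = D.vaddr p ∧ s'.reg 8 = M p ∧
        D.Stored M D.n D.e (s'.arr 19) ∧ ∃ x, s'.reg 11 = x ∧ F (2 * x) ∧ 2 * x ≤ M p ∧
        (M p ≠ 0 → 0 < x) ∧ (b ≠ 1 → x ≤ 1 ∨ ¬ F (2 * x - 2)) := by
    intro s3 f17 f5 f6 f0 f7 f8 HS f11 f10 hF
    have hsize : Nat.size (s3.reg 11 - s3.reg 10) ≤ Nat.size (q - 1) := by
      refine Nat.size_le_size ?_
      rw [f11, f10]
      split_ifs <;> omega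
    refine (wp_bisect N S hb hbb hT f17 f5 f6 HS ?_ (by rw [f11]; omega)
      (by rwa [f11])).frame.mono ?_
    · rw [f11, f10]
      split_ifs with h
      · exact fun h => absurd h (lt_irrefl _)
      · exact fun _ => ⟨h, rfl⟩
    · rintro s' t ⟨⟨ht, h1, h2, h3, h4, h6⟩, hFr⟩
      refine ⟨fun R hR => (ht R hR).trans (Nat.add_le_add_right (Nat.mul_le_mul_right _ hsize) _),
        (hFr.2 0 (by decide)).trans f0, (hFr.2 7 (by decide)).trans f7,
        (hFr.2 8 (by decide)).trans f8, h1, _, rfl, h3, h2, ?_, ?_⟩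
      · intro hne
        rcases lt_or_ge (s3.reg 10) (s3.reg 11) with h | h
        · exact (h6 h).1
        · rw [h4 h, f11]
          omega
      · intro hb1
        rcases lt_or_ge (s3.reg 10) (s3.reg 11) with h | h
        · exact (h6 h).2.imp (fun h => h.le) id
        · left
          rw [f11, f10, if_neg hb1] at h
          rw [h4 (by rw [f11, f10, if_neg hb1]; exact h), f11]
          exact h
  have post : ∀ s' : State, s'.reg 7 = D.vaddr p → s'.reg 8 = M p →
      D.Stored M D.n D.e (s'.arr 19) → (∃ x, s'.reg 11 = x ∧ F (2 * x) ∧ 2 * x ≤ M p ∧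
        (M p ≠ 0 → 0 < x) ∧ (b ≠ 1 → x ≤ 1 ∨ ¬ F (2 * x - 2))) → ∀ A : ℕ → ℕ,
      (M p ≠ 0 → A = Function.update (s'.arr 19) (s'.reg 7)
        (s'.reg 8 + 2 - (s'.reg 11 + s'.reg 11))) → (M p = 0 → A = s'.arr 19) →
      ∃ h, F h ∧ Even h ∧ h ≤ M p ∧ (¬ M p = 0 → 2 ≤ h) ∧ (¬ b = 1 → h ≤ 2 ∨ ¬ F (h - 2)) ∧
        D.Stored (Function.update M p (if M p = 0 then 0 else M p + 2 - h)) D.n D.e A := by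
    rintro s' f7 f8 HS ⟨x, hx, h1, h2, h3, h4⟩ A hA hA0
    refine ⟨2 * x, h1, even_two_mul x, h2, fun h => by have := h3 h; omega,
      fun h => (h4 h).imp (fun h => by omega) id, ?_⟩
    split_ifs with h0
    · rw [hA0 h0]
      have : Function.update M p 0 = M := by rw [← h0, Function.update_eq_self]
      rwa [this]
    · rw [hA h0, f7, f8, hx, ← two_mul]
      exact HS.write_vert N S hp le_rfl le_rfl
        (fun y hy hyp => ⟨hy, Function.update_of_ne hyp _ _⟩) (Function.update_self _ _ _)
  have hb1 : b - 1 = 0 ↔ b = 1 := by omega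
  rw [hb1]
  refine ⟨fun hans => ⟨fun hb1 => ?_, fun hb1 => ?_⟩, fun hans => ?_⟩
  · refine (core _ (by simp [hs2, h17]) (by simp [hs2, h5]) (by simp [hs2]) (by simp [hs2])
      (by simp [hs2]) (by simp [hs2]) (by simpa [e19] using hw) (by simp) (by simp [hb1])
      (hans1 hans)).mono ?_
    rintro s' t ⟨ht, f0, f7, f8, HS, hx⟩
    refine ⟨fun h8 => ⟨fun R hR => ?_, Or.inr ⟨f0, post s' f7 f8 HS hx _ (fun _ => rfl)
      fun h => absurd (f8.trans h) h8⟩⟩, fun h8 => ⟨fun R hR => ?_, Or.inr ⟨f0,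
      post s' f7 f8 HS hx _ (fun h => absurd (f8.symm.trans h8) h) fun _ => rfl⟩⟩⟩
    all_goals
      have h1 := ht R hR
      have h2 := htime R hR
      rw [Nat.add_mul, one_mul]
      omega
  · refine (core _ (by simp [hs2, h17]) (by simp [hs2, h5]) (by simp [hs2]) (by simp [hs2])
      (by simp [hs2]) (by simp [hs2]) (by simpa [e19] using hw) (by simp) (by simp [hb1])
      (hans1 hans)).mono ?_
    rintro s' t ⟨ht, f0, f7, f8, HS, hx⟩
    refine ⟨fun h8 => ⟨fun R hR => ?_, Or.inr ⟨f0, post s' f7 f8 HS hx _ (fun _ => rfl)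
      fun h => absurd (f8.trans h) h8⟩⟩, fun h8 => ⟨fun R hR => ?_, Or.inr ⟨f0,
      post s' f7 f8 HS hx _ (fun h => absurd (f8.symm.trans h8) h) fun _ => rfl⟩⟩⟩
    all_goals
      have h1 := ht R hR
      have h2 := htime R hR
      rw [Nat.add_mul, one_mul]
      omega
  · refine ⟨fun R hR => ?_, Or.inl fun h => ?_⟩
    · have h2 := htime R hR
      rw [Nat.add_mul, one_mul]
      omega
    · rw [ha.2 h] at hans
      exact absurd hans (by simp)

end Bisection

end KModal

namespace KModal

/-! ### Correctness of the greedy choice. -/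

section Greedy

open Equiv

variable {V : Type} [Fintype V] {G : Digraph V} {n : ℕ} {f : ℕ → V} {P rep : ℕ → ℕ} {m : V → ℕ}

open Classical in
/-- The maximum-modality function with which the block with top `b` is tested: `h` at the head of
the block, and `μ` at its other vertices. -/
noncomputable def blockBudget (n : ℕ) (f : ℕ → V) (P rep : ℕ → ℕ) (m μ : V → ℕ) (b h : ℕ) (v : V) :
    ℕ :=
  if v = f (P b) then h else if v ∈ blockOf n f P rep b then μ v else m v

open Classical in
/-- Embeddings of the blocks that can be combined to an embedding of `G`. -/
structure IsSolution (G : Digraph V) (n : ℕ) (f : ℕ → V) (P rep : ℕ → ℕ) (m : V → ℕ)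
    (τ : ℕ → Perm (Dart G)) : Prop where
  embedding : ∀ b, IsTop G n f P b → SubEmbedding G (blockOf n f P rep b) (τ b)
  sum_le : ∀ v, ∑ b ∈ tops G n f P with v ∈ blockOf n f P rep b, (modality (τ b) v - 2) ≤ m v - 2
  monochromatic : ∀ v, m v = 0 → Monochromatic G v

open Classical in
/-- The situation after the blocks with top at least `c` have been processed: `hv b` is the value
chosen for the head of the block with top `b`, and `μ` is what is left of the budgets. -/
structure Greedy (G : Digraph V) (n : ℕ) (f : ℕ → V) (P rep : ℕ → ℕ) (m : V → ℕ) (c : ℕ)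
    (μ : V → ℕ) (hv : ℕ → ℕ) : Prop where
  even : ∀ v, Even (μ v)
  eq_zero_iff : ∀ v, μ v = 0 ↔ m v = 0
  budget : ∀ v, m v - 2 = μ v - 2 + ∑ b ∈ tops G n f P with c ≤ b ∧ f (P b) = v, (hv b - 2)
  feasible : ∀ b, IsTop G n f P b → c ≤ b →
    MaxModality (induce G (blockOf n f P rep b)) (fun v => blockBudget n f P rep m μ b (hv b) v)
  optimal : ∀ τ, IsSolution G n f P rep m τ → ∀ b, IsTop G n f P b → c ≤ b → b ≠ 1 →
    hv b - 2 ≤ modality (τ b) (f (P b)) - 2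

theorem maxModality_iff_exists_isSolution [Nontrivial V] (D : DfsOrder G n f P)
    (R : IsRep G n f P rep) (hG : Loopless G) (hc : SimplyConnected G) (hm : ∀ v, Even (m v)) :
    MaxModality G m ↔ ∃ τ, IsSolution G n f P rep m τ := by
  rw [(D.blockSequence R hG).maxModality_iff_exists hG hc hm]
  constructor
  · rintro ⟨h1, τ, h2, h3⟩
    exact ⟨τ, fun b hb => h2 b (mem_tops.2 hb), h3, h1⟩
  · rintro ⟨τ, h1, h2, h3⟩
    exact ⟨h3, τ, fun b hb => h1 b (mem_tops.1 hb), h2⟩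

theorem maxModality_blockOf_iff (D : DfsOrder G n f P) (R : IsRep G n f P rep) (hG : Loopless G)
    {b : ℕ} (hb : IsTop G n f P b) (m' : V → ℕ) :
    MaxModality (induce G (blockOf n f P rep b)) (fun v => m' v) ↔
      ∃ σ, SubEmbedding G (blockOf n f P rep b) σ ∧
        ∀ v ∈ blockOf n f P rep b, modality σ v ≤ m' v :=
  maxModality_induce_iff ((D.blockSequence R hG).nontrivial b (mem_tops.2 hb))
    ((D.blockSequence R hG).connOn b (mem_tops.2 hb)) m'

namespace Greedy

variable {c : ℕ} {μ : V → ℕ} {hv : ℕ → ℕ}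

theorem init (hm : ∀ v, Even (m v)) (hv : ℕ → ℕ) : Greedy G n f P rep m n m hv := by
  classical
  refine ⟨hm, fun _ => Iff.rfl, fun v => ?_, fun b hb h => absurd hb.2.1 (by omega),
    fun _ _ b hb h => absurd hb.2.1 (by omega)⟩
  rw [Finset.sum_eq_zero, Nat.add_zero]
  intro b hb
  simp only [Finset.mem_filter, mem_tops] at hb
  exact absurd hb.1.2.1 (by omega)

theorem skip (A : Greedy G n f P rep m (c + 1) μ hv) (hc : ¬ IsTop G n f P c) :
    Greedy G n f P rep m c μ hv := by
  classical
  have key : ∀ b, IsTop G n f P b → (c ≤ b ↔ c + 1 ≤ b) := fun b hb =>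
    ⟨fun h => Nat.lt_of_le_of_ne h fun h' => hc (h' ▸ hb), fun h => by omega⟩
  refine ⟨A.even, A.eq_zero_iff, fun v => ?_, fun b hb h => A.feasible b hb ((key b hb).1 h),
    fun τ hτ b hb h => A.optimal τ hτ b hb ((key b hb).1 h)⟩
  rw [A.budget v]
  congr 2
  ext b
  simp only [Finset.mem_filter, mem_tops]
  exact and_congr_right fun hb => by rw [key b hb]

theorem le (A : Greedy G n f P rep m c μ hv) (hm : ∀ v, Even (m v)) (v : V) : μ v ≤ m v := by
  have h1 := A.budget v
  have h2 := A.eq_zero_iff v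
  obtain ⟨q, hq⟩ := A.even v
  obtain ⟨r, hr⟩ := hm v
  omega

/-- Budget has been spent only at heads of blocks with top above `c`, hence different from `1`, and
these heads are cut-vertices. -/
theorem eq_of_not_isCutVertex (A : Greedy G n f P rep m (c + 1) μ hv) (D : DfsOrder G n f P)
    (hm : ∀ v, Even (m v)) (hc0 : 0 < c) {v : V} (hv' : ¬ IsCutVertex G v) : μ v = m v := by
  classical
  have h1 := A.budget v
  rw [Finset.sum_eq_zero] at h1
  · have h2 := A.eq_zero_iff v
    obtain ⟨q, hq⟩ := A.even v
    obtain ⟨r, hr⟩ := hm v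
    omega
  · intro b hb
    simp only [Finset.mem_filter, mem_tops] at hb
    exact absurd (hb.2.2 ▸ D.isCutVertex_head hb.1 (by omega)) hv'

/-- This brings every call within the range of functions `m'` that define the cost of a block. The
root may fail to be a cut-vertex, which is why `c = 1` permits only the full remaining budget. -/
theorem blockBudget_spec (A : Greedy G n f P rep m (c + 1) μ hv) (D : DfsOrder G n f P)
    (hm : ∀ v, Even (m v)) (hc : IsTop G n f P c) {h : ℕ} (hh : Even h) (hle : h ≤ μ (f (P c)))
    (h1 : c = 1 → h = μ (f (P c))) :
    (∀ v, Even (blockBudget n f P rep m μ c h v) ∧ blockBudget n f P rep m μ c h v ≤ m v) ∧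
      ∀ v, ¬ IsCutVertex G v → blockBudget n f P rep m μ c h v = m v := by
  unfold blockBudget
  constructor
  · intro v
    split_ifs with h2
    · rw [h2]
      exact ⟨hh, hle.trans (A.le hm _)⟩
    · exact ⟨A.even v, A.le hm v⟩
    · exact ⟨hm v, le_rfl⟩
  · intro v hv'
    split_ifs with h2
    · by_cases hc1 : c = 1
      · rw [h1 hc1, ← h2]
        exact A.eq_of_not_isCutVertex D hm hc.1 hv'
      · exact absurd (h2 ▸ D.isCutVertex_head hc hc1) hv'
    · exact A.eq_of_not_isCutVertex D hm hc.1 hv'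
    · rfl

/-- In any solution the processed blocks with head `v` spend at least what was deducted for them, by
optimality. So at most the remaining budget is left for the block with top `c`. -/
theorem modality_le (A : Greedy G n f P rep m (c + 1) μ hv) (D : DfsOrder G n f P)
    (hc : IsTop G n f P c) {τ : ℕ → Perm (Dart G)} (hτ : IsSolution G n f P rep m τ) {v : V}
    (hvc : v ∈ blockOf n f P rep c) : modality (τ c) v ≤ μ v := by
  classical
  have hsub : insert c ((tops G n f P).filter fun b => c + 1 ≤ b ∧ f (P b) = v) ⊆
      (tops G n f P).filter fun b => v ∈ blockOf n f P rep b := by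
    intro b hb
    simp only [Finset.mem_insert, Finset.mem_filter, mem_tops] at hb ⊢
    rcases hb with rfl | ⟨hb, -, rfl⟩
    · exact ⟨hc, hvc⟩
    · exact ⟨hb, (D.mem_blockOf ((D.isParent.lt b hb.1 hb.2.1).trans hb.2.1)).2 (Or.inl rfl)⟩
  have h1 := (Finset.sum_le_sum_of_subset (f := fun b => modality (τ b) v - 2) hsub).trans
    (hτ.sum_le v)
  rw [Finset.sum_insert (by simp)] at h1
  have h2 : ∑ b ∈ tops G n f P with c + 1 ≤ b ∧ f (P b) = v, (hv b - 2) ≤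
      ∑ b ∈ tops G n f P with c + 1 ≤ b ∧ f (P b) = v, (modality (τ b) v - 2) := by
    refine Finset.sum_le_sum fun b hb => ?_
    simp only [Finset.mem_filter, mem_tops] at hb
    have := hc.1
    have h3 := A.optimal τ hτ b hb.1 hb.2.1 (by omega)
    rwa [hb.2.2] at h3
  have h3 := A.budget v
  have h4 := A.eq_zero_iff v
  obtain ⟨q, hq⟩ := A.even v
  by_cases h0 : m v = 0
  · rw [(hτ.monochromatic v h0).modality_eq_zero fun d => (hτ.embedding c hc).vertex_apply d]
    exact Nat.zero_le _
  · have : μ v ≠ 0 := fun h => h0 (h4.1 h)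
    omega

theorem feasible_of_le (A : Greedy G n f P rep m (c + 1) μ hv) (D : DfsOrder G n f P)
    (R : IsRep G n f P rep) (hG : Loopless G) (hc : IsTop G n f P c) {τ : ℕ → Perm (Dart G)}
    (hτ : IsSolution G n f P rep m τ) {h : ℕ} (hh : modality (τ c) (f (P c)) ≤ h) :
    MaxModality (induce G (blockOf n f P rep c)) (fun v => blockBudget n f P rep m μ c h v) := by
  rw [maxModality_blockOf_iff D R hG hc]
  refine ⟨τ c, hτ.embedding c hc, fun v hvc => ?_⟩
  unfold blockBudget
  split_ifs with h1
  · rw [h1]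
    exact hh
  · exact A.modality_le D hc hτ hvc

theorem feasible_budget (A : Greedy G n f P rep m (c + 1) μ hv) (D : DfsOrder G n f P)
    (R : IsRep G n f P rep) (hG : Loopless G) (hc : IsTop G n f P c) {τ : ℕ → Perm (Dart G)}
    (hτ : IsSolution G n f P rep m τ) :
    MaxModality (induce G (blockOf n f P rep c))
      (fun v => blockBudget n f P rep m μ c (μ (f (P c))) v) :=
  A.feasible_of_le D R hG hc hτ (A.modality_le D hc hτ
    ((D.mem_blockOf ((D.isParent.lt c hc.1 hc.2.1).trans hc.2.1)).2 (Or.inl rfl)))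

-- The blocks processed before stay feasible: `P c < c` is represented by none of their tops, so it
-- occurs in them at most as the head, where the changed budget is not consulted. The new choice is
-- optimal because a solution with a smaller value at the head would make `h - 2` feasible;
-- modalities are even.
open Classical in
theorem step (A : Greedy G n f P rep m (c + 1) μ hv) (D : DfsOrder G n f P)
    (R : IsRep G n f P rep) (hG : Loopless G) (hc : IsTop G n f P c) {h : ℕ}
    (hF : MaxModality (induce G (blockOf n f P rep c))
      (fun v => blockBudget n f P rep m μ c h v)) (hh : Even h) (hle : h ≤ μ (f (P c)))
    (h2 : μ (f (P c)) ≠ 0 → 2 ≤ h)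
    (hopt : c ≠ 1 → h ≤ 2 ∨ ¬ MaxModality (induce G (blockOf n f P rep c))
      (fun v => blockBudget n f P rep m μ c (h - 2) v)) :
    Greedy G n f P rep m c (Function.update μ (f (P c))
      (if μ (f (P c)) = 0 then 0 else μ (f (P c)) + 2 - h)) (Function.update hv c h) := by
  have hlt := D.isParent.lt c hc.1 hc.2.1
  set μ' := Function.update μ (f (P c)) (if μ (f (P c)) = 0 then 0 else μ (f (P c)) + 2 - h)
    with hμ'
  have hself : μ' (f (P c)) = if μ (f (P c)) = 0 then 0 else μ (f (P c)) + 2 - h :=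
    Function.update_self _ _ _
  have hne : ∀ v, v ≠ f (P c) → μ' v = μ v := fun v hv => Function.update_of_ne hv _ _
  obtain ⟨q, hq⟩ := A.even (f (P c))
  obtain ⟨r, hr⟩ := hh
  refine ⟨fun v => ?_, fun v => ?_, fun v => ?_, fun b hb hcb => ?_, fun τ hτ b hb hcb hb1 => ?_⟩
  · by_cases hv' : v = f (P c)
    · rw [hv', hself]
      split_ifs with h0
      · exact ⟨0, rfl⟩
      · exact ⟨q + 1 - r, by omega⟩
    · rw [hne v hv']
      exact A.even v
  · rw [← A.eq_zero_iff v]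
    by_cases hv' : v = f (P c)
    · rw [hv', hself]
      split_ifs with h0
      · simp [h0]
      · omega
    · rw [hne v hv']
  · rw [A.budget v]
    by_cases hv' : v = f (P c)
    · have hins : ((tops G n f P).filter fun b => c ≤ b ∧ f (P b) = v) =
          insert c ((tops G n f P).filter fun b => c + 1 ≤ b ∧ f (P b) = v) := by
        ext b
        simp only [Finset.mem_insert, Finset.mem_filter, mem_tops]
        constructor
        · rintro ⟨h1, h2, h3⟩
          by_cases hbc : b = c
          · exact Or.inl hbc
          · exact Or.inr ⟨h1, by omega, h3⟩
        · rintro (rfl | ⟨h1, h2, h3⟩)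
          · exact ⟨hc, le_rfl, hv'.symm⟩
          · exact ⟨h1, by omega, h3⟩
      rw [hins, Finset.sum_insert (by simp), Function.update_self]
      have hs : ∑ b ∈ tops G n f P with c + 1 ≤ b ∧ f (P b) = v, (Function.update hv c h b - 2) =
          ∑ b ∈ tops G n f P with c + 1 ≤ b ∧ f (P b) = v, (hv b - 2) := by
        refine Finset.sum_congr rfl fun b hb => ?_
        simp only [Finset.mem_filter] at hb
        rw [Function.update_of_ne (by omega)]
      rw [hs, hv', hself]
      split_ifs with h0 <;> omega
    · rw [hne v hv']
      congr 1
      refine Finset.sum_congr ?_ fun b hb => ?_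
      · ext b
        simp only [Finset.mem_filter, mem_tops]
        refine and_congr_right fun _ => ⟨fun h => ⟨by omega, h.2⟩, fun h => ⟨?_, h.2⟩⟩
        exact Nat.lt_of_le_of_ne h.1 fun h' => hv' (by rw [← h.2, h'])
      · simp only [Finset.mem_filter] at hb
        rw [Function.update_of_ne fun h' => hv' (by rw [← hb.2.2, h'])]
  · by_cases hbc : b = c
    · rw [hbc, Function.update_self]
      convert hF using 2 with v
      unfold blockBudget
      split_ifs with h1
      · rfl
      · exact hne _ h1
      · rfl
    · rw [Function.update_of_ne hbc]
      convert A.feasible b hb (by omega) using 2 with v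
      unfold blockBudget
      split_ifs with h1 h3
      · rfl
      · refine hne _ fun h4 => ?_
        rw [h4, D.mem_blockOf (hlt.trans hc.2.1)] at h3
        rcases h3 with h3 | h3
        · exact h1 (by rw [h4, h3])
        · by_cases h0 : P c = 0
          · rw [h0, R.zero] at h3
            omega
          · have := (D.isTop_rep R (Nat.pos_of_ne_zero h0) (hlt.trans hc.2.1)).2.1
            omega
      · rfl
  · by_cases hbc : b = c
    · subst hbc
      rw [Function.update_self]
      rcases hopt hb1 with h3 | h3
      · omega
      · have h4 : h - 2 < modality (τ b) (f (P b)) := by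
          by_contra h5
          exact h3 (A.feasible_of_le D R hG hc hτ (by omega))
        obtain ⟨q', hq'⟩ := even_modality (fun d => (hτ.embedding b hc).vertex_apply d) (f (P b))
        omega
    · rw [Function.update_of_ne hbc]
      exact A.optimal τ hτ b hb (by omega) hb1

/-- Around a vertex, the blocks that have it as their head account for the deducted amounts, and the
at most one other block for what remains. By `budget` the sum is exactly `m v - 2`. -/
theorem maxModality (A : Greedy G n f P rep m c μ hv) [Nontrivial V] (hc1 : c ≤ 1)
    (D : DfsOrder G n f P) (R : IsRep G n f P rep) (hG : Loopless G) (hc : SimplyConnected G)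
    (hm : ∀ v, Even (m v)) (hmono : ∀ v, m v = 0 → Monochromatic G v) : MaxModality G m := by
  classical
  have hf := fun b hb => (maxModality_blockOf_iff D R hG hb _).1
    (A.feasible b hb (hc1.trans hb.1))
  choose! τ hτ hle using hf
  rw [maxModality_iff_exists_isSolution D R hG hc hm]
  refine ⟨τ, hτ, fun v => ?_, hmono⟩
  obtain ⟨i, hi, rfl⟩ := D.surj v
  have hterm : ∀ b ∈ (tops G n f P).filter fun b => f i ∈ blockOf n f P rep b,
      modality (τ b) (f i) - 2 ≤ (if c ≤ b ∧ f (P b) = f i then hv b - 2 else 0) +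
        if rep i = b then μ (f i) - 2 else 0 := by
    intro b hb
    simp only [Finset.mem_filter, mem_tops] at hb
    obtain ⟨hb, hbi⟩ := hb
    have h1 := hle b hb (f i) hbi
    unfold blockBudget at h1
    split_ifs at h1 with h2
    · rw [if_pos ⟨hc1.trans hb.1, h2.symm⟩]
      omega
    · rw [D.mem_blockOf hi] at hbi
      rw [if_pos (hbi.resolve_left fun h3 => h2 (by rw [h3]))]
      omega
  refine (Finset.sum_le_sum hterm).trans ?_
  rw [Finset.sum_add_distrib, A.budget (f i), Nat.add_comm]
  refine Nat.add_le_add ?_ ?_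
  · rw [Finset.sum_ite_eq]
    split_ifs
    · exact le_rfl
    · exact Nat.zero_le _
  · rw [Finset.sum_ite, Finset.sum_const_zero, Nat.add_zero]
    refine Finset.sum_le_sum_of_subset fun b hb => ?_
    simp only [Finset.mem_filter] at hb ⊢
    exact ⟨hb.1.1, hb.2⟩

end Greedy

end Greedy

end KModal

namespace KModal

/-! ### The loop over all blocks. -/

section MainLoop

/-- Processes the blocks in the order of decreasing tops. -/
def processBlocks : Prog := .for 4 13
  (.assign 5 (𝔯 13 ⊖ 𝔯 4) ;;
   .cond (𝔯 0) (.cond (𝔯 5 ⊖ .read 12 (𝔯 5)) .skip processBlock) .skip)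

variable {V : Type} [Fintype V] {G : Digraph V} {D : Layout} {P : ℕ → ℕ} {f : ℕ → V} {m : V → ℕ}
  {k : ℕ} {T : Subroutine}

/-- The record in memory encodes the block with `blockBudget`, so the subroutine is correct on it
and every admissible cost function `r` bounds its time. The predicate on `R` keeps `r` arbitrary. -/
theorem Decomposed.callSpec (X : Decomposed G D P f) (hG : Loopless G)
    (hm : IsMaxModalityFunction k m) (hT : TestsBiconnected k T) {c : ℕ} {μ : V → ℕ} {hv : ℕ → ℕ}
    (A : Greedy G D.n f P D.rep m (c + 1) μ hv) (hc : IsTop G D.n f P c) :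
    CallSpec T D (fun i => μ (f i)) c (P c)
      (fun h => MaxModality (induce G (blockOf D.n f P D.rep c))
        (fun v => blockBudget D.n f P D.rep m μ c h v))
      (fun R => ∃ r, BoundsBlockTimes T G m r ∧ r (blockOf D.n f P D.rep c) = R) := by
  intro s H hh hle h1
  obtain ⟨hb1, hb2⟩ := A.blockBudget_spec X.order (fun v => (hm v).1) hc hh hle h1
  have hlt := X.order.isParent.lt c hc.1 hc.2.1
  have henc := X.encodes_block hG hc (s := s) (a := 19) H
    (m := blockBudget D.n f P D.rep m μ c (s.arr 19 (D.off c + 2))) (fun i hi hic => by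
      have hne : f i ≠ f (P c) := fun h => by
        have := X.le_of_rep_eq hi hic
        have := X.order.inj i hi (P c) (hlt.trans hc.2.1) h
        omega
      rw [blockBudget, if_neg hne, if_pos ((X.order.mem_blockOf hi).2 (Or.inr hic))])
    (by rw [blockBudget, if_pos rfl])
  constructor
  · exact hT _ (induce G (blockOf D.n f P D.rep c)) _ (fun v => hG v)
      (X.order.biconnected_blockOf X.isRep hc)
      (fun v => ⟨(hb1 v).1, (hb1 v).2.trans (hm v).2⟩) _ henc
  · rintro R ⟨r, hr, rfl⟩
    refine hr _ ?_ _ hb1 hb2 _ henc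
    classical
    rw [(X.order.blockSequence X.isRep hG).blocks_eq hG]
    exact Finset.mem_image_of_mem _ (mem_tops.2 hc)

-- Iteration `i` treats the candidate `n - 1 - i`, so before it the tops from `n - i` on are done.
-- After a rejection register `0` is `0` and no further call is made.
open Classical in
theorem wp_processBlocks (X : Decomposed G D P f) (hG : Loopless G) (hk : 2 ≤ k)
    (hm : IsMaxModalityFunction k m) (hT : TestsBiconnected k T) [Nontrivial V]
    (hcon : SimplyConnected G) {s : State} (h13 : s.reg 13 = D.n - 1) (h7 : s.arr 7 = P)
    (h12 : s.arr 12 = D.rep) (h17 : s.arr 17 = D.off)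
    (h18 : ∀ i < D.n, s.arr 18 i = D.vaddr i)
    (H : D.Stored (fun i => m (f i)) D.n D.e (s.arr 19))
    (h0 : s.reg 0 = if ∀ v, m v = 0 → Monochromatic G v then 1 else 0) :
    WP T processBlocks s fun s' t => (s'.reg 0 = if MaxModality G m then 1 else 0) ∧
      ∀ r, BoundsBlockTimes T G m r →
        t ≤ 300 * D.n + 6 + 102 * Nat.log 2 k * ∑ β ∈ blocks G, r β := by
  have hlog : 1 ≤ Nat.log 2 k := Nat.log_pos (by omega) hk
  have hn : 0 < D.n := by
    obtain ⟨v⟩ := (simplyConnected_iff G).1 hcon |>.2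
    obtain ⟨i, hi, -⟩ := X.order.surj v
    omega
  refine (WP.for_time (n := D.n - 1) (I := fun i s' t =>
    (∀ r, BoundsBlockTimes T G m r → t ≤ 300 * i + 2 + 102 * Nat.log 2 k *
      ∑ b ∈ tops G D.n f P with D.n - i ≤ b, r (blockOf D.n f P D.rep b)) ∧
    ((s'.reg 0 = 0 ∧ ¬ MaxModality G m) ∨ (s'.reg 0 = 1 ∧ (∀ v, m v = 0 → Monochromatic G v) ∧
      ∃ μ hv, Greedy G D.n f P D.rep m (D.n - i) μ hv ∧
        D.Stored (fun i => μ (f i)) D.n D.e (s'.arr 19)))) h13 (by decide) (by decide) (by decide)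
    ?_ ?_).mono ?_
  · refine ⟨fun r _ => by omega, ?_⟩
    split_ifs at h0 with hmono
    · refine Or.inr ⟨by simp [h0], hmono, m, fun _ => 0, ?_, H⟩
      exact Greedy.init (fun v => (hm v).1) _
    · refine Or.inl ⟨by simp [h0], fun hM => hmono ?_⟩
      obtain ⟨τ, hτ⟩ := (maxModality_iff_exists_isSolution X.order X.isRep hG hcon
        fun v => (hm v).1).1 hM
      exact hτ.monochromatic
  · rintro i s1 t hi hx hF ⟨ht, hI⟩
    have e7 : s1.arr 7 = P := by rw [hF.1 7 (by decide), h7]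
    have e12 : s1.arr 12 = D.rep := by rw [hF.1 12 (by decide), h12]
    have e17 : s1.arr 17 = D.off := by rw [hF.1 17 (by decide), h17]
    have e18 : s1.arr 18 = s.arr 18 := hF.1 18 (by decide)
    have e13 : s1.reg 13 = D.n - 1 := by rw [hF.2 13 (by decide), h13]
    obtain ⟨c, hc⟩ : ∃ c, c = D.n - 1 - i := ⟨_, rfl⟩
    have hc0 : 0 < c := by omega
    have hcn : c < D.n := by omega
    have hni : D.n - i = c + 1 := by omega
    have hni' : D.n - (i + 1) = c := by omega
    rw [hni] at hI ht
    rw [hni']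
    have htime : ∀ τ, τ ≤ 250 → ∀ r, BoundsBlockTimes T G m r → t + τ + 8 ≤
        300 * (i + 1) + 2 + 102 * Nat.log 2 k *
          ∑ b ∈ tops G D.n f P with c ≤ b, r (blockOf D.n f P D.rep b) := by
      intro τ hτ r hr
      have h1 := ht r hr
      have h2 : ∑ b ∈ tops G D.n f P with c + 1 ≤ b, r (blockOf D.n f P D.rep b) ≤
          ∑ b ∈ tops G D.n f P with c ≤ b, r (blockOf D.n f P D.rep b) := by
        refine Finset.sum_le_sum_of_subset fun b hb => ?_
        simp only [Finset.mem_filter] at hb ⊢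
        exact ⟨hb.1, by omega⟩
      have h3 := Nat.mul_le_mul_left (102 * Nat.log 2 k) h2
      omega
    simp only [wp_seq, wp_assign, wp_cond, wp_skip, Expr.eval, Expr.cost, setReg_reg, setReg_arr]
    simp only [e13, hx, ← hc, e12, if_true, show (0 : ℕ) = 5 ↔ False by decide, if_false]
    rcases hI with ⟨hr0, hno⟩ | ⟨hr0, hmono, μ, hv, A, HS⟩
    · refine ⟨fun h => absurd hr0 h, fun _ => ⟨htime _ (by omega), Or.inl ⟨?_, hno⟩⟩⟩
      simpa using hr0
    refine ⟨fun _ => ⟨fun hrep => ?_, fun hrep => ?_⟩, fun h => by omega⟩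
    · refine ⟨htime _ (by omega), Or.inr ⟨by simpa using hr0, hmono, μ, hv, A.skip fun h => ?_,
        by simpa using HS⟩⟩
      have := X.isRep.top c h
      omega
    have hrc : D.rep c = c := by
      have := X.numbered.rep_le c hcn
      omega
    have hct := (X.isTop_iff hc0 hcn).2 hrc
    have hlt := X.order.isParent.lt c hct.1 hcn
    have hspec := X.callSpec hG hm hT A hct
    refine (wp_processBlock X.numbered X.separated hc0 hcn hrc (hlt.trans hcn) hspec (by simpa using e17)
      (by simp) (by simp [e7]) (by simpa [e18] using h18 _ (hlt.trans hcn)) (by simpa using HS)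
      (A.even _)).mono ?_
    rintro s' t' ⟨ht', hres⟩
    refine ⟨fun r hr => ?_, ?_⟩
    · have h1 := ht r hr
      have h2 := ht' _ ⟨r, hr, rfl⟩
      -- `r` bounds the positive time of an actual call, so the constant overhead of an iteration
      -- can be charged to it.
      have hpos : 1 ≤ r (blockOf D.n f P D.rep c) := by
        have hw := HS.write_head X.numbered X.separated hcn hrc le_rfl le_rfl (v := μ (f (P c)))
        have := (hspec (s1.setArr 19 (D.off c + 2) (μ (f (P c)))) (by simpa using hw)
          (by simpa using A.even _) (by simp) (fun _ => by simp)).2 _ ⟨r, hr, rfl⟩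
        exact (T.time_pos _).trans_le this
      have hsz : Nat.size (μ (f (P c)) / 2 - 1) ≤ Nat.log 2 k := by
        rw [Nat.size_le]
        have h3 := (A.le (fun v => (hm v).1) (f (P c))).trans (hm _).2
        have h4 := Nat.lt_pow_succ_log_self (b := 2) (by omega) k
        rw [pow_succ] at h4
        have := Nat.pow_pos (n := Nat.log 2 k) (show 0 < 2 by omega)
        omega
      have hins : ((tops G D.n f P).filter fun b => c ≤ b) =
          insert c ((tops G D.n f P).filter fun b => c + 1 ≤ b) := by
        ext b
        simp only [Finset.mem_insert, Finset.mem_filter, mem_tops]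
        constructor
        · rintro ⟨h1, h2⟩
          by_cases hbc : b = c
          · exact Or.inl hbc
          · exact Or.inr ⟨h1, by omega⟩
        · rintro (rfl | ⟨h1, h2⟩)
          · exact ⟨hct, le_rfl⟩
          · exact ⟨h1, by omega⟩
      rw [hins, Finset.sum_insert (by simp), Nat.mul_add (102 * Nat.log 2 k)]
      -- At most `log k + 1 ≤ 2 log k` calls, as `k ≥ 2`, each of cost at most `R + 50 ≤ 51 R`; this
      -- is the constant `102`.
      have h5 : (Nat.size (μ (f (P c)) / 2 - 1) + 1) * (r (blockOf D.n f P D.rep c) + 50) ≤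
          (2 * Nat.log 2 k) * (51 * r (blockOf D.n f P D.rep c)) :=
        Nat.mul_le_mul (by omega) (by omega)
      have h6 : (2 * Nat.log 2 k) * (51 * r (blockOf D.n f P D.rep c)) =
          102 * Nat.log 2 k * r (blockOf D.n f P D.rep c) := by ring
      omega
    · rcases hres with ⟨h1, h2⟩ | ⟨h1, h, h2, h3, h4, h5, h6, h7'⟩
      · refine Or.inl ⟨by simpa using h1, fun hM => h2 ?_⟩
        obtain ⟨τ, hτ⟩ := (maxModality_iff_exists_isSolution X.order X.isRep hG hcon
          fun v => (hm v).1).1 hM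
        exact A.feasible_budget X.order X.isRep hG hct hτ
      · refine Or.inr ⟨by simpa [hr0] using h1, hmono, _, _,
          A.step X.order X.isRep hG hct h2 h3 h4 h5 h6, ?_⟩
        refine ⟨h7'.sizes, fun i hi => ?_, h7'.edge⟩
        rw [h7'.vert i hi]
        by_cases hip : i = P c
        · rw [hip, Function.update_self, Function.update_self]
        · rw [Function.update_of_ne hip, Function.update_of_ne fun h =>
            hip (X.order.inj i hi _ (hlt.trans hcn) h)]
  · rintro s' t ⟨t', rfl, ⟨ht, hI⟩, -, -⟩
    have hn1 : D.n - (D.n - 1) = 1 := by omega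
    rw [hn1] at hI ht
    constructor
    · rcases hI with ⟨h1, h2⟩ | ⟨h1, hmono, μ, hv, A, -⟩
      · rw [if_neg h2, h1]
      · rw [if_pos (A.maxModality le_rfl X.order X.isRep hG hcon (fun v => (hm v).1) hmono), h1]
    · intro r hr
      have h1 := ht r hr
      have h2 : ∑ b ∈ tops G D.n f P with 1 ≤ b, r (blockOf D.n f P D.rep b) ≤
          ∑ β ∈ blocks G, r β := by
        have hB := X.order.blockSequence X.isRep hG
        rw [hB.blocks_eq hG, Finset.sum_image fun i hi j hj h => hB.injOn hi hj h]
        exact Finset.sum_le_sum_of_subset (Finset.filter_subset _ _)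
      have h3 := Nat.mul_le_mul_left (102 * Nat.log 2 k) h2
      omega

end MainLoop

end KModal

namespace KModal

/-! ### The linear-time phases of the procedure. -/

section Phases

/-- Reads the input and performs the depth-first search. -/
def readInput : Prog :=
  .assign 1 (.read 0 (𝔠 0)) ;; .assign 2 (.read 0 (𝔠 1)) ;; .assign 3 (𝔯 2 ⊹ 𝔯 2) ;;
  .assign 13 (𝔯 1 ⊖ 𝔠 1) ;; .assign 0 (𝔠 1) ;;
  readEdges ;; buildLists ;; checkMonochromatic ;; search

open Classical in
theorem wp_readInput {T : Subroutine} {s : State} {n e : ℕ} (hn : s.arr 0 0 = n)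
    (he : s.arr 0 1 = e) (hn0 : 0 < n) {U W : ℕ → ℕ}
    (hU : ∀ j < e, s.arr 0 (2 + n + (j + j)) = U j) (hW : ∀ j < e, s.arr 0 (3 + n + (j + j)) = W j)
    (hlt : ∀ j < e, U j < n ∧ W j < n) (hzero : ∀ a, a ≠ 0 → ∀ i, s.arr a i = 0)
    (hconn : ∀ X : ℕ → Prop, X 0 → (∀ j < e, X (U j) ↔ X (W j)) → ∀ v < n, X v) :
    WP T readInput s fun s' t => (t ≤ 1000 * (n + e) + 1000 ∧ s'.reg 1 = n ∧ s'.reg 2 = e ∧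
      s'.reg 13 = n - 1 ∧
      (s'.reg 0 = if ∀ i < n, s.arr 0 (2 + i) = 0 → (∃ j < e, U j = i) → ¬ ∃ j < e, W j = i then 1
        else 0) ∧
      (∀ j < e, s'.arr 1 j = U j ∧ s'.arr 2 j = W j) ∧
      (∀ i < n, s'.arr 6 i < n ∧ s'.arr 5 (s'.arr 6 i) = i + 1) ∧
      (∀ v < n, 0 < s'.arr 5 v ∧ s'.arr 5 v - 1 < n ∧ s'.arr 6 (s'.arr 5 v - 1) = v) ∧
      IsParent n (s'.arr 7) ∧
      (∀ i, 0 < i → i < n → ∃ j < e, (U j = s'.arr 6 (s'.arr 7 i) ∧ W j = s'.arr 6 i) ∨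
        (U j = s'.arr 6 i ∧ W j = s'.arr 6 (s'.arr 7 i))) ∧
      ∀ x y, x < y → y < n → (∃ j < e, (U j = s'.arr 6 x ∧ W j = s'.arr 6 y) ∨
        (U j = s'.arr 6 y ∧ W j = s'.arr 6 x)) → Anc (s'.arr 7) x y) ∧ Frame readInput s s' := by
  refine WP.frame ?_
  simp only [readInput, wp_seq, wp_assign, Expr.eval, Expr.cost]
  simp only [setReg_arr, setReg_reg, hn, he]
  set s0 := ((((s.setReg 1 n).setReg 2 e).setReg 3 _).setReg 13 _).setReg 0 1 with hs0
  have a0 : s0.arr = s.arr := rfl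
  have r0 : s0.reg 0 = 1 := by simp [hs0]
  have r1 : s0.reg 1 = n := by simp [hs0]
  have r2 : s0.reg 2 = e := by simp [hs0]
  have r3 : s0.reg 3 = e + e := by simp [hs0]
  have r13 : s0.reg 13 = n - 1 := by simp [hs0]
  refine (wp_readEdges r1 r2 (fun j hj => hU j hj) (fun j hj => hW j hj)
    (fun v => hzero 20 (by decide) v) (fun v => hzero 21 (by decide) v)).mono ?_
  rintro s1 t1 ⟨ht1, ⟨h1, h20, h21⟩, hF1⟩
  refine (wp_buildLists (N := e + e) (by rw [hF1.2 3 (by decide), r3]) (fun v => by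
    rw [hF1.1 3 (by decide)]; exact hzero 3 (by decide) v)).mono ?_
  rintro s2 t2 ⟨ht2, hL, hF2⟩
  refine (wp_checkMonochromatic (n := n) (by
    rw [hF2.2 1 (by decide), hF1.2 1 (by decide), r1])).mono ?_
  rintro s3 t3 ⟨ht3, hr0, hF3⟩
  have b1 : s3.arr 1 = s1.arr 1 := by rw [hF3.1 1 (by decide), hF2.1 1 (by decide)]
  have b2 : s3.arr 2 = s1.arr 2 := by rw [hF3.1 2 (by decide), hF2.1 2 (by decide)]
  have b3 : s3.arr 3 = s2.arr 3 := hF3.1 3 (by decide)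
  have b4 : s3.arr 4 = s2.arr 4 := hF3.1 4 (by decide)
  have hcases : ∀ h < e + e, ∃ j < e, (h = j ∨ h = e + j) := fun h hh => by
    by_cases hlt : h < e
    · exact ⟨h, hlt, Or.inl rfl⟩
    · exact ⟨h - e, by omega, Or.inr (by omega)⟩
  refine (wp_search (n := n) (N := e + e) hn0 (by rwa [b1, b3, b4]) (fun v => by
    rw [hF3.1 5 (by decide), hF2.1 5 (by decide), hF1.1 5 (by decide)]
    exact hzero 5 (by decide) v) ?_ ?_).frame.mono ?_
  · intro h hh
    obtain ⟨j, hj, rfl | rfl⟩ := hcases h hh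
    · rw [b2, (h1 _ hj).2.1]
      exact (hlt _ hj).2
    · rw [b2, (h1 _ hj).2.2.2]
      exact (hlt _ hj).1
  · intro X hX0 hX
    refine hconn X hX0 fun j hj => ⟨fun h => ?_, fun h => ?_⟩
    · have := hX j (by omega)
      rw [b1, b2, (h1 j hj).1, (h1 j hj).2.1] at this
      exact this h
    · have := hX (e + j) (by omega)
      rw [b1, b2, (h1 j hj).2.2.1, (h1 j hj).2.2.2] at this
      exact this h
  · rintro s4 t4 ⟨⟨ht4, R⟩, hF4⟩
    rw [b1, b2] at R
    refine ⟨by omega, ?_, ?_, ?_, ?_, ?_, R.vert_spec, R.num_spec, R.isParent, ?_, ?_⟩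
    · rw [hF4.2 1 (by decide), hF3.2 1 (by decide), hF2.2 1 (by decide), hF1.2 1 (by decide), r1]
    · rw [hF4.2 2 (by decide), hF3.2 2 (by decide), hF2.2 2 (by decide), hF1.2 2 (by decide), r2]
    · rw [hF4.2 13 (by decide), hF3.2 13 (by decide), hF2.2 13 (by decide), hF1.2 13 (by decide),
        r13]
    · rw [hF4.2 0 (by decide), hr0, hF2.2 0 (by decide), hF1.2 0 (by decide), r0]
      rw [hF2.1 0 (by decide), hF2.1 20 (by decide), hF2.1 21 (by decide), hF1.1 0 (by decide)]
      refine if_congr (forall_congr' fun i => forall_congr' fun _ => forall_congr' fun _ =>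
        imp_congr (h20 i) ?_) rfl rfl
      rw [← h21 i, not_not]
    · intro j hj
      rw [hF4.1 1 (by decide), hF4.1 2 (by decide), b1, b2]
      exact ⟨(h1 j hj).1, (h1 j hj).2.1⟩
    · intro i h0 hi
      obtain ⟨h, hh, e1, e2⟩ := R.joined i h0 hi
      obtain ⟨j, hj, rfl | rfl⟩ := hcases h hh
      · rw [(h1 _ hj).1] at e1
        rw [(h1 _ hj).2.1] at e2
        exact ⟨_, hj, Or.inl ⟨e1, e2⟩⟩
      · rw [(h1 _ hj).2.2.1] at e1
        rw [(h1 _ hj).2.2.2] at e2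
        exact ⟨_, hj, Or.inr ⟨e2, e1⟩⟩
    · intro x y hxy hy hj
      have hx := (R.vert_spec x (hxy.trans hy)).2
      have hy' := (R.vert_spec y hy).2
      have key : ∀ h < e + e, s1.arr 1 h = s4.arr 6 x → s1.arr 2 h = s4.arr 6 y →
          Anc (s4.arr 7) x y := by
        intro h hh e1 e2
        have := R.anc h hh
        rw [e1, e2, hx, hy'] at this
        exact this (by omega) (by omega)
      obtain ⟨j, hj, ⟨e1, e2⟩ | ⟨e1, e2⟩⟩ := hj
      · exact key j (by omega) ((h1 j hj).1.trans e1) ((h1 j hj).2.1.trans e2)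
      · exact key (e + j) (by omega) ((h1 j hj).2.2.1.trans e2) ((h1 j hj).2.2.2.trans e1)

/-- Finds the tops of the blocks. -/
def findTops : Prog := initLow ;; renumber ;; pushLow ;; computeReps

theorem wp_findTops {T : Subroutine} {s : State} {n e : ℕ} (h1 : s.reg 1 = n) (h2 : s.reg 2 = e)
    (h13 : s.reg 13 = n - 1) {U W : ℕ → ℕ} (hU : ∀ j < e, s.arr 5 (s.arr 1 j) - 1 = U j)
    (hW : ∀ j < e, s.arr 5 (s.arr 2 j) - 1 = W j) (hlt : ∀ j < e, U j < n ∧ W j < n)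
    (hP : IsParent n (s.arr 7)) (h12 : s.arr 12 0 = 0) :
    WP T findTops s fun s' t => (t ≤ 1000 * (n + e) + 1000 ∧
      (∀ j < e, s'.arr 8 j = U j ∧ s'.arr 9 j = W j ∧ s'.arr 22 j = max (U j) (W j)) ∧
      ∃ low, IsLow n e U W (s.arr 7) low 1 ∧ s'.arr 12 0 = 0 ∧ ∀ i, 0 < i → i < n →
        s'.arr 12 i = if s.arr 7 i ≤ low i then i else s'.arr 12 (s.arr 7 i)) ∧
      Frame findTops s s' := by
  refine WP.frame ?_
  simp only [findTops, wp_seq]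
  refine (wp_initLow h1).mono ?_
  rintro s1 t1 ⟨ht1, hlow, hF1⟩
  have c5 : s1.arr 5 = s.arr 5 := hF1.1 5 (by decide)
  have c1 : s1.arr 1 = s.arr 1 := hF1.1 1 (by decide)
  have c2 : s1.arr 2 = s.arr 2 := hF1.1 2 (by decide)
  refine (wp_renumber (P := s.arr 7) (by rw [hF1.2 2 (by decide), h2]) hlow
    (by rwa [c5, c1]) (by rwa [c5, c2]) hlt).mono ?_
  rintro s2 t2 ⟨ht2, ⟨h8, hL⟩, hF2⟩
  have d7 : s2.arr 7 = s.arr 7 := by rw [hF2.1 7 (by decide), hF1.1 7 (by decide)]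
  refine (wp_pushLow (n := n) (by rw [hF2.2 13 (by decide), hF1.2 13 (by decide), h13])
    (by rwa [d7]) (by rwa [d7])).mono ?_
  rintro s3 t3 ⟨ht3, hL3, hF3⟩
  have e7 : s3.arr 7 = s.arr 7 := by rw [hF3.1 7 (by decide), d7]
  refine (wp_computeReps (n := n) (by
    rw [hF3.2 13 (by decide), hF2.2 13 (by decide), hF1.2 13 (by decide), h13]) (by rwa [e7])
    (by rw [hF3.1 12 (by decide), hF2.1 12 (by decide), hF1.1 12 (by decide), h12])).mono ?_
  rintro s4 t4 ⟨ht4, ⟨h0, hr⟩, hF4⟩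
  refine ⟨by omega, ?_, s3.arr 11, by rwa [d7] at hL3, h0, by rwa [e7] at hr⟩
  rw [hF4.1 8 (by decide), hF4.1 9 (by decide), hF4.1 22 (by decide), hF3.1 8 (by decide),
    hF3.1 9 (by decide), hF3.1 22 (by decide)]
  exact h8

/-- Stores the encodings of the blocks in array `19`. -/
def storeBlocks : Prog :=
  fillBuckets 1 (.read 12 (𝔯 4)) 13 14 ;; fillBuckets 2 (.read 12 (.read 22 (𝔯 4))) 15 16 ;;
  storeSizes ;; storeVerts ;; storeEdges

theorem wp_storeBlocks {T : Subroutine} {s : State} {n e : ℕ} (h1 : s.reg 1 = n) (h2 : s.reg 2 = e)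
    {U W M : ℕ → ℕ} (h8 : ∀ j < e, s.arr 8 j = U j ∧ s.arr 9 j = W j ∧ s.arr 22 j = max (U j) (W j))
    (hlt : ∀ j < e, U j < n ∧ W j < n)
    (hrep : ∀ i < n, s.arr 12 i ≤ i ∧ s.arr 12 (s.arr 12 i) = s.arr 12 i)
    (hUW : ∀ j < e, s.arr 12 (U j) ≤ s.arr 12 (max (U j) (W j)) ∧
      s.arr 12 (W j) ≤ s.arr 12 (max (U j) (W j)))
    (hM : ∀ i < n, s.arr 0 (2 + s.arr 6 i) = M i)
    (h14 : ∀ i, s.arr 14 i = 0) (h16 : ∀ i, s.arr 16 i = 0) :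
    WP T storeBlocks s fun s' t => (t ≤ 1000 * (n + e) + 1000 ∧
      ∃ D : Layout, D.n = n ∧ D.e = e ∧ D.rep = s.arr 12 ∧ D.U = U ∧ D.W = W ∧
        (∀ j, D.key j = s.arr 12 (max (U j) (W j))) ∧ D.Numbered ∧ D.Separated ∧
        s'.arr 17 = D.off ∧ (∀ i < n, s'.arr 18 i = D.vaddr i) ∧
        D.Stored M n e (s'.arr 19)) ∧ Frame storeBlocks s s' := by
  refine WP.frame ?_
  simp only [storeBlocks, wp_seq]
  refine (wp_fillBuckets (κ := s.arr 12) h1 (by decide) (by decide) (by decide) (by decide)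
    (fun s' i _ hx ha => by simp [hx, ha 12 (by decide) (by decide)]) h14).mono ?_
  rintro s1 t1 ⟨ht1, hB1, hF1⟩
  have c12 : s1.arr 12 = s.arr 12 := hF1.1 12 (by decide)
  have c22 : s1.arr 22 = s.arr 22 := hF1.1 22 (by decide)
  refine (wp_fillBuckets (n := e) (κ := fun j => s.arr 12 (max (U j) (W j)))
    (by rw [hF1.2 2 (by decide), h2]) (by decide) (by decide) (by decide) (by decide)
    (fun s' i hi hx ha => by
      simp [hx, ha 12 (by decide) (by decide), ha 22 (by decide) (by decide), c12, c22,
        (h8 i hi).2.2])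
    (fun b => by rw [hF1.1 16 (by decide), h16])).mono ?_
  rintro s2 t2 ⟨ht2, hB2, hF2⟩
  -- The addresses `0` are placeholders until `storeSizes` has computed the real ones.
  let D0 : Layout := ⟨n, e, s.arr 12, s1.arr 13, s1.arr 14, fun j => s.arr 12 (max (U j) (W j)),
    s2.arr 15, s2.arr 16, fun _ => 0, U, W⟩
  have d1 : s2.reg 1 = n := by rw [hF2.2 1 (by decide), hF1.2 1 (by decide), h1]
  have d2 : s2.reg 2 = e := by rw [hF2.2 2 (by decide), hF1.2 2 (by decide), h2]
  have d12 : s2.arr 12 = s.arr 12 := by rw [hF2.1 12 (by decide), c12]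
  have d13 : s2.arr 13 = s1.arr 13 := hF2.1 13 (by decide)
  have d14 : s2.arr 14 = s1.arr 14 := hF2.1 14 (by decide)
  refine (wp_storeSizes (D := D0) d1 d12 d14 rfl (fun i hi => (hrep i hi).1) M).mono ?_
  rintro s3 t3 ⟨ht3, ⟨hS, hst⟩, hF3⟩
  let D : Layout := {D0 with off := s3.arr 17}
  have N : D.Numbered := ⟨hB1, hB2, fun i hi => (hrep i hi).1, fun i hi => (hrep i hi).2,
    fun j hj => by
      obtain ⟨hu, hw⟩ := hlt j hj
      exact (hrep _ (max_lt hu hw)).1.trans_lt (max_lt hu hw), fun j hj => by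
      obtain ⟨hu, hw⟩ := hlt j hj
      exact (hrep _ (max_lt hu hw)).2⟩
  have e12 : s3.arr 12 = s.arr 12 := by rw [hF3.1 12 (by decide), d12]
  have e13 : s3.arr 13 = s1.arr 13 := by rw [hF3.1 13 (by decide), d13]
  refine (wp_storeVerts (D := D) (by rw [hF3.2 1 (by decide), d1]) e12 e13 rfl N hS (M := M)
    (fun i hi => by
      rw [hF3.1 0 (by decide), hF3.1 6 (by decide), hF2.1 0 (by decide), hF2.1 6 (by decide),
        hF1.1 0 (by decide), hF1.1 6 (by decide)]
      exact hM i hi) hst).mono ?_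
  rintro s4 t4 ⟨ht4, ⟨h18, hst4⟩, hF4⟩
  have f : ∀ a, a ∈ [8, 9, 22] → s4.arr a = s.arr a := by
    intro a ha
    simp only [List.mem_cons, List.not_mem_nil, or_false] at ha
    rcases ha with rfl | rfl | rfl
    all_goals rw [hF4.1 _ (by decide), hF3.1 _ (by decide), hF2.1 _ (by decide),
      hF1.1 _ (by decide)]
  have f12 : s4.arr 12 = s.arr 12 := by rw [hF4.1 12 (by decide), e12]
  refine (wp_storeEdges (D := D) (by rw [hF4.2 2 (by decide), hF3.2 2 (by decide), d2])
    f12 (by rw [hF4.1 13 (by decide), e13])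
    (by rw [hF4.1 14 (by decide), hF3.1 14 (by decide), d14])
    (by rw [hF4.1 15 (by decide), hF3.1 15 (by decide)]) (by rw [hF4.1 17 (by decide)])
    (fun j hj => by rw [f 8 (by decide)]; exact (h8 j hj).1)
    (fun j hj => by rw [f 9 (by decide)]; exact (h8 j hj).2.1)
    (fun j hj => by rw [f 22 (by decide), (h8 j hj).2.2]) hUW N hS hst4).mono ?_
  rintro s5 t5 ⟨ht5, hst5, hF5⟩
  have gn : D.n = n := rfl
  have ge : D.e = e := rfl
  have gn0 : D0.n = n := rfl
  refine ⟨by omega, D, rfl, rfl, rfl, rfl, rfl, fun _ => rfl, N, hS, ?_, ?_, hst5⟩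
  · rw [hF5.1 17 (by decide), hF4.1 17 (by decide)]
  · rw [hF5.1 18 (by decide)]
    exact h18

end Phases

end KModal

namespace KModal

/-! ### Assembling the procedure. -/

section Main

/-- The procedure `TestSimplyConnected`. -/
def testSimplyConnected : Prog := readInput ;; findTops ;; storeBlocks ;; processBlocks

variable {V : Type}

theorem monochromatic_iff {G : Digraph V} {v : V} :
    Monochromatic G v ↔ ((∃ y, G.Adj v y) → ¬ ∃ y, G.Adj y v) := by
  constructor
  · rintro h ⟨y, hy⟩ ⟨z, hz⟩
    have := h ⟨⟨(v, y), hy⟩, true⟩ ⟨⟨(z, v), hz⟩, false⟩ rfl rfl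
    exact absurd this (by simp [Dart.outgoing])
  · rintro h ⟨⟨⟨x, y⟩, hxy⟩, b⟩ ⟨⟨⟨x', y'⟩, hxy'⟩, b'⟩ h1 h2
    cases b <;> cases b' <;> simp only [Dart.vertex, Dart.outgoing] at h1 h2 ⊢
    · subst h1
      simp at h2
      subst h2
      exact absurd ⟨x, hxy⟩ (h ⟨y', hxy'⟩)
    · simp at h1 h2
      subst h1
      subst h2
      exact absurd ⟨x', hxy'⟩ (h ⟨y, hxy⟩)

/-- A single vertex has no edge ends and one trivial face, so Euler's formula reads `1 + 1 = 0 + 2`.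
The genus criterion does not cover this case. -/
theorem maxModality_of_subsingleton [Subsingleton V] [Nonempty V] {G : Digraph V}
    (hG : Loopless G) (m : V → ℕ) : MaxModality G m := by
  have hE : IsEmpty (Edge G) := ⟨fun p => hG p.1.1 (by
    have := p.2
    rwa [Subsingleton.elim p.1.2 p.1.1] at this)⟩
  have hV : Nat.card V = 1 := Nat.card_eq_one_iff_unique.2 ⟨inferInstance, inferInstance⟩
  have hcc : Nat.card G.toSimpleGraphInclusive.ConnectedComponent = 1 := by
    have : Subsingleton G.toSimpleGraphInclusive.ConnectedComponent :=
      ⟨SimpleGraph.ConnectedComponent.ind₂ fun _ _ => congrArg _ (Subsingleton.elim _ _)⟩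
    obtain ⟨v⟩ := ‹Nonempty V›
    exact Nat.card_eq_one_iff_unique.2
      ⟨this, ⟨G.toSimpleGraphInclusive.connectedComponentMk v⟩⟩
  refine ⟨⟨1, fun d => isEmptyElim d.1, ?_⟩, fun v => ?_⟩
  · have h1 : Nat.card {v : V // ∀ d : Dart G, d.vertex ≠ v} = 1 := by
      rw [← hV]
      exact Nat.card_congr (Equiv.subtypeUnivEquiv fun v d => isEmptyElim d.1)
    have h2 : IsEmpty (Quotient (Equiv.Perm.SameCycle.setoid ((1 : Equiv.Perm (Dart G)) * flip G))) :=
      ⟨fun q => by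
        induction q using Quotient.ind with
        | _ d => exact isEmptyElim d.1⟩
    rw [numFaces, h1, hV, hcc, Nat.card_of_isEmpty, Nat.card_of_isEmpty]
  · have : IsEmpty {d : Dart G // d.vertex = v ∧
        Dart.outgoing ((1 : Equiv.Perm (Dart G)) d) ≠ Dart.outgoing d} :=
      ⟨fun d => isEmptyElim d.1.1⟩
    rw [Embedding.modality, Nat.card_of_isEmpty]
    exact Nat.zero_le _

theorem wp_processBlocks_of_reg_eq_zero {T : Subroutine} {s : State} (h13 : s.reg 13 = 0) :
    WP T processBlocks s fun s' t => s'.reg 0 = s.reg 0 ∧ t ≤ 6 := by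
  refine (WP.for (n := 0) 0 (I := fun _ s' => s'.reg 0 = s.reg 0) h13 (by decide) (by decide)
    (by decide) (by simp) fun i s' hi => absurd hi (Nat.not_lt_zero i)).mono ?_
  rintro s' t ⟨h1, h2, -⟩
  exact ⟨h2, by omega⟩

-- Two numberings occur: `f0`, `U`, `W` come from the input and `f`, `U'`, `W'` from the search. The
-- phases are chained, and their results make up the structures `DfsOrder`, `IsRep` and
-- `Decomposed`.
open Classical in
theorem wp_testSimplyConnected [Fintype V] {G : Digraph V} {m : V → ℕ} {k : ℕ} {T : Subroutine}
    (hk : 2 ≤ k) (hT : TestsBiconnected k T) (hG : Loopless G) (hcon : SimplyConnected G)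
    (hm : IsMaxModalityFunction k m) {L : List ℕ} (hL : Encodes G m L) :
    WP T testSimplyConnected (initState L) fun s' t =>
      (s'.reg 0 = if MaxModality G m then 1 else 0) ∧ ∀ r, BoundsBlockTimes T G m r →
        t ≤ 10000 * size G + 102 * Nat.log 2 k * ∑ β ∈ blocks G, r β := by
  obtain ⟨n, e, g, u, w, hn, he, hL0, hL1, hLm, hLe, hadj, hinj⟩ := hL.exists_getD
  obtain ⟨hconn, ⟨v0⟩⟩ := (simplyConnected_iff G).1 hcon
  have hn0 : 0 < n := (g.symm v0).pos
  let f0 : ℕ → V := fun i => if h : i < n then g ⟨i, h⟩ else v0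
  let U : ℕ → ℕ := fun j => if h : j < e then u ⟨j, h⟩ else 0
  let W : ℕ → ℕ := fun j => if h : j < e then w ⟨j, h⟩ else 0
  have hf0 : ∀ i : Fin n, f0 i = g i := fun i => by simp [f0]
  have hUj : ∀ j : Fin e, U j = u j := fun j => by simp [U]
  have hWj : ∀ j : Fin e, W j = w j := fun j => by simp [W]
  have hlt : ∀ j < e, U j < n ∧ W j < n := fun j hj => by
    rw [hUj ⟨j, hj⟩, hWj ⟨j, hj⟩]
    exact ⟨(u _).2, (w _).2⟩
  have hf0inj : ∀ x < n, ∀ y < n, f0 x = f0 y → x = y := fun x hx y hy h => by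
    rw [hf0 ⟨x, hx⟩, hf0 ⟨y, hy⟩] at h
    exact Fin.ext_iff.1 (g.injective h)
  have hf0surj : ∀ v, ∃ i < n, f0 i = v := fun v => ⟨g.symm v, (g.symm v).2, by simp [hf0]⟩
  have hadj0 : ∀ x < n, ∀ y < n, G.Adj (f0 x) (f0 y) ↔ ∃ j < e, U j = x ∧ W j = y := by
    intro x hx y hy
    rw [hf0 ⟨x, hx⟩, hf0 ⟨y, hy⟩, hadj]
    constructor
    · rintro ⟨j, h1, h2⟩
      exact ⟨j, j.2, by rw [hUj, h1], by rw [hWj, h2]⟩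
    · rintro ⟨j, hj, h1, h2⟩
      exact ⟨⟨j, hj⟩, Fin.ext (by rw [← hUj]; exact h1), Fin.ext (by rw [← hWj]; exact h2)⟩
  have harr : ∀ i, (initState L).arr 0 i = L.getD i 0 := fun i => by simp [initState]
  have hzero : ∀ a, a ≠ 0 → ∀ i, (initState L).arr a i = 0 := fun a ha i => by
    simp [initState, ha]
  have hmi : ∀ i < n, (initState L).arr 0 (2 + i) = m (f0 i) := fun i hi => by
    rw [harr, hf0 ⟨i, hi⟩]
    exact hLm ⟨i, hi⟩
  have hjoined0 : ∀ x < n, ∀ y < n, Joined G (f0 x) (f0 y) ↔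
      ∃ j < e, (U j = x ∧ W j = y) ∨ (U j = y ∧ W j = x) := by
    intro x hx y hy
    rw [Joined, hadj0 x hx y hy, hadj0 y hy x hx]
    constructor
    · rintro (⟨j, hj, h⟩ | ⟨j, hj, h⟩)
      exacts [⟨j, hj, Or.inl h⟩, ⟨j, hj, Or.inr h⟩]
    · rintro ⟨j, hj, h | h⟩
      exacts [Or.inl ⟨j, hj, h⟩, Or.inr ⟨j, hj, h⟩]
  -- Connectivity in the form that the search needs: only everything is closed under the edges and
  -- contains vertex `0`.
  have hreach : ∀ X : ℕ → Prop, X 0 → (∀ j < e, X (U j) ↔ X (W j)) → ∀ v < n, X v := by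
    intro X hX0 hX v hv
    by_contra hXv
    obtain ⟨x, -, hxX, y, -, hyX, hxy⟩ := hconn {v | ∃ i < n, f0 i = v ∧ X i}
      ⟨f0 0, Set.mem_univ _, 0, hn0, rfl, hX0⟩ ⟨f0 v, Set.mem_univ _, fun ⟨i, hi, h, hXi⟩ =>
        hXv (hf0inj i hi v hv h ▸ hXi)⟩
    obtain ⟨i, hi, rfl, hXi⟩ := hxX
    obtain ⟨j, hj, rfl⟩ := hf0surj y
    have hXj : ¬ X j := fun h => hyX ⟨j, hj, rfl, h⟩
    obtain ⟨l, hl, ⟨h1, h2⟩ | ⟨h1, h2⟩⟩ := (hjoined0 i hi j hj).1 hxy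
    · exact hXj (h2 ▸ (hX l hl).1 (h1 ▸ hXi))
    · exact hXj (h1 ▸ (hX l hl).2 (h2 ▸ hXi))
  have hmono : (∀ i < n, (initState L).arr 0 (2 + i) = 0 → (∃ j < e, U j = i) →
      ¬ ∃ j < e, W j = i) ↔ ∀ v, m v = 0 → Monochromatic G v := by
    have hout : ∀ i < n, (∃ y, G.Adj (f0 i) y) ↔ ∃ j < e, U j = i := fun i hi => by
      constructor
      · rintro ⟨y, hy⟩
        obtain ⟨l, hl, rfl⟩ := hf0surj y
        obtain ⟨j, hj, h, -⟩ := (hadj0 i hi l hl).1 hy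
        exact ⟨j, hj, h⟩
      · rintro ⟨j, hj, h⟩
        exact ⟨f0 (W j), (hadj0 i hi _ (hlt j hj).2).2 ⟨j, hj, h, rfl⟩⟩
    have hin : ∀ i < n, (∃ y, G.Adj y (f0 i)) ↔ ∃ j < e, W j = i := fun i hi => by
      constructor
      · rintro ⟨y, hy⟩
        obtain ⟨l, hl, rfl⟩ := hf0surj y
        obtain ⟨j, hj, -, h⟩ := (hadj0 l hl i hi).1 hy
        exact ⟨j, hj, h⟩
      · rintro ⟨j, hj, h⟩
        exact ⟨f0 (U j), (hadj0 _ (hlt j hj).1 i hi).2 ⟨j, hj, rfl, h⟩⟩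
    constructor
    · intro h v hv
      obtain ⟨i, hi, rfl⟩ := hf0surj v
      rw [monochromatic_iff, hout i hi, hin i hi]
      exact h i hi ((hmi i hi).trans hv)
    · intro h i hi h0
      rw [← hout i hi, ← hin i hi, ← monochromatic_iff]
      exact h _ ((hmi i hi).symm.trans h0)
  simp only [testSimplyConnected, wp_seq]
  refine (wp_readInput (n := n) (e := e) (by rw [harr, hL0]) (by rw [harr, hL1]) hn0
    (fun j hj => by rw [harr, hUj ⟨j, hj⟩]; exact (hLe ⟨j, hj⟩).1)
    (fun j hj => by rw [harr, hWj ⟨j, hj⟩]; exact (hLe ⟨j, hj⟩).2) hlt hzero hreach).mono ?_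
  rintro s1 t1 ⟨⟨ht1, hr1, hr2, hr13, hr0, hown, hvert, hnum, hP, hpj, hanc⟩, hF1⟩
  rw [if_congr hmono rfl rfl] at hr0
  obtain ⟨num, hnum'⟩ : ∃ num, num = s1.arr 5 := ⟨_, rfl⟩
  obtain ⟨vert, hvert'⟩ : ∃ vert, vert = s1.arr 6 := ⟨_, rfl⟩
  obtain ⟨P, hP'⟩ : ∃ P, P = s1.arr 7 := ⟨_, rfl⟩
  rw [← hP'] at hP hpj hanc
  rw [← hvert'] at hvert hnum hpj hanc
  rw [← hnum'] at hvert hnum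
  have hvert_iff : ∀ v < n, ∀ x < n, v = vert x ↔ num v - 1 = x := by
    intro v hv x hx
    constructor
    · rintro rfl
      rw [(hvert x hx).2, Nat.add_sub_cancel]
    · rintro rfl
      exact (hnum v hv).2.2.symm
  let f : ℕ → V := fun i => f0 (vert i)
  let U' : ℕ → ℕ := fun j => num (U j) - 1
  let W' : ℕ → ℕ := fun j => num (W j) - 1
  have hlt' : ∀ j < e, U' j < n ∧ W' j < n := fun j hj =>
    ⟨(hnum _ (hlt j hj).1).2.1, (hnum _ (hlt j hj).2).2.1⟩
  have hUx : ∀ j < e, ∀ x < n, (U j = vert x ↔ U' j = x) := fun j hj x hx =>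
    hvert_iff _ (hlt j hj).1 x hx
  have hWx : ∀ j < e, ∀ x < n, (W j = vert x ↔ W' j = x) := fun j hj x hx =>
    hvert_iff _ (hlt j hj).2 x hx
  have hadj' : ∀ x < n, ∀ y < n, G.Adj (f x) (f y) ↔ ∃ j < e, U' j = x ∧ W' j = y := by
    intro x hx y hy
    rw [hadj0 _ (hvert x hx).1 _ (hvert y hy).1]
    refine exists_congr fun j => and_congr_right fun hj => ?_
    rw [hUx j hj x hx, hWx j hj y hy]
  have hjoined : ∀ x < n, ∀ y < n, Joined G (f x) (f y) ↔
      ∃ j < e, (U' j = x ∧ W' j = y) ∨ (U' j = y ∧ W' j = x) := by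
    intro x hx y hy
    rw [hjoined0 _ (hvert x hx).1 _ (hvert y hy).1]
    refine exists_congr fun j => and_congr_right fun hj => ?_
    rw [hUx j hj x hx, hWx j hj y hy, hUx j hj y hy, hWx j hj x hx]
  have O : DfsOrder G n f P := by
    refine ⟨hP, fun x hx y hy h => ?_, fun v => ?_, fun i h0 hi => ?_, fun i j hij hj h => ?_⟩
    · have h1 := hf0inj _ (hvert x hx).1 _ (hvert y hy).1 h
      have h2 := (hvert_iff _ (hvert x hx).1 y hy).1 h1
      rw [(hvert x hx).2] at h2
      omega
    · obtain ⟨i, hi, rfl⟩ := hf0surj v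
      exact ⟨num i - 1, (hnum i hi).2.1, by simp only [f, (hnum i hi).2.2]⟩
    · have hPi := (hP.lt i h0 hi).trans hi
      exact (hjoined0 _ (hvert _ hPi).1 _ (hvert i hi).1).2 (hpj i h0 hi)
    · exact hanc i j hij hj ((hjoined0 _ (hvert i (hij.trans hj)).1 _ (hvert j hj).1).1 h)
  refine (wp_findTops (U := U') (W := W') hr1 hr2 hr13
    (fun j hj => by rw [(hown j hj).1, ← hnum']) (fun j hj => by rw [(hown j hj).2, ← hnum'])
    hlt' (by rwa [← hP']) (by rw [hF1.1 12 (by decide)]; exact hzero 12 (by decide) 0)).mono ?_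
  rintro s2 t2 ⟨⟨ht2, h8, low, hlow, hrep0, hrep⟩, hF2⟩
  rw [← hP'] at hlow hrep
  have R : IsRep G n f P (s2.arr 12) := by
    refine ⟨hrep0, fun i hi => ?_, fun i h0 hi ht => ?_⟩
    · rw [hrep i hi.1 hi.2.1, if_pos ((hlow.isTop_iff hP hjoined hi.1 hi.2.1).1 hi)]
    · rw [hrep i h0 hi, if_neg fun h => ht ((hlow.isTop_iff hP hjoined h0 hi).2 h)]
  have hrepi : ∀ i < n, s2.arr 12 i ≤ i ∧ s2.arr 12 (s2.arr 12 i) = s2.arr 12 i := by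
    intro i hi
    rcases Nat.eq_zero_or_pos i with rfl | h0
    · rw [hrep0, hrep0]
      exact ⟨le_rfl, rfl⟩
    · obtain ⟨h1, h2, -⟩ := O.isTop_rep R h0 hi
      exact ⟨h2, R.top _ h1⟩
  -- The smaller end of an edge is represented by the same top, or it is the head and its top is
  -- smaller. This legitimates the test by truncated subtraction in `storeEdges`.
  have hle : ∀ x y, x < y → y < n → Joined G (f x) (f y) → s2.arr 12 x ≤ s2.arr 12 y := by
    intro x y hxy hy hj
    rcases O.mem_block_of_joined R hy hxy hj with h | h
    · have h1 := (O.isTop_rep R (by omega) hy).1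
      have h2 := hP.lt _ h1.1 h1.2.1
      have h3 := (hrepi x (hxy.trans hy)).1
      omega
    · exact h.le
  have hUW : ∀ j < e, s2.arr 12 (U' j) ≤ s2.arr 12 (max (U' j) (W' j)) ∧
      s2.arr 12 (W' j) ≤ s2.arr 12 (max (U' j) (W' j)) := by
    intro j hj
    obtain ⟨hu, hw⟩ := hlt' j hj
    have hJ : Joined G (f (U' j)) (f (W' j)) :=
      (hjoined _ hu _ hw).2 ⟨j, hj, Or.inl ⟨rfl, rfl⟩⟩
    rcases lt_trichotomy (U' j) (W' j) with h | h | h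
    · rw [max_eq_right h.le]
      exact ⟨hle _ _ h hw hJ, le_rfl⟩
    · rw [h, max_self]
      exact ⟨le_rfl, le_rfl⟩
    · rw [max_eq_left h.le]
      exact ⟨le_rfl, hle _ _ h hu hJ.symm⟩
  have k6 : s2.arr 6 = vert := by rw [hF2.1 6 (by decide), hvert']
  have k0 : s2.arr 0 = (initState L).arr 0 := by rw [hF2.1 0 (by decide), hF1.1 0 (by decide)]
  have hz2 : ∀ a ∈ [14, 16], ∀ i, s2.arr a i = 0 := by
    intro a ha i
    simp only [List.mem_cons, List.not_mem_nil, or_false] at ha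
    rcases ha with rfl | rfl
    all_goals
      rw [hF2.1 _ (by decide), hF1.1 _ (by decide)]
      exact hzero _ (by decide) i
  refine (wp_storeBlocks (n := n) (e := e) (U := U') (W := W') (M := fun i => m (f i))
    (by rw [hF2.2 1 (by decide), hr1]) (by rw [hF2.2 2 (by decide), hr2]) h8 hlt' hrepi hUW
    (fun i hi => by rw [k6, k0, hmi _ (hvert i hi).1]) (hz2 14 (by simp)) (hz2 16 (by simp))).mono ?_
  rintro s3 t3 ⟨⟨ht3, D, hDn, hDe, hDr, hDU, hDW, hDk, N, S, h17, h18, hst⟩, hF3⟩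
  have hq0 : s3.reg 0 = if ∀ v, m v = 0 → Monochromatic G v then 1 else 0 := by
    rw [hF3.2 0 (by decide), hF2.2 0 (by decide), hr0]
  have hq13 : s3.reg 13 = n - 1 := by
    rw [hF3.2 13 (by decide), hF2.2 13 (by decide), hr13]
  have hsize : size G = n + e := by rw [size, hn, he]
  rcases subsingleton_or_nontrivial V with hV | hV
  · have hV' : Nonempty V := ⟨v0⟩
    have hM := maxModality_of_subsingleton hG m
    have hn1 : n = 1 := by rw [← hn, Nat.card_eq_one_iff_unique]; exact ⟨hV, hV'⟩
    refine (wp_processBlocks_of_reg_eq_zero (by rw [hq13, hn1])).mono ?_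
    rintro s4 t4 ⟨h0, ht4⟩
    refine ⟨?_, fun r _ => by omega⟩
    rw [h0, hq0, if_pos hM, if_pos]
    intro v _
    refine monochromatic_iff.2 fun ⟨y, hy⟩ => absurd hy ?_
    rw [Subsingleton.elim y v]
    exact hG v
  · have X : Decomposed G D P f := by
      subst hDn hDe
      refine ⟨O, hDr ▸ R, N, S, ?_, ?_, ?_, ?_⟩
      · rwa [hDU, hDW]
      · intro j _
        rw [hDk, hDr, hDU, hDW]
      · rwa [hDU, hDW]
      · rw [hDU, hDW]
        intro i hi j hj h1 h2
        have e1 : U i = U j := by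
          rw [← (hnum _ (hlt i hi).1).2.2, ← (hnum _ (hlt j hj).1).2.2]
          exact congrArg vert h1
        have e2 : W i = W j := by
          rw [← (hnum _ (hlt i hi).2).2.2, ← (hnum _ (hlt j hj).2).2.2]
          exact congrArg vert h2
        rw [hUj ⟨i, hi⟩, hUj ⟨j, hj⟩] at e1
        rw [hWj ⟨i, hi⟩, hWj ⟨j, hj⟩] at e2
        exact Fin.ext_iff.1 (hinj _ _ (Fin.ext e1) (Fin.ext e2))
    refine (wp_processBlocks X hG hk hm hT hcon (by rw [hq13, hDn])
      (by rw [hF3.1 7 (by decide), hF2.1 7 (by decide), hP'])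
      (by rw [hF3.1 12 (by decide), hDr]) h17 (by rwa [hDn]) (by rwa [hDn, hDe]) hq0).mono ?_
    rintro s4 t4 ⟨h0, ht4⟩
    refine ⟨h0, fun r hr => ?_⟩
    have := ht4 r hr
    omega

end Main

end KModal

theorem mainTheorem12 :
    ∃ (TestSimplyConnected : KModal.Prog) (C : ℝ),
      ∀ (k : ℕ), 0 < k → Even k →
      ∀ (TestBiconnected : KModal.Subroutine), KModal.TestsBiconnected k TestBiconnected →
      ∀ (V : Type) [Fintype V] (G : Digraph V) (m : V → ℕ),
        KModal.Loopless G → KModal.SimplyConnected G → KModal.IsMaxModalityFunction k m →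
      ∀ L : List ℕ, KModal.Encodes G m L →
        ∃ (s : KModal.State) (t : ℕ),
          KModal.Exec TestBiconnected TestSimplyConnected (KModal.initState L) s t ∧
          (KModal.MaxModality G m → s.reg 0 = 1) ∧
          (¬ KModal.MaxModality G m → s.reg 0 = 0) ∧
          ∀ r : Finset V → ℕ, KModal.BoundsBlockTimes TestBiconnected G m r →
            (t : ℝ) ≤ C * ((KModal.size G : ℝ) +
              Real.logb 2 (k : ℝ) * ∑ β ∈ KModal.blocks G, (r β : ℝ)) := by
  refine ⟨KModal.testSimplyConnected, 10000, fun k hk0 hk T hT V _ G m hG hcon hm L hL => ?_⟩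
  have hk2 : 2 ≤ k := by
    obtain ⟨q, rfl⟩ := hk
    omega
  obtain ⟨s, t, hexec, h0, ht⟩ := KModal.wp_testSimplyConnected hk2 hT hG hcon hm hL
  refine ⟨s, t, hexec, fun h => by rw [h0, if_pos h], fun h => by rw [h0, if_neg h],
    fun r hr => ?_⟩
  have h1 : (t : ℝ) ≤ 10000 * KModal.size G +
      102 * Nat.log 2 k * ∑ β ∈ KModal.blocks G, (r β : ℝ) := by
    exact_mod_cast ht r hr
  -- The count is in terms of the rounded logarithm, which is below the real one; the constant
  -- `10000` covers both the linear part and the factor `102`.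
  have h2 : (Nat.log 2 k : ℝ) ≤ Real.logb 2 k := Real.natLog_le_logb k 2
  have h3 : (0 : ℝ) ≤ ∑ β ∈ KModal.blocks G, (r β : ℝ) :=
    Finset.sum_nonneg fun β _ => Nat.cast_nonneg _
  have h4 := mul_le_mul_of_nonneg_right h2 h3
  have h5 : (0 : ℝ) ≤ Nat.log 2 k * ∑ β ∈ KModal.blocks G, (r β : ℝ) :=
    mul_nonneg (Nat.cast_nonneg _) h3
  nlinarith
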